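/- Recall the following notions. An instance of Maximum Colored Densest $k$-Subgraph is a graph $G$ with a partition of its vertex set into $k$ independent sets $V_1,\dots,V_k$, each of size $n\ge 1$; $\mathrm{OPT}$ is the maximum number of edges of a subgraph of $G$ induced by a set that contains exactly one vertex of every $V_i$. Let $s_i$ be the number of indices $j$ such that $G$ has an edge between $V_i$ and $V_j$, and let $\sigma=\sum_{i=1}^k s_i/2$. The Parameterized Inapproximability Hypothesis (PIH) states that there is a constant $0<c<1$ such that no algorithm of running time $f(k)\,n^{O(1)}$ distinguishes between the instances with $\mathrm{OPT}=\sigma$ and those with $\mathrm{OPT}<c\cdot\sigma$. In Maximum Node-Disjoint Paths we are given an $n$-vertex graph $G$ and a set $\mathcal M\subseteq\binom{V(G)}{2}$ of demand pairs; $\mathrm{OPT}$ is the maximum number of demand pairs that can be joined simultaneously by pairwise vertex-disjoint paths (endpoints included). For $0<\rho\le 1$, a $\rho$-approximation algorithm computes a number $v$ (for instance the number of paths of a solution that it returns) with $\rho\cdot\mathrm{OPT}\le v\le\mathrm{OPT}$. Let $\mathrm{pw}$ and $\mathrm{fvs}$ denote the pathwidth and the feedback vertex number of $G$. Theorem. Assume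 the PIH. Then (1) there is a constant $0<c'<1$ such that Maximum Node-Disjoint Paths has no $c'$-approximation algorithm of running time $f(\mathrm{pw},\mathrm{fvs})\,n^{O(1)}$, for any function $f$; (2) consequently, there are no functions $f,g$ such that for every rational $0<\varepsilon<1$ Maximum Node-Disjoint Paths has a $(1-\varepsilon)$-approximation algorithm of running time $f(\mathrm{pw},\mathrm{fvs},\varepsilon)\,n^{g(\varepsilon)}$. In particular it has no FPT approximation scheme parameterized by pathwidth, not even one of running time $f(\mathrm{pw},\varepsilon)\,n^{g(\varepsilon)}$. This holds both when $f$ ranges over all functions, in the PIH and in the conclusion, and when $f$ ranges (for each fixed $\varepsilon$ in (2)) over the computable functions, in the PIH and in the conclusion. -/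

import Mathlib

/-! ### Random access machines with a step count -/

namespace RAM

/-- Memory of a random access machine: registers, and arrays with indirect addressing (a program
mentions only finitely many of both), all cells holding natural numbers. -/
structure State where
  reg : ℕ → ℕ
  arr : ℕ → ℕ → ℕ

/-- Write `x` into register `r`. -/
def State.setReg (s : State) (r x : ℕ) : State :=
  { s with reg := Function.update s.reg r x }

/-- Write `x` into cell `i` of array `A`. -/
def State.setArr (s : State) (A i x : ℕ) : State :=
  { s with arr := Function.update s.arr A (Function.update (s.arr A) i x) }

/-- Programs of a random access machine. The arithmetic is addition and truncated subtraction
(no multiplication), so that unit-cost time is polynomially related to Turing machine time. -/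
inductive Prog where
  | skip : Prog
  /-- `reg r := c` -/
  | const (r c : ℕ) : Prog
  /-- `reg r := reg a + reg b` -/
  | add (r a b : ℕ) : Prog
  /-- `reg r := max (reg a - reg b) 0` -/
  | sub (r a b : ℕ) : Prog
  /-- `reg r := arr A (reg i)` -/
  | load (r A i : ℕ) : Prog
  /-- `arr A (reg i) := reg a` -/
  | store (A i a : ℕ) : Prog
  | seq (p q : Prog) : Prog
  /-- if `reg a ≠ 0` then `p` else `q` -/
  | ite (a : ℕ) (p q : Prog) : Prog
  /-- while `reg a ≠ 0` do `p` -/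
  | loop (a : ℕ) (p : Prog) : Prog

/-- `Exec p s t s'`: started in `s`, the program `p` halts in `s'` after exactly `t` steps. Every
elementary instruction and every evaluation of a test is one step. -/
inductive Exec : Prog → State → ℕ → State → Prop where
  | skip (s : State) : Exec .skip s 1 s
  | const (r c : ℕ) (s : State) : Exec (.const r c) s 1 (s.setReg r c)
  | add (r a b : ℕ) (s : State) : Exec (.add r a b) s 1 (s.setReg r (s.reg a + s.reg b))
  | sub (r a b : ℕ) (s : State) : Exec (.sub r a b) s 1 (s.setReg r (s.reg a - s.reg b))
  | load (r A i : ℕ) (s : State) : Exec (.load r A i) s 1 (s.setReg r (s.arr A (s.reg i)))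
  | store (A i a : ℕ) (s : State) : Exec (.store A i a) s 1 (s.setArr A (s.reg i) (s.reg a))
  | seq {p q : Prog} {s s' s'' : State} {t t' : ℕ} :
      Exec p s t s' → Exec q s' t' s'' → Exec (.seq p q) s (t + t') s''
  | ite_true {a : ℕ} {p q : Prog} {s s' : State} {t : ℕ} :
      s.reg a ≠ 0 → Exec p s t s' → Exec (.ite a p q) s (t + 1) s'
  | ite_false {a : ℕ} {p q : Prog} {s s' : State} {t : ℕ} :
      s.reg a = 0 → Exec q s t s' → Exec (.ite a p q) s (t + 1) s'
  | loop_done {a : ℕ} {p : Prog} {s : State} :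
      s.reg a = 0 → Exec (.loop a p) s 1 s
  | loop_step {a : ℕ} {p : Prog} {s s' s'' : State} {t t' : ℕ} :
      s.reg a ≠ 0 → Exec p s t s' → Exec (.loop a p) s' t' s'' →
      Exec (.loop a p) s (t + t' + 1) s''

open Classical in
/-- Contents of an array holding the `N × N` zero-one matrix of the relation `R` on
`{0, …, N - 1}` in row-major order; all other cells are `0`. -/
noncomputable def matrixArray (N : ℕ) (R : ℕ → ℕ → Prop) : ℕ → ℕ :=
  fun x => if x < N * N ∧ R (x / N) (x % N) then 1 else 0

end RAM

/-! ### Maximum Colored Densest k-Subgraph and the Parameterized Inapproximability Hypothesis -/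

/-- An instance of Maximum Colored Densest `k`-Subgraph: a graph whose vertex set is partitioned
into `k` independent sets `V_i = {(i, p) : p < n}`, each of size `n ≥ 1`. -/
structure ColoredInstance where
  k : ℕ
  n : ℕ
  n_pos : 0 < n
  G : SimpleGraph (Fin k × Fin n)
  indep : ∀ i p q, ¬ G.Adj (i, p) (i, q)

namespace ColoredInstance

/-- The number of edges of the subgraph induced by the vertices `(i, h i)`, one per color. -/
noncomputable def value (I : ColoredInstance) (h : Fin I.k → Fin I.n) : ℕ :=
  (I.G.induce (Set.range fun i => (i, h i))).edgeSet.ncard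

/-- The maximum number of edges induced by a choice of exactly one vertex per color. -/
noncomputable def opt (I : ColoredInstance) : ℕ :=
  Finset.univ.sup I.value

/-- `s_i`: the number of colors `j` such that some edge joins `V_i` and `V_j`. -/
noncomputable def colorDegree (I : ColoredInstance) (i : Fin I.k) : ℕ :=
  {j : Fin I.k | ∃ p q, I.G.Adj (i, p) (j, q)}.ncard

/-- `σ = ∑ i, s_i / 2`. -/
noncomputable def sigma (I : ColoredInstance) : ℝ :=
  ∑ i, (I.colorDegree i : ℝ) / 2

/-- The input on a random access machine: `k` in register `0`, `n` in register `1`, and in array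
`0` the adjacency matrix, where the vertex `(i, p)` has number `i * n + p`. -/
noncomputable def input (I : ColoredInstance) : RAM.State where
  reg := fun r => if r = 0 then I.k else if r = 1 then I.n else 0
  arr := fun A => if A = 0 then
      RAM.matrixArray (I.k * I.n) fun u v =>
        ∃ (i j : Fin I.k) (p q : Fin I.n),
          u = i * I.n + p ∧ v = j * I.n + q ∧ I.G.Adj (i, p) (j, q)
    else fun _ => 0

end ColoredInstance

/-- The Parameterized Inapproximability Hypothesis: for some constant `0 < c < 1`, no algorithm of
running time `f(k) n^{O(1)}` distinguishes (answering by the value of register `0`) the instances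
with `OPT = σ` from those with `OPT < c σ`. Here `f` ranges over all functions if
`onlyComputable = false`, and over the computable ones if `onlyComputable = true`. -/
def PIH (onlyComputable : Bool) : Prop :=
  ∃ c : ℝ, 0 < c ∧ c < 1 ∧
    ¬ ∃ (A : RAM.Prog) (f : ℕ → ℕ) (d : ℕ),
      (onlyComputable = true → Computable f) ∧
      ∀ I : ColoredInstance, ∃ (t : ℕ) (s : RAM.State),
        RAM.Exec A I.input t s ∧ t ≤ f I.k * (I.n + 1) ^ d ∧
        ((I.opt : ℝ) = I.sigma → s.reg 0 = 1) ∧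
        ((I.opt : ℝ) < c * I.sigma → s.reg 0 = 0)

/-! ### Pathwidth and feedback vertex number -/

namespace SimpleGraph

/-- `X 0, …, X (r - 1)` is a path decomposition of `G`. -/
structure IsPathDecomposition {V : Type*} (G : SimpleGraph V) {r : ℕ}
    (X : Fin r → Finset V) : Prop where
  vertex_mem : ∀ v, ∃ i, v ∈ X i
  edge_mem : ∀ u v, G.Adj u v → ∃ i, u ∈ X i ∧ v ∈ X i
  interval : ∀ v i j l, i ≤ j → j ≤ l → v ∈ X i → v ∈ X l → v ∈ X j

/-- The pathwidth: the least `w` such that `G` has a path decomposition whose bags have at most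
`w + 1` elements. -/
noncomputable def pathwidth {V : Type*} (G : SimpleGraph V) : ℕ :=
  sInf {w | ∃ (r : ℕ) (X : Fin r → Finset V),
    G.IsPathDecomposition X ∧ ∀ i, (X i).card ≤ w + 1}

/-- The feedback vertex number: the least size of a vertex set whose deletion leaves a forest. -/
noncomputable def feedbackVertexNumber {V : Type*} (G : SimpleGraph V) : ℕ :=
  sInf {m | ∃ S : Finset V, S.card = m ∧ (G.induce {v | v ∉ S}).IsAcyclic}

/-- All pairs in `D` can be routed in `G` simultaneously: for every pair there is a path joining
its two elements, and these paths are pairwise vertex-disjoint, endpoints included. -/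
def Routable {V : Type*} (G : SimpleGraph V) (D : Finset (Sym2 V)) : Prop :=
  ∃ (a b : D → V) (P : ∀ d : D, G.Path (a d) (b d)),
    (∀ d : D, s(a d, b d) = (d : Sym2 V)) ∧
    ∀ d e : D, d ≠ e → List.Disjoint (P d).1.support (P e).1.support

end SimpleGraph

/-! ### Maximum Node-Disjoint Paths -/

/-- An instance of Maximum Node-Disjoint Paths: a graph on `n` vertices and a set of demands, each
of which is an unordered pair of distinct vertices. -/
structure NDPInstance where
  n : ℕ
  G : SimpleGraph (Fin n)
  demands : Finset (Sym2 (Fin n))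
  not_isDiag : ∀ d ∈ demands, ¬ d.IsDiag

namespace NDPInstance

open Classical in
/-- The maximum number of demands that can be routed. -/
noncomputable def opt (J : NDPInstance) : ℕ :=
  (J.demands.powerset.filter J.G.Routable).sup Finset.card

/-- The input on a random access machine: `n` in register `0`, the adjacency matrix in array `0`
and the matrix of the demands in array `1`. -/
noncomputable def input (J : NDPInstance) : RAM.State where
  reg := fun r => if r = 0 then J.n else 0
  arr := fun A =>
    if A = 0 then RAM.matrixArray J.n fun u v =>
      ∃ (hu : u < J.n) (hv : v < J.n), J.G.Adj ⟨u, hu⟩ ⟨v, hv⟩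
    else if A = 1 then RAM.matrixArray J.n fun u v =>
      ∃ (hu : u < J.n) (hv : v < J.n), s(⟨u, hu⟩, ⟨v, hv⟩) ∈ J.demands
    else fun _ => 0

end NDPInstance

/-- `A` approximates Maximum Node-Disjoint Paths within the factor `ρ` and takes at most `T J` steps
on the instance `J`: it halts with a number `v` in register `0` such that `ρ OPT ≤ v ≤ OPT`. Nothing
is asked of the remaining memory, where an algorithm may leave `v` disjoint paths. -/
def IsNDPApproximation (A : RAM.Prog) (ρ : ℝ) (T : NDPInstance → ℕ) : Prop :=
  ∀ J : NDPInstance, ∃ (t : ℕ) (s : RAM.State),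
    RAM.Exec A J.input t s ∧ t ≤ T J ∧ ρ * (J.opt : ℝ) ≤ (s.reg 0 : ℝ) ∧ s.reg 0 ≤ J.opt

/-- Maximum Node-Disjoint Paths has a `ρ`-approximation algorithm of running time
`f(pw, fvs) n^{O(1)}`. -/
def HasFPTApproximation (onlyComputable : Bool) (ρ : ℝ) : Prop :=
  ∃ (A : RAM.Prog) (f : ℕ × ℕ → ℕ) (d : ℕ),
    (onlyComputable = true → Computable f) ∧
    IsNDPApproximation A ρ fun J =>
      f (J.G.pathwidth, J.G.feedbackVertexNumber) * (J.n + 1) ^ d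

/-- Maximum Node-Disjoint Paths has `(1 - ε)`-approximation algorithms, one for each rational
`0 < ε < 1`, of running time `f(pw, fvs, ε) n^{g(ε)}`. -/
def HasApproximationScheme (onlyComputable : Bool) : Prop :=
  ∃ (f : ℚ → ℕ × ℕ → ℕ) (g : ℚ → ℕ),
    (onlyComputable = true → ∀ ε, Computable (f ε)) ∧
    ∀ ε : ℚ, 0 < ε → ε < 1 → ∃ A : RAM.Prog,
      IsNDPApproximation A (1 - (ε : ℝ)) fun J =>
        f ε (J.G.pathwidth, J.G.feedbackVertexNumber) * (J.n + 1) ^ g ε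

/-! A colored instance is a constraint problem: one variable per color, one binary constraint per
pair of joined colors, and σ is the number of these pairs (`sigma_eq`). A gap-preserving reduction
turns it into disjoint paths with parameters bounded in k.

Bounded degree. Color i is replaced by two sides of w² copies each, where deg i ≤ w² ≤ 2 deg i.
Equality constraints run along an expander on the torus (ℤ/w)², and each constraint of i is moved to
a copy of its own. A variable then takes part in at most one constraint in each of six slots, and
the size of the network is linear in σ. By expansion (`Torus.exists_label`), few violated equalities
leave few copies that disagree with the most frequent label of their color.

Path gadget. A variable x has two lines of n blocks of 8 positions, line 2x and line 2x+1. Special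
vertex (x,0) joins the start of the first line to the end of the second, and (x,7) joins the end of
the first to the start of the second. The demands of x for the value p link positions 8p and 8p+7
crosswise. Routing both of them through (x,0) and (x,7) fills everything except positions 8p+1, …,
8p+6 of either line. A constraint in slot o has a special vertex (x,o) attached to position o of the
blocks of values that occur in allowed pairs, and a demand for each allowed pair. Its demand can be
met through (x,o) when the two free blocks form an allowed pair. The special vertices number O(k³),
and without them only disjoint paths remain, so pathwidth and feedback vertex number are bounded in
k.

Gap. Every demand joins two different lines, hence every path uses a special vertex and at most L
paths exist, where L counts the attached special vertices. If OPT = σ, then L paths exist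
(`card_live_le_opt`). Conversely, with L − s paths all but 2s special vertices are alone on their
path, which forces values (`exists_values`) violating at most 32s constraints and labels missing at
most 32800s pairs of colors (`card_pairs_add_le`). Since L ≤ 64σ, a ratio 1 − 1/D close to 1
separates the two cases of the PIH.

Running time. `PolyTime` is a small calculus of functions of the instance and of finitely many
relevant variables, closed under arithmetic, lookup in the input and bounded sums. Variable 0 is the
innermost bound one. The description of the network is an expression of this calculus, so
`exists_reduction` can put its construction in front of any approximation algorithm. -/

/-! ### Polynomially bounded functions -/

/-- `T` is bounded by a polynomial. -/
def PolyBounded (T : ℕ → ℕ) : Prop := ∃ C e, ∀ M, T M ≤ C * (M + 1) ^ e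

namespace PolyBounded

theorem const (c : ℕ) : PolyBounded fun _ => c := ⟨c, 0, by simp⟩

theorem id : PolyBounded fun M => M := ⟨1, 1, by simp⟩

theorem add {S T : ℕ → ℕ} : PolyBounded S → PolyBounded T → PolyBounded fun M => S M + T M := by
  rintro ⟨C, e, h⟩ ⟨C', e', h'⟩
  refine ⟨C + C', e + e', fun M => ?_⟩
  have h1 : (M + 1) ^ e ≤ (M + 1) ^ (e + e') := Nat.pow_le_pow_right (by omega) (by omega)
  have h2 : (M + 1) ^ e' ≤ (M + 1) ^ (e + e') := Nat.pow_le_pow_right (by omega) (by omega)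
  calc S M + T M ≤ C * (M + 1) ^ e + C' * (M + 1) ^ e' := add_le_add (h M) (h' M)
    _ ≤ C * (M + 1) ^ (e + e') + C' * (M + 1) ^ (e + e') := by gcongr
    _ = _ := by ring

theorem mul {S T : ℕ → ℕ} : PolyBounded S → PolyBounded T → PolyBounded fun M => S M * T M := by
  rintro ⟨C, e, h⟩ ⟨C', e', h'⟩
  refine ⟨C * C', e + e', fun M => ?_⟩
  calc S M * T M ≤ (C * (M + 1) ^ e) * (C' * (M + 1) ^ e') := Nat.mul_le_mul (h M) (h' M)
    _ = _ := by ring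

theorem comp {S T : ℕ → ℕ} : PolyBounded S → PolyBounded T → PolyBounded fun M => S (T M) := by
  rintro ⟨C, e, h⟩ ⟨C', e', h'⟩
  refine ⟨C * (C' + 1) ^ e, e' * e, fun M => ?_⟩
  have h1 : 1 ≤ (M + 1) ^ e' := Nat.one_le_pow _ _ (by omega)
  calc S (T M) ≤ C * (T M + 1) ^ e := h _
    _ ≤ C * ((C' + 1) * (M + 1) ^ e') ^ e := by
        gcongr
        calc T M + 1 ≤ C' * (M + 1) ^ e' + (M + 1) ^ e' := add_le_add (h' M) h1
          _ = _ := by ring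
    _ = _ := by rw [mul_pow, pow_mul]; ring

end PolyBounded

/-! ### Functions computed by random access machines in polynomial time -/

namespace RAM

/-- Register `c` counts down from `N`, so the test fails exactly after `N` rounds; `Inv j` describes
the memory after `j` of them. -/
theorem exec_for {c : ℕ} {body : Prog} {T N : ℕ} (Inv : ℕ → State → Prop)
    (hc : ∀ j s, Inv j s → s.reg c = N - j)
    (hb : ∀ j s, j < N → Inv j s → ∃ t s', Exec body s t s' ∧ t ≤ T ∧ Inv (j + 1) s')
    {s : State} (h0 : Inv 0 s) :
    ∃ t s', Exec (.loop c body) s t s' ∧ t ≤ N * (T + 1) + 1 ∧ Inv N s' := by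
  suffices H : ∀ m j s, m + j = N → Inv j s →
      ∃ t s', Exec (.loop c body) s t s' ∧ t ≤ m * (T + 1) + 1 ∧ Inv N s' from
    H N 0 s (by omega) h0
  intro m
  induction m with
  | zero =>
    intro j s hj hs
    obtain rfl : j = N := by omega
    exact ⟨1, s, .loop_done (by rw [hc _ _ hs]; omega), by omega, hs⟩
  | succ m ih =>
    intro j s hj hs
    obtain ⟨t, s', h1, h2, h3⟩ := hb j s (by omega) hs
    obtain ⟨t', s'', h4, h5, h6⟩ := ih (j + 1) s' (by omega) h3
    exact ⟨t + t' + 1, s'', .loop_step (by rw [hc _ _ hs]; omega) h1 h4,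
      by rw [Nat.succ_mul]; omega, h6⟩

/-- The memory `s` holds the input `I`. -/
def Holds (I : ColoredInstance) (s : State) : Prop :=
  s.reg 0 = I.k ∧ s.reg 1 = I.n ∧ s.arr 0 = I.input.arr 0

theorem holds_input (I : ColoredInstance) : Holds I I.input := ⟨rfl, rfl, rfl⟩

theorem Holds.of_eq {I : ColoredInstance} {s s' : State} (h : Holds I s)
    (h0 : s'.reg 0 = s.reg 0) (h1 : s'.reg 1 = s.reg 1) (ha : s'.arr 0 = s.arr 0) : Holds I s' :=
  ⟨h0.trans h.1, h1.trans h.2.1, ha.trans h.2.2⟩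

/-- A function of an instance of Maximum Colored Densest `k`-Subgraph and of variables is computed
by a program in polynomial time, whatever registers `Γ` hold the variables. The result is in
register `d`, and the arrays and the registers below `d` are left unchanged. -/
def PolyTime (F : ColoredInstance → (ℕ → ℕ) → ℕ) : Prop :=
  ∃ B T, PolyBounded B ∧ PolyBounded T ∧
    (∀ I ρ M, I.k ≤ M → I.n ≤ M → (∀ i, ρ i ≤ M) → F I ρ ≤ B M) ∧
    ∀ (Γ : ℕ → ℕ) d, 2 ≤ d → (∀ i, Γ i < d) → ∃ P, ∀ I s M, Holds I s → I.k ≤ M → I.n ≤ M →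
      (∀ i, s.reg (Γ i) ≤ M) → ∃ t s', Exec P s t s' ∧ t ≤ T M ∧ s'.arr = s.arr ∧
        (∀ r < d, s'.reg r = s.reg r) ∧ s'.reg d = F I fun i => s.reg (Γ i)

namespace PolyTime

variable {F G H : ColoredInstance → (ℕ → ℕ) → ℕ}

theorem const (c : ℕ) : PolyTime fun _ _ => c := by
  refine ⟨fun _ => c, fun _ => 1, .const c, .const 1, fun _ _ _ _ _ _ => le_rfl, fun Γ d _ _ =>
    ⟨.const d c, fun I s M _ _ _ _ => ⟨1, _, .const _ _ _, le_rfl, rfl, ?_, ?_⟩⟩⟩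
  · intro r hr
    simp [State.setReg, Function.update_of_ne hr.ne]
  · simp [State.setReg]

/-- There is no move instruction: a register is copied by adding a register that has been set to 0.
-/
theorem copy {g : ColoredInstance → (ℕ → ℕ) → ℕ} (src : (ℕ → ℕ) → ℕ → ℕ)
    (hsrc : ∀ Γ d, 2 ≤ d → (∀ i, Γ i < d) → src Γ d < d)
    (hle : ∀ I ρ M, I.k ≤ M → I.n ≤ M → (∀ i, ρ i ≤ M) → g I ρ ≤ M)
    (hg : ∀ Γ d I s, Holds I s → s.reg (src Γ d) = g I fun i => s.reg (Γ i)) :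
    PolyTime g := by
  refine ⟨fun M => M, fun _ => 2, .id, .const 2, hle, fun Γ d hd hΓ =>
    ⟨.seq (.const (d + 1) 0) (.add d (src Γ d) (d + 1)), fun I s M hI _ _ _ =>
      ⟨1 + 1, _, .seq (.const _ _ _) (.add _ _ _ _), le_rfl, rfl, ?_, ?_⟩⟩⟩
  · intro r hr
    simp [State.setReg, Function.update_of_ne hr.ne,
      Function.update_of_ne (show r ≠ d + 1 by omega)]
  · have := hsrc Γ d hd hΓ
    simp [State.setReg, Function.update_of_ne (show src Γ d ≠ d + 1 by omega), hg Γ d I s hI]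

theorem var (i : ℕ) : PolyTime fun _ ρ => ρ i :=
  copy (fun Γ _ => Γ i) (fun _ _ _ h => h i) (fun _ _ _ _ _ h => h i) fun _ _ _ _ _ => rfl

theorem k : PolyTime fun I _ => I.k :=
  copy (fun _ _ => 0) (fun _ _ h _ => by omega) (fun _ _ _ h _ _ => h) fun _ _ _ _ h => h.1

theorem n : PolyTime fun I _ => I.n :=
  copy (fun _ _ => 1) (fun _ _ h _ => by omega) (fun _ _ _ _ h _ => h) fun _ _ _ _ h => h.2.1

/-- The second operand is evaluated with result register `d + 1`, so the first one survives in
register `d`. -/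
theorem binary (op : ℕ → ℕ → ℕ) (hop : ∀ a b, op a b ≤ a + b) (ins : ℕ → ℕ → ℕ → Prog)
    (hins : ∀ r a b s, Exec (ins r a b) s 1 (s.setReg r (op (s.reg a) (s.reg b))))
    (hF : PolyTime F) (hG : PolyTime G) : PolyTime fun I ρ => op (F I ρ) (G I ρ) := by
  obtain ⟨B, T, hB, hT, hFB, hF⟩ := hF
  obtain ⟨B', T', hB', hT', hGB, hG⟩ := hG
  refine ⟨_, _, hB.add hB', (hT.add hT').add (.const 1), fun I ρ M h1 h2 h3 =>
    (hop _ _).trans (add_le_add (hFB I ρ M h1 h2 h3) (hGB I ρ M h1 h2 h3)), fun Γ d hd hΓ => ?_⟩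
  obtain ⟨P, hP⟩ := hF Γ d hd hΓ
  obtain ⟨Q, hQ⟩ := hG Γ (d + 1) (by omega) fun i => (hΓ i).trans (by omega)
  refine ⟨.seq P (.seq Q (ins d d (d + 1))), fun I s M hI hk hn hM => ?_⟩
  obtain ⟨t, s', h1, h2, h3, h4, h5⟩ := hP I s M hI hk hn hM
  have hΓs : ∀ i, s'.reg (Γ i) = s.reg (Γ i) := fun i => h4 _ (hΓ i)
  obtain ⟨t', s'', h6, h7, h8, h9, h10⟩ := hQ I s' M
    (hI.of_eq (h4 _ (by omega)) (h4 _ (by omega)) (by rw [h3])) hk hn (fun i => by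
      rw [hΓs]; exact hM i)
  refine ⟨_, _, .seq h1 (.seq h6 (hins _ _ _ _)), by omega, by simp [State.setReg, h8, h3], ?_, ?_⟩
  · intro r hr
    simp [State.setReg, Function.update_of_ne hr.ne, h9 r (by omega), h4 r hr]
  · simp [State.setReg, h9 d (by omega), h5, h10, hΓs]

theorem add (hF : PolyTime F) (hG : PolyTime G) : PolyTime fun I ρ => F I ρ + G I ρ :=
  binary _ (fun _ _ => le_rfl) .add .add hF hG

theorem sub (hF : PolyTime F) (hG : PolyTime G) : PolyTime fun I ρ => F I ρ - G I ρ :=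
  binary _ (fun _ _ => by omega) .sub .sub hF hG

theorem load (hF : PolyTime F) : PolyTime fun I ρ => I.input.arr 0 (F I ρ) := by
  obtain ⟨B, T, hB, hT, hFB, hF⟩ := hF
  -- Matrix entries are 0 or 1, so the value bound is constant.
  refine ⟨fun _ => 1, _, .const 1, hT.add (.const 1), fun I ρ M _ _ _ => ?_, fun Γ d hd hΓ => ?_⟩
  · simp only [ColoredInstance.input, matrixArray, if_true]
    split_ifs <;> simp
  · obtain ⟨P, hP⟩ := hF Γ d hd hΓ
    refine ⟨.seq P (.load d 0 d), fun I s M hI hk hn hM => ?_⟩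
    obtain ⟨t, s', h1, h2, h3, h4, h5⟩ := hP I s M hI hk hn hM
    refine ⟨_, _, .seq h1 (.load _ _ _ _), by omega, by simp [State.setReg, h3], ?_, ?_⟩
    · intro r hr
      simp [State.setReg, Function.update_of_ne hr.ne, h4 r hr]
    · simp [State.setReg, h3, h5, hI.2.2]

/-- The placement `Γ` of the variables is arbitrary, so renaming variables only changes `Γ`. The
case of `shift` is weakening under a bound variable. -/
theorem rename (hF : PolyTime F) (g : ℕ → ℕ) : PolyTime fun I ρ => F I fun i => ρ (g i) := by
  obtain ⟨B, T, hB, hT, hFB, hF⟩ := hF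
  refine ⟨B, T, hB, hT, fun I ρ M h1 h2 h3 => hFB I _ M h1 h2 fun i => h3 _, fun Γ d hd hΓ => ?_⟩
  obtain ⟨P, hP⟩ := hF (fun i => Γ (g i)) d hd fun i => hΓ _
  exact ⟨P, fun I s M hI hk hn hM => hP I s M hI hk hn fun i => hM _⟩

theorem shift (hF : PolyTime F) : PolyTime fun I ρ => F I fun i => ρ (i + 1) := hF.rename (· + 1)

/-- The assignment `ρ` with a further variable of value `z` in front. -/
def cons (z : ℕ) (ρ : ℕ → ℕ) : ℕ → ℕ
  | 0 => z
  | i + 1 => ρ i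

end PolyTime

end RAM

/-! ### Loops, bounded sums and filling of arrays -/

namespace RAM
namespace PolyTime

variable {F : ColoredInstance → (ℕ → ℕ) → ℕ} {G : ColoredInstance → (ℕ → ℕ) → ℕ → ℕ}

/-- A loop that evaluates `G` at `0, …, F - 1` and performs one instruction after every
evaluation. Register `d` is an accumulator, `d + 2` holds the index and `d + 4` the value. -/
theorem exec_loop (hF : PolyTime F)
    (hG : PolyTime fun I ρ => G I (fun i => ρ (i + 1)) (ρ 0)) :
    ∃ T, PolyBounded T ∧ ∀ (Γ : ℕ → ℕ) d, 2 ≤ d → (∀ i, Γ i < d) →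
      ∀ (ins : Prog) (upd : State → State), (∀ s, Exec ins s 1 (upd s)) →
      (∀ s, (upd s).arr 0 = s.arr 0) → (∀ s, ∀ r ≠ d, (upd s).reg r = s.reg r) →
      ∃ P, ∀ I s M, Holds I s → I.k ≤ M → I.n ≤ M → (∀ i, s.reg (Γ i) ≤ M) →
      ∀ J : ℕ → State → Prop,
      (∀ j s s', J j s → s'.arr = s.arr → s'.reg d = s.reg d → J j s') →
      (∀ s', s'.arr = s.arr → s'.reg d = 0 → J 0 s') →
      (∀ j s', J j s' → s'.reg (d + 2) = j →
        s'.reg (d + 4) = G I (fun i => s.reg (Γ i)) j → J (j + 1) (upd s')) →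
      ∃ t s', Exec P s t s' ∧ t ≤ T M ∧ s'.arr 0 = s.arr 0 ∧ (∀ r < d, s'.reg r = s.reg r) ∧
        J (F I fun i => s.reg (Γ i)) s' := by
  obtain ⟨B, T, hB, hT, hFB, hF⟩ := hF
  obtain ⟨B', T', hB', hT', hGB, hG⟩ := hG
  -- One evaluation of `F`, three initialisations and at most `B M` rounds. Inside the loop the
  -- variables are bounded by `M + B M`, since the index stays below the value of `F`.
  refine ⟨fun M => T M + (3 + (B M * (T' (M + B M) + 3 + 1) + 1)),
    hT.add ((PolyBounded.const 3).add ((hB.mul (((hT'.comp (PolyBounded.id.add hB)).add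
      (.const 3)).add (.const 1))).add (.const 1))), ?_⟩
  intro Γ d hd hΓ ins upd hins hupd hupd'
  obtain ⟨P, hP⟩ := hF Γ (d + 1) (by omega) fun i => (hΓ i).trans (by omega)
  obtain ⟨Q, hQ⟩ := hG (cons (d + 2) Γ) (d + 4) (by omega) (by
    rintro (_ | i)
    · exact (by omega : d + 2 < d + 4)
    · exact (hΓ i).trans (by omega))
  -- Register `d + 1` holds the number of rounds left and `d + 3` the constant 1 that moves index
  -- and counter.
  refine ⟨.seq P (.seq (.seq (.const d 0) (.seq (.const (d + 2) 0) (.const (d + 3) 1)))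
    (.loop (d + 1) (.seq Q (.seq ins (.seq (.add (d + 2) (d + 2) (d + 3))
      (.sub (d + 1) (d + 1) (d + 3))))))), fun I s M hI hk hn hM J hJ hJ0 hJs => ?_⟩
  obtain ⟨t, s', h1, h2, h3, h4, h5⟩ := hP I s M hI hk hn hM
  have hN : F I (fun i => s.reg (Γ i)) ≤ B M := hFB I _ M hk hn hM
  set N := F I (fun i => s.reg (Γ i)) with hNdef
  let s₁ := ((s'.setReg d 0).setReg (d + 2) 0).setReg (d + 3) 1
  have key := exec_for (c := d + 1) (N := N) (T := T' (M + B M) + 3)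
    (body := .seq Q (.seq ins (.seq (.add (d + 2) (d + 2) (d + 3))
      (.sub (d + 1) (d + 1) (d + 3)))))
    (fun j σ => σ.arr 0 = s.arr 0 ∧ (∀ r < d, σ.reg r = s.reg r) ∧ σ.reg (d + 1) = N - j ∧
      σ.reg (d + 2) = j ∧ σ.reg (d + 3) = 1 ∧ J j σ)
    (fun j σ h => h.2.2.1) ?_ (s := s₁) ?_
  · obtain ⟨t', s'', g1, g2, g3, g4, -, -, -, g5⟩ := key
    refine ⟨_, s'', .seq h1 (.seq (.seq (.const _ _ _) (.seq (.const _ _ _) (.const _ _ _))) g1),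
      ?_, g3, g4, g5⟩
    have : N * (T' (M + B M) + 3 + 1) ≤ B M * (T' (M + B M) + 3 + 1) := by gcongr
    show t + (1 + (1 + 1) + t') ≤ T M + (3 + (B M * (T' (M + B M) + 3 + 1) + 1))
    omega
  · rintro j σ hj ⟨g0, g1, g2, g3, g4, g5⟩
    have hΓσ : ∀ i, σ.reg (Γ i) = s.reg (Γ i) := fun i => g1 _ (hΓ i)
    obtain ⟨t', s'', e1, e2, e3, e4, e5⟩ := hQ I σ (M + B M)
      (hI.of_eq (g1 _ (by omega)) (g1 _ (by omega)) g0) (by omega) (by omega) (by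
        rintro (_ | i)
        · show σ.reg (d + 2) ≤ _
          omega
        · show σ.reg (Γ i) ≤ _
          rw [hΓσ]; exact (hM i).trans (by omega))
    refine ⟨_, _, .seq e1 (.seq (hins _) (.seq (.add _ _ _ _) (.sub _ _ _ _))),
      by omega, ?_⟩
    have hr : ∀ r ≠ d, r < d + 4 → (upd s'').reg r = σ.reg r := fun r h h' => by
      rw [hupd' _ _ h, e4 r h']
    refine ⟨by simp [State.setReg, hupd, e3, g0], fun r h => ?_, ?_, ?_, ?_, ?_⟩
    · simp only [State.setReg]
      rw [Function.update_of_ne (by omega), Function.update_of_ne (by omega),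
        hr r (by omega) (by omega), g1 r h]
    · simp only [State.setReg]
      rw [Function.update_self, Function.update_of_ne (by omega), Function.update_of_ne (by omega),
        hr _ (by omega) (by omega), hr _ (by omega) (by omega), g2, g4]
      omega
    · simp only [State.setReg]
      rw [Function.update_of_ne (by omega), Function.update_self,
        hr _ (by omega) (by omega), hr _ (by omega) (by omega), g3, g4]
    · simp only [State.setReg]
      rw [Function.update_of_ne (by omega), Function.update_of_ne (by omega),
        hr _ (by omega) (by omega), g4]
    · refine hJ _ (upd s'') _ (hJs j s'' (hJ j σ s'' g5 e3 (e4 d (by omega))) ?_ ?_) rfl ?_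
      · rw [e4 _ (by omega), g3]
      · rw [e5]
        show G I (fun i => σ.reg (Γ i)) (σ.reg (d + 2)) = _
        simp_rw [hΓσ, g3]
      · simp only [State.setReg]
        rw [Function.update_of_ne (by omega), Function.update_of_ne (by omega)]
  · refine ⟨by simp [s₁, State.setReg, h3], fun r h => ?_, ?_, ?_, ?_, ?_⟩
    · simp only [s₁, State.setReg]
      rw [Function.update_of_ne (by omega), Function.update_of_ne (by omega),
        Function.update_of_ne (by omega), h4 r (by omega)]
    · simp only [s₁, State.setReg]
      rw [Function.update_of_ne (by omega), Function.update_of_ne (by omega),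
        Function.update_of_ne (by omega), h5, Nat.sub_zero]
    · simp only [s₁, State.setReg]
      rw [Function.update_of_ne (by omega), Function.update_self]
    · simp only [s₁, State.setReg]
      rw [Function.update_self]
    · refine hJ0 _ (by simp [s₁, State.setReg, h3]) ?_
      simp only [s₁, State.setReg]
      rw [Function.update_of_ne (by omega), Function.update_of_ne (by omega), Function.update_self]

/-- Products, counting, division and bounded quantifiers are all derived from this one loop. -/
theorem sum (hF : PolyTime F) (hG : PolyTime fun I ρ => G I (fun i => ρ (i + 1)) (ρ 0)) :
    PolyTime fun I ρ => ∑ z ∈ Finset.range (F I ρ), G I ρ z := by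
  obtain ⟨T, hT, H⟩ := exec_loop hF hG
  obtain ⟨B, -, hB, -, hFB, -⟩ := hF
  obtain ⟨B', -, hB', -, hGB, -⟩ := hG
  refine ⟨_, T, hB.mul (hB'.comp (PolyBounded.id.add hB)), hT, fun I ρ M hk hn hM => ?_,
    fun Γ d hd hΓ => ?_⟩
  · have h1 := hFB I ρ M hk hn hM
    calc ∑ z ∈ Finset.range (F I ρ), G I ρ z
        ≤ ∑ z ∈ Finset.range (F I ρ), B' (M + B M) := Finset.sum_le_sum fun z hz => by
          refine hGB I (cons z ρ) (M + B M) (by omega) (by omega) ?_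
          rintro (_ | i)
          · exact (show z ≤ _ by have := Finset.mem_range.1 hz; omega)
          · exact (hM i).trans (by omega)
      _ = F I ρ * B' (M + B M) := by simp
      _ ≤ _ := by gcongr
  · obtain ⟨P, hP⟩ := H Γ d hd hΓ (.add d d (d + 4))
      (fun s => s.setReg d (s.reg d + s.reg (d + 4))) (fun s => .add _ _ _ _) (fun _ => rfl)
      (fun s r hr => by simp [State.setReg, Function.update_of_ne hr])
    refine ⟨P, fun I s M hI hk hn hM => ?_⟩
    obtain ⟨t, s', h1, h2, h3, h4, h5⟩ := hP I s M hI hk hn hM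
      (fun j σ => σ.arr = s.arr ∧
        σ.reg d = ∑ z ∈ Finset.range j, G I (fun i => s.reg (Γ i)) z)
      (fun j σ σ' h h' h'' => ⟨h'.trans h.1, h''.trans h.2⟩)
      (fun σ h h' => ⟨h, by simp [h']⟩)
      (fun j σ h h' h'' => ⟨h.1, by simp [State.setReg, h.2, h'', Finset.sum_range_succ]⟩)
    exact ⟨t, s', h1, h2, h5.1, h4, h5.2⟩

/-- Filling an array. -/
theorem exec_fill (hF : PolyTime fun I _ => F I (fun _ => 0))
    (hG : PolyTime fun I ρ => G I (fun _ => 0) (ρ 0)) :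
    ∃ T, PolyBounded T ∧ ∀ d, 2 ≤ d → ∀ a ≠ 0, ∃ P, ∀ I s M, Holds I s → I.k ≤ M → I.n ≤ M →
      ∃ t s', Exec P s t s' ∧ t ≤ T M ∧ (∀ r < d, s'.reg r = s.reg r) ∧
        s'.arr = Function.update s.arr a fun x =>
          if x < F I (fun _ => 0) then G I (fun _ => 0) x else s.arr a x := by
  obtain ⟨T, hT, H⟩ := exec_loop (G := fun I _ x => G I (fun _ => 0) x) hF hG
  refine ⟨T, hT, fun d hd a ha => ?_⟩
  obtain ⟨P, hP⟩ := H (fun _ => 0) d hd (fun _ => by omega) (.store a (d + 2) (d + 4))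
    (fun s => s.setArr a (s.reg (d + 2)) (s.reg (d + 4))) (fun s => .store _ _ _ _)
    (fun s => by simp [State.setArr, Function.update_of_ne ha.symm]) (fun s r hr => rfl)
  refine ⟨P, fun I s M hI hk hn => ?_⟩
  obtain ⟨t, s', h1, h2, h3, h4, h5⟩ := hP I s M hI hk hn (fun i => by rw [hI.1]; exact hk)
    (fun j σ => σ.arr = Function.update s.arr a fun x =>
          if x < j then G I (fun _ => 0) x else s.arr a x)
    (fun j σ σ' h h' h'' => h'.trans h)
    (fun σ h h' => by simp [h])
    (fun j σ h h' h'' => by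
      simp only [State.setArr, h, Function.update_self, Function.update_idem, h', h'']
      congr 1
      funext x
      by_cases hx : x = j
      · subst hx; simp
      · simp only [Function.update_of_ne hx]
        have : x < j ↔ x < j + 1 := by omega
        simp only [this])
  exact ⟨t, s', h1, h2, h4, h5⟩

end PolyTime
end RAM

/-- Adjacency of the vertices `(i, p)` and `(j, q)` given by natural numbers. -/
def ColoredInstance.Edge (I : ColoredInstance) (i p j q : ℕ) : Prop :=
  ∃ (hi : i < I.k) (hp : p < I.n) (hj : j < I.k) (hq : q < I.n),
    I.G.Adj (⟨i, hi⟩, ⟨p, hp⟩) (⟨j, hj⟩, ⟨q, hq⟩)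

/-! ### Predicates decided in polynomial time -/

namespace RAM

open Classical in
/-- A property of instances and variables that is decided in polynomial time. -/
def PolyDec (P : ColoredInstance → (ℕ → ℕ) → Prop) : Prop :=
  PolyTime fun I ρ => if P I ρ then 1 else 0

variable {F G : ColoredInstance → (ℕ → ℕ) → ℕ} {P Q : ColoredInstance → (ℕ → ℕ) → Prop}

theorem PolyTime.congr (hF : PolyTime F) (h : ∀ I ρ, F I ρ = G I ρ) : PolyTime G := by
  have : F = G := by funext I ρ; exact h I ρ
  exact this ▸ hF

namespace PolyDec

theorem congr (hP : PolyDec P) (h : ∀ I ρ, P I ρ ↔ Q I ρ) : PolyDec Q := by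
  have : P = Q := by funext I ρ; exact propext (h I ρ)
  exact this ▸ hP

theorem shift (hP : PolyDec P) : PolyDec fun I ρ => P I fun i => ρ (i + 1) := PolyTime.shift hP

/-- With truncated subtraction, 1 − (1 − F) is the sign of F. -/
theorem pos (hF : PolyTime F) : PolyDec fun I ρ => 0 < F I ρ := by
  refine ((PolyTime.const 1).sub ((PolyTime.const 1).sub hF)).congr fun I ρ => ?_
  split_ifs <;> omega

theorem lt (hF : PolyTime F) (hG : PolyTime G) : PolyDec fun I ρ => F I ρ < G I ρ :=
  (pos (hG.sub hF)).congr fun I ρ => by omega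

theorem not (hP : PolyDec P) : PolyDec fun I ρ => ¬ P I ρ := by
  refine ((PolyTime.const 1).sub hP).congr fun I ρ => ?_
  split_ifs <;> simp_all

theorem and (hP : PolyDec P) (hQ : PolyDec Q) : PolyDec fun I ρ => P I ρ ∧ Q I ρ := by
  refine ((hP.add hQ).sub (.const 1)).congr fun I ρ => ?_
  by_cases h : P I ρ <;> by_cases h' : Q I ρ <;> simp [h, h']

theorem or (hP : PolyDec P) (hQ : PolyDec Q) : PolyDec fun I ρ => P I ρ ∨ Q I ρ :=
  (hP.not.and hQ.not).not.congr fun I ρ => by tauto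

theorem le (hF : PolyTime F) (hG : PolyTime G) : PolyDec fun I ρ => F I ρ ≤ G I ρ :=
  (lt hG hF).not.congr fun I ρ => by omega

theorem eq (hF : PolyTime F) (hG : PolyTime G) : PolyDec fun I ρ => F I ρ = G I ρ :=
  ((le hF hG).and (le hG hF)).congr fun I ρ => by omega

end PolyDec

namespace PolyTime

theorem mul (hF : PolyTime F) (hG : PolyTime G) : PolyTime fun I ρ => F I ρ * G I ρ :=
  (sum (G := fun I ρ _ => G I ρ) hF hG.shift).congr fun _ _ => by
    rw [Finset.sum_const, Finset.card_range, smul_eq_mul]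

open Classical in
theorem count {P : ColoredInstance → (ℕ → ℕ) → ℕ → Prop} (hF : PolyTime F)
    (hP : PolyDec fun I ρ => P I (fun i => ρ (i + 1)) (ρ 0)) :
    PolyTime fun I ρ => ((Finset.range (F I ρ)).filter fun z => P I ρ z).card :=
  (sum (G := fun I ρ z => if P I ρ z then 1 else 0) hF hP).congr fun I ρ => by
    rw [Finset.card_filter]

/-- The quotient F / G counts the z < F with (z + 1) G ≤ F; the conjunct 0 < G yields the value 0 of
a division by zero. -/
theorem div (hF : PolyTime F) (hG : PolyTime G) : PolyTime fun I ρ => F I ρ / G I ρ := by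
  classical
  refine (count (P := fun I ρ z => 0 < G I ρ ∧ (z + 1) * G I ρ ≤ F I ρ) hF
    ((PolyDec.pos hG.shift).and (.le (((var 0).add (.const 1)).mul hG.shift) hF.shift))).congr
    fun I ρ => ?_
  rcases Nat.eq_zero_or_pos (G I ρ) with h | h
  · simp [h]
  · rw [← Finset.card_range (F I ρ / G I ρ)]
    congr 1
    ext z
    simp only [Finset.mem_filter, Finset.mem_range, h, true_and, ← Nat.le_div_iff_mul_le h,
      Nat.succ_le_iff]
    exact ⟨fun h => h.2, fun h' => ⟨h'.trans_le (Nat.div_le_self _ _), h'⟩⟩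

theorem mod (hF : PolyTime F) (hG : PolyTime G) : PolyTime fun I ρ => F I ρ % G I ρ :=
  (hF.sub (hG.mul (hF.div hG))).congr fun _ _ => (Nat.mod_eq_sub _ _).symm

end PolyTime

namespace PolyDec

theorem ex {P : ColoredInstance → (ℕ → ℕ) → ℕ → Prop} (hF : PolyTime F)
    (hP : PolyDec fun I ρ => P I (fun i => ρ (i + 1)) (ρ 0)) :
    PolyDec fun I ρ => ∃ z, z < F I ρ ∧ P I ρ z := by
  classical
  refine (pos (PolyTime.count hF hP)).congr fun I ρ => ?_
  simp [Finset.card_pos, Finset.Nonempty]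

/-- For p, q < n the numbers i n + p and j n + q determine i, p, j, q, so one lookup at the
row-major position decides adjacency once all four arguments are known to be in range. -/
theorem edge {i p j q : ColoredInstance → (ℕ → ℕ) → ℕ} (hi : PolyTime i) (hp : PolyTime p)
    (hj : PolyTime j) (hq : PolyTime q) :
    PolyDec fun I ρ => I.Edge (i I ρ) (p I ρ) (j I ρ) (q I ρ) := by
  refine ((((lt hi .k).and (lt hp .n)).and ((lt hj .k).and (lt hq .n))).and (pos (PolyTime.load
    ((((hi.mul .n).add hp).mul (PolyTime.mul .k .n)).add ((hj.mul .n).add hq))))).congr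
    fun I ρ => ?_
  generalize i I ρ = i
  generalize j I ρ = j
  generalize p I ρ = p
  generalize q I ρ = q
  have lin : ∀ {i p : ℕ}, i < I.k → p < I.n → i * I.n + p < I.k * I.n := fun {i p} hi hp =>
    calc i * I.n + p < i * I.n + I.n := by omega
      _ = (i + 1) * I.n := by ring
      _ ≤ I.k * I.n := Nat.mul_le_mul_right _ hi
  have inj : ∀ {i p i' p' : ℕ}, p < I.n → p' < I.n → i * I.n + p = i' * I.n + p' →
      i = i' ∧ p = p' := fun {i p i' p'} hp hp' h => by
    have h1 := congrArg (· / I.n) h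
    have h2 := congrArg (· % I.n) h
    simp only [Nat.mul_comm _ I.n, Nat.mul_add_div I.n_pos, Nat.mul_add_mod,
      Nat.div_eq_of_lt hp, Nat.div_eq_of_lt hp', Nat.mod_eq_of_lt hp, Nat.mod_eq_of_lt hp'] at h1 h2
    exact ⟨by omega, h2⟩
  simp only [ColoredInstance.Edge, ColoredInstance.input, if_true, matrixArray]
  constructor
  · rintro ⟨⟨⟨hi, hp⟩, hj, hq⟩, h⟩
    refine ⟨hi, hp, hj, hq, ?_⟩
    split_ifs at h with h'
    · obtain ⟨-, i', j', p', q', h1, h2, h3⟩ := h'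
      have hv := lin hj hq
      rw [Nat.mul_comm _ (I.k * I.n), Nat.mul_add_div (by omega), Nat.div_eq_of_lt hv,
        Nat.add_zero] at h1
      rw [Nat.mul_comm _ (I.k * I.n), Nat.mul_add_mod, Nat.mod_eq_of_lt hv] at h2
      obtain ⟨rfl, rfl⟩ := inj hp p'.2 h1
      obtain ⟨rfl, rfl⟩ := inj hq q'.2 h2
      exact h3
    · omega
  · rintro ⟨hi, hp, hj, hq, h⟩
    refine ⟨⟨⟨hi, hp⟩, hj, hq⟩, ?_⟩
    have hv := lin hj hq
    have hu := lin hi hp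
    rw [if_pos]
    · exact one_pos
    · refine ⟨?_, ⟨i, hi⟩, ⟨j, hj⟩, ⟨p, hp⟩, ⟨q, hq⟩, ?_, ?_, h⟩
      · calc (i * I.n + p) * (I.k * I.n) + (j * I.n + q)
            < (i * I.n + p) * (I.k * I.n) + I.k * I.n := by omega
          _ = (i * I.n + p + 1) * (I.k * I.n) := by ring
          _ ≤ _ := Nat.mul_le_mul_right _ hu
      · rw [Nat.mul_comm _ (I.k * I.n), Nat.mul_add_div (by omega), Nat.div_eq_of_lt hv,
          Nat.add_zero]
      · rw [Nat.mul_comm _ (I.k * I.n), Nat.mul_add_mod, Nat.mod_eq_of_lt hv]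

end PolyDec

theorem _root_.NDPInstance.input_arr_of_le (J : NDPInstance) (a x : ℕ) (hx : J.n * J.n ≤ x) :
    J.input.arr a x = 0 := by
  have h : ∀ R, matrixArray J.n R x = 0 := fun R => if_neg fun h => absurd h.1 (not_lt.2 hx)
  match a with
  | 0 => simp only [NDPInstance.input, if_true, h]
  | 1 => simp only [NDPInstance.input, if_true, h, one_ne_zero, if_false]
  | a + 2 => rfl

/-! ### Running a program in a shifted part of the memory -/

/-- A strict upper bound for the registers that a program mentions. -/
def Prog.regBound : Prog → ℕ
  | .skip => 0
  | .const r _ => r + 1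
  | .add r a b => r + a + b + 1
  | .sub r a b => r + a + b + 1
  | .load r _ i => r + i + 1
  | .store _ i a => i + a + 1
  | .seq p q => p.regBound + q.regBound
  | .ite a p q => a + 1 + p.regBound + q.regBound
  | .loop a p => a + 1 + p.regBound

/-- The program with all registers shifted by `c` and all arrays shifted by `1`. -/
def Prog.shift (c : ℕ) : Prog → Prog
  | .skip => .skip
  | .const r x => .const (r + c) x
  | .add r a b => .add (r + c) (a + c) (b + c)
  | .sub r a b => .sub (r + c) (a + c) (b + c)
  | .load r A i => .load (r + c) (A + 1) (i + c)
  | .store A i a => .store (A + 1) (i + c) (a + c)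
  | .seq p q => .seq (p.shift c) (q.shift c)
  | .ite a p q => .ite (a + c) (p.shift c) (q.shift c)
  | .loop a p => .loop (a + c) (p.shift c)

/-- `σ` holds a copy of `s` in the registers from `c` on and the arrays from `1` on. -/
def Simulates (c K : ℕ) (σ s : State) : Prop :=
  (∀ r < K, σ.reg (r + c) = s.reg r) ∧ ∀ a, σ.arr (a + 1) = s.arr a

theorem Simulates.setReg {c K : ℕ} {σ s : State} (h : Simulates c K σ s) (r x : ℕ) :
    Simulates c K (σ.setReg (r + c) x) (s.setReg r x) := by
  refine ⟨fun r' hr' => ?_, h.2⟩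
  by_cases e : r' = r
  · subst e; simp [State.setReg]
  · simp only [State.setReg]
    rw [Function.update_of_ne e, Function.update_of_ne (by omega), h.1 r' hr']

theorem Simulates.setArr {c K : ℕ} {σ s : State} (h : Simulates c K σ s) (A i x : ℕ) :
    Simulates c K (σ.setArr (A + 1) i x) (s.setArr A i x) := by
  refine ⟨h.1, fun a => ?_⟩
  by_cases e : a = A
  · subst e; simp [State.setArr, h.2]
  · simp only [State.setArr]
    rw [Function.update_of_ne e, Function.update_of_ne (by omega), h.2]

/-- The shifted program never touches registers below `c` or array 0, so the original input survives
and is available when the answer is evaluated. Registers from `K` on need not agree, as they may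
hold scratch values. -/
theorem Exec.shift {p : Prog} {s s' : State} {t : ℕ} (h : Exec p s t s') (c K : ℕ) :
    p.regBound ≤ K → ∀ σ, Simulates c K σ s → ∃ σ', Exec (p.shift c) σ t σ' ∧
      Simulates c K σ' s' ∧ (∀ r < c, σ'.reg r = σ.reg r) ∧ σ'.arr 0 = σ.arr 0 := by
  have low : ∀ (σ : State) (r x : ℕ), ∀ r' < c, (σ.setReg (r + c) x).reg r' = σ.reg r' :=
    fun σ r x r' hr' => by simp only [State.setReg]; rw [Function.update_of_ne (by omega)]
  have arr0 : ∀ (σ : State) (A i x : ℕ), (σ.setArr (A + 1) i x).arr 0 = σ.arr 0 :=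
    fun σ A i x => by simp only [State.setArr]; rw [Function.update_of_ne (by omega)]
  induction h with
  | skip s => exact fun _ σ hσ => ⟨σ, .skip _, hσ, fun _ _ => rfl, rfl⟩
  | const r x s => exact fun _ σ hσ => ⟨_, .const _ _ _, hσ.setReg r x, low _ _ _, rfl⟩
  | add r a b s =>
    intro hK σ hσ
    simp only [Prog.regBound] at hK
    refine ⟨_, .add _ _ _ _, ?_, low _ _ _, rfl⟩
    rw [hσ.1 a (by omega), hσ.1 b (by omega)]
    exact hσ.setReg _ _
  | sub r a b s =>
    intro hK σ hσ
    simp only [Prog.regBound] at hK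
    refine ⟨_, .sub _ _ _ _, ?_, low _ _ _, rfl⟩
    rw [hσ.1 a (by omega), hσ.1 b (by omega)]
    exact hσ.setReg _ _
  | load r A i s =>
    intro hK σ hσ
    simp only [Prog.regBound] at hK
    refine ⟨_, .load _ _ _ _, ?_, low _ _ _, rfl⟩
    rw [hσ.1 i (by omega), hσ.2 A]
    exact hσ.setReg _ _
  | store A i a s =>
    intro hK σ hσ
    simp only [Prog.regBound] at hK
    refine ⟨_, .store _ _ _ _, ?_, fun _ _ => rfl, arr0 _ _ _ _⟩
    rw [hσ.1 i (by omega), hσ.1 a (by omega)]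
    exact hσ.setArr _ _ _
  | seq _ _ ih ih' =>
    intro hK σ hσ
    simp only [Prog.regBound] at hK
    obtain ⟨σ₁, h1, h2, h3, h4⟩ := ih (by omega) σ hσ
    obtain ⟨σ₂, h1', h2', h3', h4'⟩ := ih' (by omega) σ₁ h2
    exact ⟨σ₂, .seq h1 h1', h2', fun r hr => (h3' r hr).trans (h3 r hr), h4'.trans h4⟩
  | ite_true ha _ ih =>
    intro hK σ hσ
    simp only [Prog.regBound] at hK
    obtain ⟨σ₁, h1, h2⟩ := ih (by omega) σ hσ
    exact ⟨σ₁, .ite_true (by rwa [hσ.1 _ (by omega)]) h1, h2⟩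
  | ite_false ha _ ih =>
    intro hK σ hσ
    simp only [Prog.regBound] at hK
    obtain ⟨σ₁, h1, h2⟩ := ih (by omega) σ hσ
    exact ⟨σ₁, .ite_false (by rwa [hσ.1 _ (by omega)]) h1, h2⟩
  | loop_done ha =>
    intro hK σ hσ
    simp only [Prog.regBound] at hK
    exact ⟨σ, .loop_done (by rwa [hσ.1 _ (by omega)]), hσ, fun _ _ => rfl, rfl⟩
  | loop_step ha _ _ ih ih' =>
    intro hK σ hσ
    have hK' := hK
    simp only [Prog.regBound] at hK
    obtain ⟨σ₁, h1, h2, h3, h4⟩ := ih (by omega) σ hσ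
    obtain ⟨σ₂, h1', h2', h3', h4'⟩ := ih' hK' σ₁ h2
    exact ⟨σ₂, .loop_step (by rwa [hσ.1 _ (by omega)]) h1 h1', h2',
      fun r hr => (h3' r hr).trans (h3 r hr), h4'.trans h4⟩

open Classical in
/-- An algorithm for Maximum Node-Disjoint Paths, preceded by a polynomial-time construction of its
input and followed by a polynomial-time evaluation of its answer. -/
theorem exists_reduction {J : ColoredInstance → NDPInstance} {out : ColoredInstance → ℕ → ℕ}
    (hN : PolyTime fun I _ => (J I).n)
    (hG : PolyTime fun I ρ => (J I).input.arr 0 (ρ 0))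
    (hD : PolyTime fun I ρ => (J I).input.arr 1 (ρ 0))
    (hout : PolyTime fun I ρ => out I (ρ 0)) (A : Prog) :
    ∃ (P : Prog) (T : ℕ → ℕ), PolyBounded T ∧ ∀ I t s M, Exec A (J I).input t s →
      I.k ≤ M → I.n ≤ M → s.reg 0 ≤ M →
      ∃ t' s', Exec P I.input t' s' ∧ t' ≤ t + T M ∧ s'.reg 0 = out I (s.reg 0) := by
  obtain ⟨T₁, hT₁, H₁⟩ := PolyTime.exec_fill (F := fun I _ => (J I).n * (J I).n)
    (G := fun I _ x => (J I).input.arr 0 x) (hN.mul hN) hG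
  obtain ⟨T₂, hT₂, H₂⟩ := PolyTime.exec_fill (F := fun I _ => (J I).n * (J I).n)
    (G := fun I _ x => (J I).input.arr 1 x) (hN.mul hN) hD
  obtain ⟨-, T₃, -, hT₃, -, H₃⟩ := hN
  obtain ⟨-, T₄, -, hT₄, -, H₄⟩ := hout
  -- The shifted algorithm lives in registers 2 to K + 1; results and scratch values are kept from K
  -- + 3 on.
  set K := A.regBound + 1 with hK
  obtain ⟨P₁, H₁⟩ := H₁ (K + 3) (by omega) 1 (by omega)
  obtain ⟨P₂, H₂⟩ := H₂ (K + 3) (by omega) 2 (by omega)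
  obtain ⟨P₃, H₃⟩ := H₃ (fun _ => 0) (K + 3) (by omega) (fun _ => by omega)
  obtain ⟨P₄, H₄⟩ := H₄ (fun _ => 2) (K + 3) (by omega) (fun _ => by omega)
  refine ⟨.seq P₁ (.seq P₂ (.seq P₃ (.seq (.seq (.const (K + 4) 0) (.add 2 (K + 3) (K + 4)))
    (.seq (A.shift 2) (.seq P₄ (.seq (.const (K + 4) 0) (.add 0 (K + 3) (K + 4)))))))),
    fun M => T₁ M + T₂ M + T₃ M + T₄ M + 4,
    (((hT₁.add hT₂).add hT₃).add hT₄).add (.const 4), fun I t s M hA hk hn hv => ?_⟩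
  have h0 := holds_input I
  obtain ⟨t₁, s₁, e1, e2, e3, e4⟩ := H₁ I _ M h0 hk hn
  have h1 : Holds I s₁ := h0.of_eq (e3 _ (by omega)) (e3 _ (by omega)) (by
    rw [e4, Function.update_of_ne (by omega)])
  obtain ⟨t₂, s₂, f1, f2, f3, f4⟩ := H₂ I _ M h1 hk hn
  have h2 : Holds I s₂ := h1.of_eq (f3 _ (by omega)) (f3 _ (by omega)) (by
    rw [f4, Function.update_of_ne (by omega)])
  obtain ⟨t₃, s₃, g1, g2, g3, g4, g5⟩ := H₃ I _ M h2 hk hn (fun _ => by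
    show s₂.reg 0 ≤ M
    rw [h2.1]; exact hk)
  have h3 : Holds I s₃ := h2.of_eq (g4 _ (by omega)) (g4 _ (by omega)) (by rw [g3])
  set s₄ := (s₃.setReg (K + 4) 0).setReg 2 (s₃.reg (K + 3)) with hs₄
  have hs₄' : Exec (.seq (.const (K + 4) 0) (.add 2 (K + 3) (K + 4))) s₃ (1 + 1) s₄ := by
    have := Exec.add 2 (K + 3) (K + 4) (s₃.setReg (K + 4) 0)
    simp only [State.setReg, Function.update_self] at this
    rw [Function.update_of_ne (by omega), Nat.add_zero] at this
    exact .seq (.const _ _ _) this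
  have hsim : Simulates 2 K s₄ (J I).input := by
    constructor
    · intro r hr
      simp only [hs₄, State.setReg, NDPInstance.input]
      by_cases hr0 : r = 0
      · subst hr0
        simp [g5]
      · rw [Function.update_of_ne (by omega), Function.update_of_ne (by omega), g4 _ (by omega),
          f3 _ (by omega), e3 _ (by omega), if_neg hr0]
        simp only [ColoredInstance.input]
        rw [if_neg (by omega), if_neg (by omega)]
    · intro a
      -- Beyond the matrix the filled arrays still contain the zeros of the initial memory, as the
      -- input of `J I` requires.
      have hout := (J I).input_arr_of_le a
      simp only [hs₄, State.setReg, g3, f4, e4]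
      match a with
      | 0 =>
        rw [Function.update_of_ne (by omega), Function.update_self]
        funext x
        split_ifs with h
        · rfl
        · rw [hout x (not_lt.1 h)]; rfl
      | 1 =>
        rw [Function.update_self]
        funext x
        split_ifs with h
        · rfl
        · rw [hout x (not_lt.1 h), Function.update_of_ne (by omega)]; rfl
      | a + 2 =>
        rw [Function.update_of_ne (by omega), Function.update_of_ne (by omega)]
        simp [ColoredInstance.input, NDPInstance.input]
  obtain ⟨s₅, i1, i2, i3, i4⟩ := hA.shift 2 K (by omega) s₄ hsim
  have h5 : Holds I s₅ := by
    refine h3.of_eq ?_ ?_ ?_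
    · rw [i3 _ (by omega)]; simp only [hs₄, State.setReg]
      rw [Function.update_of_ne (by omega), Function.update_of_ne (by omega)]
    · rw [i3 _ (by omega)]; simp only [hs₄, State.setReg]
      rw [Function.update_of_ne (by omega), Function.update_of_ne (by omega)]
    · rw [i4]; rfl
  have hv5 : s₅.reg 2 = s.reg 0 := i2.1 0 (by omega)
  obtain ⟨t₄, s₆, j1, j2, j3, j4, j5⟩ := H₄ I s₅ M h5 hk hn (fun _ => by
    show s₅.reg 2 ≤ M
    rw [hv5]; exact hv)
  refine ⟨_, _, .seq e1 (.seq f1 (.seq g1 (.seq hs₄' (.seq i1 (.seq j1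
    (.seq (.const _ _ _) (.add _ _ _ _))))))), by beta_reduce; omega, ?_⟩
  simp only [State.setReg, Function.update_self]
  rw [Function.update_of_ne (by omega), Nat.add_zero, j5, hv5]

end RAM

/-! ### An expander on the discrete torus -/

namespace Torus

open ZMod ComplexConjugate

variable {m : ℕ}

/-- `(x, y) ↦ (x + 1, y)` -/
def moveFst : ZMod m × ZMod m ≃ ZMod m × ZMod m where
  toFun v := (v.1 + 1, v.2)
  invFun v := (v.1 - 1, v.2)
  left_inv v := by simp
  right_inv v := by simp

/-- `(x, y) ↦ (x, y + 1)` -/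
def moveSnd : ZMod m × ZMod m ≃ ZMod m × ZMod m where
  toFun v := (v.1, v.2 + 1)
  invFun v := (v.1, v.2 - 1)
  left_inv v := by simp
  right_inv v := by simp

/-- `(x, y) ↦ (x + y, y)` -/
def shearFst : ZMod m × ZMod m ≃ ZMod m × ZMod m where
  toFun v := (v.1 + v.2, v.2)
  invFun v := (v.1 - v.2, v.2)
  left_inv v := by simp
  right_inv v := by simp

/-- `(x, y) ↦ (x, x + y)` -/
def shearSnd : ZMod m × ZMod m ≃ ZMod m × ZMod m where
  toFun v := (v.1, v.1 + v.2)
  invFun v := (v.1, v.2 - v.1)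
  left_inv v := by simp
  right_inv v := by simp

theorem shearFst_apply (v : ZMod m × ZMod m) : shearFst v = (v.1 + v.2, v.2) := rfl

theorem shearSnd_apply (v : ZMod m × ZMod m) : shearSnd v = (v.1, v.1 + v.2) := rfl

theorem shearFst_symm_apply (v : ZMod m × ZMod m) : shearFst.symm v = (v.1 - v.2, v.2) := rfl

theorem shearSnd_symm_apply (v : ZMod m × ZMod m) : shearSnd.symm v = (v.1, v.2 - v.1) := rfl

variable [NeZero m]

/-- The discrete Fourier transform on `(ℤ/m)²`. -/
noncomputable def fourier (f : ZMod m × ZMod m → ℂ) (ξ : ZMod m × ZMod m) : ℂ :=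
  ∑ v, f v * stdAddChar (ξ.1 * v.1 + ξ.2 * v.2)

theorem sum_stdAddChar (a b : ZMod m) :
    ∑ ξ : ZMod m × ZMod m, stdAddChar (ξ.1 * a + ξ.2 * b) =
      if a = 0 ∧ b = 0 then (m : ℂ) ^ 2 else 0 := by
  rw [Fintype.sum_prod_type]
  simp only [AddChar.map_add_eq_mul]
  have h := fun c : ZMod m => AddChar.sum_mulShift c (isPrimitive_stdAddChar m)
  simp only [← Finset.mul_sum, ← Finset.sum_mul, h, ZMod.card]
  by_cases ha : a = 0 <;> by_cases hb : b = 0 <;> simp [ha, hb, sq]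

theorem parseval (f : ZMod m × ZMod m → ℂ) :
    ∑ ξ, ‖fourier f ξ‖ ^ 2 = (m : ℝ) ^ 2 * ∑ v, ‖f v‖ ^ 2 := by
  have key : ∑ ξ, fourier f ξ * conj (fourier f ξ) = (m : ℂ) ^ 2 * ∑ v, f v * conj (f v) := by
    have h1 : ∀ ξ, fourier f ξ * conj (fourier f ξ) = ∑ v, ∑ w, f v * conj (f w) *
        stdAddChar (ξ.1 * (v.1 - w.1) + ξ.2 * (v.2 - w.2)) := fun ξ => by
      simp only [fourier, map_sum, map_mul, ← AddChar.map_neg_eq_conj, Finset.sum_mul_sum]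
      refine Finset.sum_congr rfl fun v _ => Finset.sum_congr rfl fun w _ => ?_
      rw [show ξ.1 * (v.1 - w.1) + ξ.2 * (v.2 - w.2) =
        (ξ.1 * v.1 + ξ.2 * v.2) + -(ξ.1 * w.1 + ξ.2 * w.2) by ring,
        AddChar.map_add_eq_mul _ (ξ.1 * v.1 + ξ.2 * v.2)]
      ring
    simp only [h1]
    rw [Finset.sum_comm, Finset.mul_sum]
    refine Finset.sum_congr rfl fun v _ => ?_
    rw [Finset.sum_comm, Finset.sum_eq_single v]
    · rw [← Finset.mul_sum, sum_stdAddChar]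
      simp
      ring
    · intro w _ hw
      rw [← Finset.mul_sum, sum_stdAddChar, if_neg, mul_zero]
      rintro ⟨h1, h2⟩
      exact hw (Prod.ext (sub_eq_zero.1 h1).symm (sub_eq_zero.1 h2).symm)
    · simp
  simp only [Complex.mul_conj, Complex.normSq_eq_norm_sq] at key
  exact_mod_cast key

theorem fourier_sub (f g : ZMod m × ZMod m → ℂ) (ξ : ZMod m × ZMod m) :
    fourier (fun v => f v - g v) ξ = fourier f ξ - fourier g ξ := by
  simp [fourier, sub_mul, Finset.sum_sub_distrib]

theorem fourier_comp (f : ZMod m × ZMod m → ℂ) (e : ZMod m × ZMod m ≃ ZMod m × ZMod m)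
    (ξ : ZMod m × ZMod m) : fourier (fun v => f (e v)) ξ =
      ∑ v, f v * stdAddChar (ξ.1 * (e.symm v).1 + ξ.2 * (e.symm v).2) := by
  rw [fourier]
  simpa using
    e.sum_comp fun v => f v * stdAddChar (ξ.1 * (e.symm v).1 + ξ.2 * (e.symm v).2)

theorem fourier_moveFst (f : ZMod m × ZMod m → ℂ) (ξ : ZMod m × ZMod m) :
    fourier (fun v => f (moveFst v)) ξ = stdAddChar (-ξ.1) * fourier f ξ := by
  rw [fourier_comp, fourier, Finset.mul_sum]
  refine Finset.sum_congr rfl fun v _ => ?_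
  rw [mul_left_comm, ← AddChar.map_add_eq_mul]
  congr 2
  simp only [moveFst, Equiv.coe_fn_symm_mk]
  ring

theorem fourier_moveSnd (f : ZMod m × ZMod m → ℂ) (ξ : ZMod m × ZMod m) :
    fourier (fun v => f (moveSnd v)) ξ = stdAddChar (-ξ.2) * fourier f ξ := by
  rw [fourier_comp, fourier, Finset.mul_sum]
  refine Finset.sum_congr rfl fun v _ => ?_
  rw [mul_left_comm, ← AddChar.map_add_eq_mul]
  congr 2
  simp only [moveSnd, Equiv.coe_fn_symm_mk]
  ring

/-- On the dual torus a linear map acts by its inverse transpose, and the inverse transpose of one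
shear is the inverse of the other. -/
theorem fourier_shearFst (f : ZMod m × ZMod m → ℂ) (ξ : ZMod m × ZMod m) :
    fourier (fun v => f (shearFst v)) ξ = fourier f (shearSnd.symm ξ) := by
  rw [fourier_comp, fourier]
  refine Finset.sum_congr rfl fun v _ => ?_
  congr 2
  simp only [shearFst, shearSnd, Equiv.coe_fn_symm_mk]
  ring

theorem fourier_shearSnd (f : ZMod m × ZMod m → ℂ) (ξ : ZMod m × ZMod m) :
    fourier (fun v => f (shearSnd v)) ξ = fourier f (shearFst.symm ξ) := by
  rw [fourier_comp, fourier]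
  refine Finset.sum_congr rfl fun v _ => ?_
  congr 2
  simp only [shearFst, shearSnd, Equiv.coe_fn_symm_mk]
  ring

/-- A frequency of absolute value at least m/4 has an angle θ between π/2 and π, and |exp(iθ) − 1|²
= 2 − 2 cos θ. -/
theorem two_le_norm_stdAddChar_sub_one {x : ZMod m} (hx : (m : ℤ) ≤ 4 * |x.valMinAbs|) :
    2 ≤ ‖stdAddChar (-x) - 1‖ ^ 2 := by
  have hm : (0 : ℝ) < m := by exact_mod_cast Nat.pos_of_ne_zero (NeZero.ne m)
  set j := x.valMinAbs with hj
  have hxj : stdAddChar (-x) = Complex.exp ((-(2 * Real.pi * j / m) : ℝ) * Complex.I) := by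
    rw [← coe_valMinAbs x, ← hj, ← Int.cast_neg, stdAddChar_coe]
    congr 1
    push_cast
    ring
  have h2 : 2 * |j| ≤ (m : ℤ) := by
    have := valMinAbs_mem_Ioc x
    rw [← hj, Set.mem_Ioc] at this
    rcases abs_cases j with h | h <;> omega
  have hx' : (m : ℝ) ≤ 4 * |(j : ℝ)| := by exact_mod_cast hx
  have h2' : 2 * |(j : ℝ)| ≤ m := by exact_mod_cast h2
  have hcos : Real.cos (2 * Real.pi * j / m) ≤ 0 := by
    rw [← Real.cos_abs, abs_div, abs_mul, abs_of_pos (by positivity : (0 : ℝ) < 2 * Real.pi),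
      abs_of_pos hm]
    have hpi := Real.pi_pos
    apply Real.cos_nonpos_of_pi_div_two_le_of_le
    · rw [le_div_iff₀ hm]; nlinarith
    · rw [div_le_iff₀ hm]; nlinarith
  rw [hxj, ← Complex.normSq_eq_norm_sq, Complex.normSq_apply, Complex.sub_re, Complex.sub_im,
    Complex.exp_ofReal_mul_I_re, Complex.exp_ofReal_mul_I_im, Real.cos_neg, Real.sin_neg,
    Complex.one_re, Complex.one_im]
  nlinarith [Real.sin_sq_add_cos_sq (2 * Real.pi * j / m)]

/-- The images of `Q` under `S` and `T` are disjoint subsets of `Q ∪ O`, so together they carry no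
more than the mass of `Q` plus that of `O`. -/
theorem sum_image_add_sum_image_le {α : Type*} [DecidableEq α] (φ : α → ℝ) (hφ : ∀ z, 0 ≤ φ z)
    (Q O : Finset α) (S T : α → α) (hS : S.Injective) (hT : T.Injective)
    (hSQ : ∀ z ∈ Q, S z ∈ Q ∪ O) (hTQ : ∀ z ∈ Q, T z ∈ Q ∪ O)
    (hST : ∀ z ∈ Q, ∀ w ∈ Q, S z ≠ T w) :
    ∑ z ∈ Q, φ (S z) + ∑ z ∈ Q, φ (T z) ≤ ∑ z ∈ Q, φ z + ∑ z ∈ O, φ z := by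
  rw [← Finset.sum_image (s := Q) (g := S) fun _ _ _ _ h => hS h,
    ← Finset.sum_image (s := Q) (g := T) fun _ _ _ _ h => hT h,
    ← Finset.sum_union (Finset.disjoint_left.2 fun a h h' => by
      obtain ⟨z, hz, rfl⟩ := Finset.mem_image.1 h
      obtain ⟨w, hw, h⟩ := Finset.mem_image.1 h'
      exact hST z hz w hw h.symm), ← Finset.sum_union_inter]
  refine (Finset.sum_le_sum_of_subset_of_nonneg ?_ fun _ _ _ => hφ _).trans
    (le_add_of_nonneg_right (Finset.sum_nonneg fun _ _ => hφ _))
  intro a h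
  rcases Finset.mem_union.1 h with h | h <;> obtain ⟨z, hz, rfl⟩ := Finset.mem_image.1 h
  exacts [hSQ z hz, hTQ z hz]

/-- Pointwise |a|² − |b|² ≤ δs ≤ 8δ² + s²/32 with δ = |a − b| and s = |a| + |b|. The weight 8 is
chosen so that four uses cost only half of the total mass. -/
theorem sum_norm_sq_le {α : Type*} [Fintype α] (F : α → ℂ) (e : α ≃ α) (Q : Finset α) :
    ∑ z ∈ Q, ‖F z‖ ^ 2 ≤ ∑ z ∈ Q, ‖F (e z)‖ ^ 2 +
      (8 * ∑ z, ‖F (e z) - F z‖ ^ 2 + (∑ z, ‖F z‖ ^ 2) / 8) := by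
  have h1 : ∀ z, ‖F z‖ ^ 2 - ‖F (e z)‖ ^ 2 ≤
      8 * ‖F (e z) - F z‖ ^ 2 + (‖F (e z)‖ ^ 2 + ‖F z‖ ^ 2) / 16 := fun z => by
    have h := norm_sub_norm_le (F z) (F (e z))
    rw [norm_sub_rev] at h
    have h0 := norm_nonneg (F (e z) - F z)
    have ha := norm_nonneg (F z)
    have hb := norm_nonneg (F (e z))
    nlinarith [sq_nonneg (16 * ‖F (e z) - F z‖ - (‖F z‖ + ‖F (e z)‖)),
      sq_nonneg (‖F z‖ - ‖F (e z)‖), mul_le_mul_of_nonneg_right h (add_nonneg ha hb)]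
  have h2 : ∑ z ∈ Q, (‖F z‖ ^ 2 - ‖F (e z)‖ ^ 2) ≤
      ∑ z, (8 * ‖F (e z) - F z‖ ^ 2 + (‖F (e z)‖ ^ 2 + ‖F z‖ ^ 2) / 16) :=
    (Finset.sum_le_sum fun z _ => h1 z).trans
      (Finset.sum_le_sum_of_subset_of_nonneg (Finset.subset_univ _) fun _ _ _ => by positivity)
  rw [Finset.sum_sub_distrib, Finset.sum_add_distrib, ← Finset.mul_sum, ← Finset.sum_div,
    Finset.sum_add_distrib, e.sum_comp fun z => ‖F z‖ ^ 2] at h2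
  linarith

theorem valMinAbs_add_of_small {x y : ZMod m} (hx : 4 * |x.valMinAbs| < m)
    (hy : 4 * |y.valMinAbs| < m) : (x + y).valMinAbs = x.valMinAbs + y.valMinAbs := by
  rw [valMinAbs_spec]
  refine ⟨by simp, Set.mem_Ioc.2 ?_⟩
  rcases abs_cases x.valMinAbs with h | h <;> rcases abs_cases y.valMinAbs with h' | h' <;> omega

theorem valMinAbs_sub_of_small {x y : ZMod m} (hx : 4 * |x.valMinAbs| < m)
    (hy : 4 * |y.valMinAbs| < m) : (x - y).valMinAbs = x.valMinAbs - y.valMinAbs := by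
  rw [valMinAbs_spec]
  refine ⟨by simp, Set.mem_Ioc.2 ?_⟩
  rcases abs_cases x.valMinAbs with h | h <;> rcases abs_cases y.valMinAbs with h' | h' <;> omega

/-- A function on the dual torus that vanishes at the origin cannot be concentrated near the
origin and almost invariant under shears. -/
theorem sum_norm_sq_le_of_apply_zero (F : ZMod m × ZMod m → ℂ) (h0 : F 0 = 0) :
    ∑ ξ, ‖F ξ‖ ^ 2 ≤
      3 * ∑ ξ, (‖stdAddChar (-ξ.1) - 1‖ ^ 2 + ‖stdAddChar (-ξ.2) - 1‖ ^ 2) * ‖F ξ‖ ^ 2 +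
      32 * (∑ ξ, ‖F (shearFst.symm ξ) - F ξ‖ ^ 2 + ∑ ξ, ‖F (shearSnd.symm ξ) - F ξ‖ ^ 2) := by
  classical
  -- `O` is the set of frequencies far from the origin. `Q₁` and `Q₂` split the other nonzero ones
  -- into pairs of opposite quadrants, each with one of the axes. Near the origin no addition wraps
  -- around, so the two shears map `Q₁` into `Q₁ ∪ O` with disjoint images, and the inverse shears
  -- do the same for `Q₂`.
  let O : Finset (ZMod m × ZMod m) :=
    Finset.univ.filter fun ξ => ¬ (4 * |ξ.1.valMinAbs| < m ∧ 4 * |ξ.2.valMinAbs| < m)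
  let Q₁ : Finset (ZMod m × ZMod m) := Finset.univ.filter fun ξ =>
    (4 * |ξ.1.valMinAbs| < m ∧ 4 * |ξ.2.valMinAbs| < m) ∧
    (0 < ξ.1.valMinAbs ∧ 0 ≤ ξ.2.valMinAbs ∨ ξ.1.valMinAbs < 0 ∧ ξ.2.valMinAbs ≤ 0)
  let Q₂ : Finset (ZMod m × ZMod m) := Finset.univ.filter fun ξ =>
    (4 * |ξ.1.valMinAbs| < m ∧ 4 * |ξ.2.valMinAbs| < m) ∧
    (ξ.1.valMinAbs ≤ 0 ∧ 0 < ξ.2.valMinAbs ∨ 0 ≤ ξ.1.valMinAbs ∧ ξ.2.valMinAbs < 0)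
  set Φ := ∑ ξ, ‖F ξ‖ ^ 2 with hΦ
  have hφ : ∀ ξ, 0 ≤ ‖F ξ‖ ^ 2 := fun ξ => by positivity
  have hO : 2 * ∑ ξ ∈ O, ‖F ξ‖ ^ 2 ≤
      ∑ ξ, (‖stdAddChar (-ξ.1) - 1‖ ^ 2 + ‖stdAddChar (-ξ.2) - 1‖ ^ 2) * ‖F ξ‖ ^ 2 := by
    rw [Finset.mul_sum]
    refine (Finset.sum_le_sum fun ξ hξ => ?_).trans
      (Finset.sum_le_sum_of_subset_of_nonneg (Finset.subset_univ O) fun _ _ _ => by positivity)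
    refine mul_le_mul_of_nonneg_right ?_ (hφ ξ)
    have hξ := (Finset.mem_filter.1 hξ).2
    rw [not_and_or, not_lt, not_lt] at hξ
    rcases hξ with h | h
    · exact (two_le_norm_stdAddChar_sub_one h).trans (le_add_of_nonneg_right (by positivity))
    · exact (two_le_norm_stdAddChar_sub_one h).trans (le_add_of_nonneg_left (by positivity))
  have hQ₁ := sum_image_add_sum_image_le (fun ξ => ‖F ξ‖ ^ 2) hφ Q₁ O shearFst shearSnd
    shearFst.injective shearSnd.injective ?_ ?_ ?_
  have hQ₂ := sum_image_add_sum_image_le (fun ξ => ‖F ξ‖ ^ 2) hφ Q₂ O shearFst.symm shearSnd.symm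
    shearFst.symm.injective shearSnd.symm.injective ?_ ?_ ?_
  · have a1 := sum_norm_sq_le F shearFst Q₁
    have a2 := sum_norm_sq_le F shearSnd Q₁
    have a3 := sum_norm_sq_le F shearFst.symm Q₂
    have a4 := sum_norm_sq_le F shearSnd.symm Q₂
    have b : ∀ e : ZMod m × ZMod m ≃ ZMod m × ZMod m,
        ∑ ξ, ‖F (e ξ) - F ξ‖ ^ 2 = ∑ ξ, ‖F (e.symm ξ) - F ξ‖ ^ 2 := fun e => by
      rw [← e.sum_comp fun ξ => ‖F (e.symm ξ) - F ξ‖ ^ 2]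
      exact Finset.sum_congr rfl fun ξ _ => by rw [e.symm_apply_apply, norm_sub_rev]
    rw [b shearFst] at a1
    rw [b shearSnd] at a2
    have c : Φ ≤ ∑ ξ ∈ Q₁, ‖F ξ‖ ^ 2 + ∑ ξ ∈ Q₂, ‖F ξ‖ ^ 2 + ∑ ξ ∈ O, ‖F ξ‖ ^ 2 := by
      rw [hΦ, Finset.sum_filter, Finset.sum_filter, Finset.sum_filter, ← Finset.sum_add_distrib,
        ← Finset.sum_add_distrib]
      refine Finset.sum_le_sum fun ξ _ => ?_
      by_cases hb : 4 * |ξ.1.valMinAbs| < (m : ℤ) ∧ 4 * |ξ.2.valMinAbs| < (m : ℤ)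
      · by_cases hξ : ξ = 0
        · subst hξ; simp [h0]
        · have : ξ.1.valMinAbs ≠ 0 ∨ ξ.2.valMinAbs ≠ 0 := by
            by_contra! h
            exact hξ (Prod.ext (by simpa using h.1) (by simpa using h.2))
          by_cases h1 : 0 < ξ.1.valMinAbs ∧ 0 ≤ ξ.2.valMinAbs ∨
            ξ.1.valMinAbs < 0 ∧ ξ.2.valMinAbs ≤ 0
          · rw [if_pos ⟨hb, h1⟩]
            have := hφ ξ
            split_ifs <;> linarith
          · rw [if_neg (fun h => h1 h.2), if_pos ⟨hb, by omega⟩]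
            have := hφ ξ
            split_ifs
            linarith
      · rw [if_pos hb]
        have := hφ ξ
        split_ifs <;> linarith
    -- With φ(O) the mass of `O` and E the total shear error, either quadrant pair has mass at most
    -- φ(O) + 8E + Φ/4. Hence Φ ≤ 3φ(O) + 16E + Φ/2, and `hO` bounds φ(O).
    linarith
  all_goals simp only [Q₁, Q₂, O, Finset.mem_filter, Finset.mem_univ, true_and, Finset.mem_union]
  · rintro ξ ⟨hb, h⟩
    simp only [shearFst_symm_apply, valMinAbs_sub_of_small hb.1 hb.2]
    omega
  · rintro ξ ⟨hb, h⟩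
    simp only [shearSnd_symm_apply, valMinAbs_sub_of_small hb.2 hb.1]
    omega
  · rintro ξ ⟨hb, h⟩ η ⟨hb', h'⟩ e
    rw [shearFst_symm_apply, shearSnd_symm_apply, Prod.mk.injEq] at e
    have e1 := congrArg valMinAbs e.1
    have e2 := congrArg valMinAbs e.2
    rw [valMinAbs_sub_of_small hb.1 hb.2] at e1
    rw [valMinAbs_sub_of_small hb'.2 hb'.1] at e2
    omega
  · rintro ξ ⟨hb, h⟩
    simp only [shearFst_apply, valMinAbs_add_of_small hb.1 hb.2]
    omega
  · rintro ξ ⟨hb, h⟩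
    simp only [shearSnd_apply, valMinAbs_add_of_small hb.1 hb.2]
    omega
  · rintro ξ ⟨hb, h⟩ η ⟨hb', h'⟩ e
    rw [shearFst_apply, shearSnd_apply, Prod.mk.injEq] at e
    have e1 := congrArg valMinAbs e.1
    have e2 := congrArg valMinAbs e.2
    rw [valMinAbs_add_of_small hb.1 hb.2] at e1
    rw [valMinAbs_add_of_small hb'.1 hb'.2] at e2
    omega

theorem sum_norm_sq_le_of_sum_eq_zero (f : ZMod m × ZMod m → ℂ) (h0 : ∑ v, f v = 0) :
    ∑ v, ‖f v‖ ^ 2 ≤ 32 * (∑ v, ‖f (moveFst v) - f v‖ ^ 2 + ∑ v, ‖f (moveSnd v) - f v‖ ^ 2 +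
      ∑ v, ‖f (shearFst v) - f v‖ ^ 2 + ∑ v, ‖f (shearSnd v) - f v‖ ^ 2) := by
  have h := sum_norm_sq_le_of_apply_zero (fourier f) (by simpa [fourier] using h0)
  have hm : (0 : ℝ) < (m : ℝ) ^ 2 := by
    have : (0 : ℝ) < m := by exact_mod_cast Nat.pos_of_ne_zero (NeZero.ne m)
    positivity
  have e1 := parseval fun v => f (moveFst v) - f v
  have e2 := parseval fun v => f (moveSnd v) - f v
  have e3 := parseval fun v => f (shearFst v) - f v
  have e4 := parseval fun v => f (shearSnd v) - f v
  simp only [fourier_sub fun v => f (moveFst v), fourier_moveFst, ← sub_one_mul, norm_mul,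
    mul_pow] at e1
  simp only [fourier_sub fun v => f (moveSnd v), fourier_moveSnd, ← sub_one_mul, norm_mul,
    mul_pow] at e2
  simp only [fourier_sub fun v => f (shearFst v), fourier_shearFst] at e3
  simp only [fourier_sub fun v => f (shearSnd v), fourier_shearSnd] at e4
  simp only [add_mul, Finset.sum_add_distrib] at h
  rw [parseval, e1, e2, e3, e4] at h
  have p1 : 0 ≤ ∑ v, ‖f (moveFst v) - f v‖ ^ 2 := Finset.sum_nonneg fun _ _ => by positivity
  have p2 : 0 ≤ ∑ v, ‖f (moveSnd v) - f v‖ ^ 2 := Finset.sum_nonneg fun _ _ => by positivity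
  refine le_of_mul_le_mul_left ?_ hm
  nlinarith [mul_nonneg hm.le p1, mul_nonneg hm.le p2]

/-- If a labelling of the torus is constant on most edges of the expander, then it is constant on
most of the torus. -/
theorem exists_label (g : ZMod m × ZMod m → ℕ) : ∃ l,
    (Finset.univ.filter fun v => g v ≠ l).card ≤
      64 * ((Finset.univ.filter fun v => g (moveFst v) ≠ g v).card +
        (Finset.univ.filter fun v => g (moveSnd v) ≠ g v).card +
        (Finset.univ.filter fun v => g (shearFst v) ≠ g v).card +
        (Finset.univ.filter fun v => g (shearSnd v) ≠ g v).card) := by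
  classical
  let N : ℕ := Fintype.card (ZMod m × ZMod m)
  have hN : (0 : ℝ) < N := by exact_mod_cast Fintype.card_pos
  let c : ℕ → ℕ := fun l => (Finset.univ.filter fun v => g v = l).card
  let Λ := Finset.univ.image g
  obtain ⟨l₀, -, hl₀⟩ := Λ.exists_max_image c ⟨g 0, Finset.mem_image_of_mem _ (Finset.mem_univ _)⟩
  have hsum : ∑ l ∈ Λ, (c l : ℝ) = N := by
    exact_mod_cast (Finset.card_eq_sum_card_image g Finset.univ).symm
  -- Centred indicator functions of the labels. Their energies add up to N − ∑ c_l²/N, which is at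
  -- least N − c_{l₀} for the most frequent label l₀.
  let f : ℕ → ZMod m × ZMod m → ℂ := fun l v => ((if g v = l then 1 else 0) - c l / N : ℝ)
  have hf0 : ∀ l, ∑ v, f l v = 0 := fun l => by
    have : ∑ v, ((if g v = l then 1 else 0) - c l / N : ℝ) = 0 := by
      rw [Finset.sum_sub_distrib, Finset.sum_boole, Finset.sum_const, Finset.card_univ,
        nsmul_eq_mul]
      show (c l : ℝ) - N * (c l / N) = 0
      field_simp
      ring
    rw [← Complex.ofReal_sum, this, Complex.ofReal_zero]
  have hf : ∀ l, ∑ v, ‖f l v‖ ^ 2 = c l - (c l : ℝ) ^ 2 / N := fun l => by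
    have h1 : ∀ v, ‖f l v‖ ^ 2 =
        (1 - 2 * (c l / N)) * (if g v = l then 1 else 0) + (c l / N : ℝ) ^ 2 := fun v => by
      simp only [f, Complex.norm_real, Real.norm_eq_abs, sq_abs]
      split_ifs <;> ring
    simp only [h1, Finset.sum_add_distrib, ← Finset.mul_sum, Finset.sum_boole, Finset.sum_const,
      Finset.card_univ, nsmul_eq_mul]
    show (1 - 2 * (c l / N)) * (c l : ℝ) + N * (c l / N : ℝ) ^ 2 = _
    field_simp
    ring
  -- An edge between different labels changes exactly two of the indicators, each by one.
  have hE : ∀ e : ZMod m × ZMod m ≃ ZMod m × ZMod m, ∑ l ∈ Λ, ∑ v, ‖f l (e v) - f l v‖ ^ 2 =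
      2 * (Finset.univ.filter fun v => g (e v) ≠ g v).card := fun e => by
    rw [Finset.sum_comm, Finset.card_filter, Nat.cast_sum, Finset.mul_sum]
    refine Finset.sum_congr rfl fun v _ => ?_
    have h1 : ∀ l, ‖f l (e v) - f l v‖ ^ 2 =
        ((if g (e v) = l then 1 else 0) - (if g v = l then 1 else 0) : ℝ) ^ 2 := fun l => by
      simp only [f, ← Complex.ofReal_sub, Complex.norm_real, Real.norm_eq_abs, sq_abs]
      ring
    simp only [h1]
    have h2 : ∀ v, g v ∈ Λ := fun v => Finset.mem_image_of_mem _ (Finset.mem_univ _)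
    by_cases h : g (e v) = g v
    · simp [h]
    · have h3 : ∀ l, ((if g (e v) = l then 1 else 0) - (if g v = l then 1 else 0) : ℝ) ^ 2 =
          (if g (e v) = l then 1 else 0) + (if g v = l then 1 else 0) := fun l => by
        by_cases h4 : g (e v) = l <;> by_cases h5 : g v = l <;> first
          | exact absurd (h4.trans h5.symm) h
          | simp [h4, h5]
      simp only [h3, Finset.sum_add_distrib, Finset.sum_ite_eq, h2, if_true]
      norm_num [h]
  have main := Finset.sum_le_sum fun l (_ : l ∈ Λ) => sum_norm_sq_le_of_sum_eq_zero (f l) (hf0 l)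
  simp only [hf, ← Finset.mul_sum, Finset.sum_add_distrib, hE, Finset.sum_sub_distrib, hsum] at main
  have hsq : ∑ l ∈ Λ, (c l : ℝ) ^ 2 / N ≤ c l₀ := by
    calc ∑ l ∈ Λ, (c l : ℝ) ^ 2 / N ≤ ∑ l ∈ Λ, (c l₀ * c l / N : ℝ) := by
          refine Finset.sum_le_sum fun l hl => ?_
          have : (c l : ℝ) ≤ c l₀ := by exact_mod_cast hl₀ l hl
          rw [sq]
          gcongr
      _ = c l₀ := by
          rw [← Finset.sum_div, ← Finset.mul_sum, hsum]
          field_simp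
  refine ⟨l₀, ?_⟩
  have hcompl : ((Finset.univ.filter fun v => g v ≠ l₀).card : ℝ) = N - c l₀ := by
    have := Finset.card_filter_add_card_filter_not (s := Finset.univ) fun v => g v = l₀
    rw [Finset.card_univ] at this
    rw [eq_sub_iff_add_eq', ← Nat.cast_add]
    exact_mod_cast this
  rw [← Nat.cast_le (α := ℝ), hcompl]
  push_cast
  linarith

end Torus

/-! ### Graphs whose edges join consecutive vertices, up to a few vertices -/

namespace SimpleGraph

/-- Every edge is a bridge: by injectivity of `f`, the edge between the levels `f u` and `f u + 1`
is the only one leaving the set of vertices of level at most `f u`. -/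
theorem isAcyclic_of_consecutive {V : Type*} (G : SimpleGraph V) (f : V → ℕ)
    (hf : f.Injective) (h : ∀ u v, G.Adj u v → f v = f u + 1 ∨ f u = f v + 1) : G.IsAcyclic := by
  have key : ∀ u v, G.Adj u v → f v = f u + 1 →
      ¬ (G.deleteEdges {s(u, v)}).Reachable u v := by
    rintro u v - huv ⟨w⟩
    have : ∀ a b, (G.deleteEdges {s(u, v)}).Walk a b → f a ≤ f u → f b ≤ f u := by
      intro a b w
      induction w with
      | nil => exact id
      | @cons a c b hab _ ih =>
        intro ha
        refine ih ?_
        rw [deleteEdges_adj] at hab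
        by_contra hb
        rcases h a c hab.1 with h' | h'
        · have h1 : a = u := hf (by omega)
          have h2 : c = v := hf (by omega)
          subst h1 h2
          exact hab.2 rfl
        · omega
    have := this u v w le_rfl
    omega
  rw [isAcyclic_iff_forall_isBridge]
  intro e he
  induction e with
  | _ u v =>
    rw [isBridge_iff]
    rcases h u v he with h' | h'
    · exact key u v he h'
    · rw [Sym2.eq_swap]
      exact fun hr => key v u he.symm h' hr.symm

variable {N : ℕ} (G : SimpleGraph (Fin N)) (S : Finset (Fin N))

theorem feedbackVertexNumber_le_of_consecutive
    (h : ∀ u v, G.Adj u v → u ∉ S → v ∉ S → v.val = u.val + 1 ∨ u.val = v.val + 1) :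
    G.feedbackVertexNumber ≤ S.card := by
  refine Nat.sInf_le ⟨S, rfl, isAcyclic_of_consecutive _ (fun v => v.1.val) ?_ ?_⟩
  · exact fun u v huv => Subtype.ext (Fin.ext huv)
  · exact fun u v huv => h _ _ huv u.2 v.2

/-- The bags consist of `S` and two consecutive vertices. -/
theorem pathwidth_le_of_consecutive
    (h : ∀ u v, G.Adj u v → u ∉ S → v ∉ S → v.val = u.val + 1 ∨ u.val = v.val + 1) :
    G.pathwidth ≤ S.card + 1 := by
  classical
  refine Nat.sInf_le ⟨N, fun i => S ∪ Finset.univ.filter fun v => v.val = i ∨ v.val = i + 1,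
    ⟨fun v => ⟨v, by simp⟩, fun u v huv => ?_, fun v i j l hij hjl hi hl => ?_⟩, fun i => ?_⟩
  · by_cases hu : u ∈ S
    · exact ⟨v, by simp [hu], by simp⟩
    by_cases hv : v ∈ S
    · exact ⟨u, by simp, by simp [hv]⟩
    rcases h u v huv hu hv with h' | h'
    · exact ⟨u, by simp, by simp [h']⟩
    · exact ⟨v, by simp [h'], by simp⟩
  · simp only [Finset.mem_union, Finset.mem_filter, Finset.mem_univ, true_and] at hi hl ⊢
    rw [Fin.le_def] at hij hjl
    by_cases hv : v ∈ S
    · exact .inl hv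
    · simp only [hv, false_or] at hi hl ⊢
      omega
  · refine (Finset.card_union_le _ _).trans (?_ : _ ≤ S.card + 2)
    refine Nat.add_le_add_left ?_ _
    have : (Finset.univ.filter fun v : Fin N => v.val = i ∨ v.val = i + 1).image Fin.val ⊆
        {i.val, i.val + 1} := by
      intro x
      simp only [Finset.mem_image, Finset.mem_filter, Finset.mem_univ, true_and,
        Finset.mem_insert, Finset.mem_singleton]
      rintro ⟨v, hv, rfl⟩
      exact hv
    rw [← Finset.card_image_of_injective _ Fin.val_injective]
    exact (Finset.card_le_card this).trans Finset.card_le_two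

end SimpleGraph

/-! ### Constraint networks and their disjoint paths instances -/

/-- A network of binary constraints on variables with values below `n`. Every constraint belongs to
a slot `o ∈ {1, …, 6}` of a variable `x`; `Rel x o p y q` means that the constraint in slot `o` of
`x` relates `x` to the variable `y` and allows the values `p` for `x` and `q` for `y`. -/
structure Network where
  V : ℕ
  n : ℕ
  Active : ℕ → Prop
  Rel : ℕ → ℕ → ℕ → ℕ → ℕ → Prop
  lt_of_active : ∀ x, Active x → x < V
  bounds : ∀ x o p y q, Rel x o p y q →
    1 ≤ o ∧ o ≤ 6 ∧ p < n ∧ q < n ∧ Active x ∧ Active y ∧ x ≠ y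
  target_unique : ∀ x o p y q p' y' q', Rel x o p y q → Rel x o p' y' q' → y = y'
  source_unique : ∀ x o p y q x' p' q', Rel x o p y q → Rel x' o p' y q' → x = x'
  source_ne_target : ∀ x o p y q p' y' q', Rel x o p y q → ¬ Rel y o p' y' q'
  parallel : ∀ x o p y q o' p' q', Rel x o p y q → Rel x o' p' y q' → Rel x o p' y q'
  antiparallel : ∀ x o p y q o' p' q', Rel x o p y q → ¬ Rel y o' p' x q'

namespace Network

variable (W : Network)

/-- The position `r` of line `l` (left) or the special vertex in slot `o` of `x` (right) that has
number `v`. -/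
def decode (v : ℕ) : (ℕ × ℕ) ⊕ (ℕ × ℕ) :=
  if v < 2 * W.V * (8 * W.n) then .inl (v / (8 * W.n), v % (8 * W.n))
  else .inr ((v - 2 * W.V * (8 * W.n)) / 8, (v - 2 * W.V * (8 * W.n)) % 8)

/-- The number of vertices. -/
def size : ℕ := 2 * W.V * (8 * W.n) + 8 * W.V

/-- The position `r` of line `l` is attached to the special vertex in slot `o` of `x`. -/
def Attached (l r x o : ℕ) : Prop :=
  (W.Active x ∧ (o = 0 ∧ (l = 2 * x ∧ r = 0 ∨ l = 2 * x + 1 ∧ r + 1 = 8 * W.n) ∨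
    o = 7 ∧ (l = 2 * x ∧ r + 1 = 8 * W.n ∨ l = 2 * x + 1 ∧ r = 0))) ∨
  ∃ p y q, W.Rel x o p y q ∧ (l = 2 * x ∧ r = 8 * p + o ∨ l = 2 * y ∧ r = 8 * q + o)

/-- Directed edges between decoded vertices. -/
def Arc : (ℕ × ℕ) ⊕ (ℕ × ℕ) → (ℕ × ℕ) ⊕ (ℕ × ℕ) → Prop
  | .inl (l, r), .inl (l', r') => l = l' ∧ r' = r + 1
  | .inl (l, r), .inr (x, o) => W.Attached l r x o
  | .inr _, _ => False

/-- The directed demand from position `r` of line `l` to position `r'` of line `l'`. -/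
def Demand (l r l' r' : ℕ) : Prop :=
  (∃ x p, W.Active x ∧ p < W.n ∧ l = 2 * x ∧ l' = 2 * x + 1 ∧
    (r = 8 * p ∧ r' = 8 * p + 7 ∨ r = 8 * p + 7 ∧ r' = 8 * p)) ∨
  ∃ x o p y q, W.Rel x o p y q ∧ l = 2 * x ∧ r = 8 * p + o ∧ l' = 2 * y ∧ r' = 8 * q + o

/-- Directed demands between decoded vertices. -/
def DemandArc : (ℕ × ℕ) ⊕ (ℕ × ℕ) → (ℕ × ℕ) ⊕ (ℕ × ℕ) → Prop
  | .inl (l, r), .inl (l', r') => W.Demand l r l' r'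
  | _, _ => False

theorem Arc.ne {W : Network} {a b : (ℕ × ℕ) ⊕ (ℕ × ℕ)} (h : W.Arc a b) : a ≠ b := by
  rcases a with ⟨l, r⟩ | ⟨x, o⟩ <;> rcases b with ⟨l', r'⟩ | ⟨x', o'⟩
  · rintro ⟨⟩
    have := h.2
    omega
  · simp
  · simp
  · exact h.elim

theorem Demand.line_ne {W : Network} {l r l' r' : ℕ} (h : W.Demand l r l' r') : l ≠ l' := by
  rcases h with ⟨x, p, -, -, rfl, rfl, -⟩ | ⟨x, o, p, y, q, h, rfl, -, rfl, -⟩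
  · omega
  · have := (W.bounds _ _ _ _ _ h).2.2.2.2.2.2
    omega

theorem DemandArc.ne {W : Network} {a b : (ℕ × ℕ) ⊕ (ℕ × ℕ)} (h : W.DemandArc a b) : a ≠ b := by
  rcases a with ⟨l, r⟩ | ⟨x, o⟩ <;> rcases b with ⟨l', r'⟩ | ⟨x', o'⟩
  · rintro ⟨⟩
    exact Demand.line_ne h rfl
  all_goals exact h.elim

/-- The graph of the disjoint paths instance. -/
def graph : SimpleGraph (Fin W.size) where
  Adj u v := W.Arc (W.decode u) (W.decode v) ∨ W.Arc (W.decode v) (W.decode u)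
  symm := ⟨fun _ _ h => Or.symm h⟩
  loopless := ⟨fun _ h => h.elim (fun h => h.ne rfl) fun h => h.ne rfl⟩

open Classical in
/-- The demands of the disjoint paths instance. -/
noncomputable def demandSet : Finset (Sym2 (Fin W.size)) :=
  (Finset.univ.filter fun e : Fin W.size × Fin W.size =>
    W.DemandArc (W.decode e.1) (W.decode e.2)).image fun e => s(e.1, e.2)

theorem mem_demandSet {u v : Fin W.size} : s(u, v) ∈ W.demandSet ↔
    W.DemandArc (W.decode u) (W.decode v) ∨ W.DemandArc (W.decode v) (W.decode u) := by
  simp only [demandSet, Finset.mem_image, Finset.mem_filter, Finset.mem_univ, true_and,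
    Prod.exists, Sym2.eq_iff]
  constructor
  · rintro ⟨a, b, h, ⟨rfl, rfl⟩ | ⟨rfl, rfl⟩⟩
    exacts [.inl h, .inr h]
  · rintro (h | h)
    exacts [⟨u, v, h, .inl ⟨rfl, rfl⟩⟩, ⟨v, u, h, .inr ⟨rfl, rfl⟩⟩]

/-- The instance of Maximum Node-Disjoint Paths of a constraint network. -/
noncomputable def toNDP : NDPInstance where
  n := W.size
  G := W.graph
  demands := W.demandSet
  not_isDiag := by
    intro d
    induction d with
    | _ u v =>
      intro h h'
      obtain rfl : u = v := h'
      rcases W.mem_demandSet.1 h with h | h <;> exact h.ne rfl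

theorem decode_line {l r : ℕ} (hl : l < 2 * W.V) (hr : r < 8 * W.n) :
    l * (8 * W.n) + r < 2 * W.V * (8 * W.n) ∧ W.decode (l * (8 * W.n) + r) = .inl (l, r) := by
  have h : l * (8 * W.n) + r < 2 * W.V * (8 * W.n) :=
    calc l * (8 * W.n) + r < l * (8 * W.n) + 8 * W.n := Nat.add_lt_add_left hr _
      _ = (l + 1) * (8 * W.n) := by ring
      _ ≤ _ := Nat.mul_le_mul_right _ hl
  refine ⟨h, ?_⟩
  rw [decode, if_pos h, Nat.mul_comm l, Nat.mul_add_div (by omega), Nat.div_eq_of_lt hr,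
    Nat.mul_add_mod, Nat.mod_eq_of_lt hr, Nat.add_zero]

theorem decode_special {x o : ℕ} (ho : o < 8) :
    W.decode (2 * W.V * (8 * W.n) + (8 * x + o)) = .inr (x, o) := by
  rw [decode, if_neg (by omega), Nat.add_sub_cancel_left]
  congr 2 <;> omega

theorem exists_line {l r : ℕ} (hl : l < 2 * W.V) (hr : r < 8 * W.n) :
    ∃ v : Fin W.size, W.decode v = .inl (l, r) :=
  ⟨⟨l * (8 * W.n) + r, by have := (W.decode_line hl hr).1; unfold size; omega⟩,
    (W.decode_line hl hr).2⟩

theorem exists_special {x o : ℕ} (hx : x < W.V) (ho : o < 8) :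
    ∃ v : Fin W.size, W.decode v = .inr (x, o) :=
  ⟨⟨2 * W.V * (8 * W.n) + (8 * x + o), by unfold size; omega⟩, W.decode_special ho⟩

theorem eq_of_decode_inl {v l r : ℕ} (h : W.decode v = .inl (l, r)) :
    v = l * (8 * W.n) + r ∧ r < 8 * W.n ∧ l < 2 * W.V := by
  unfold decode at h
  split_ifs at h with hv
  simp only [Sum.inl.injEq, Prod.mk.injEq] at h
  obtain ⟨rfl, rfl⟩ := h
  have hn : 0 < 8 * W.n := by
    rcases Nat.eq_zero_or_pos (8 * W.n) with h | h
    · rw [h] at hv; omega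
    · exact h
  exact ⟨by rw [Nat.mul_comm]; exact (Nat.div_add_mod _ _).symm, Nat.mod_lt _ hn,
    (Nat.div_lt_iff_lt_mul hn).2 hv⟩

theorem eq_of_decode_inr {v x o : ℕ} (h : W.decode v = .inr (x, o)) :
    v = 2 * W.V * (8 * W.n) + (8 * x + o) ∧ o < 8 := by
  unfold decode at h
  split_ifs at h with hv
  simp only [Sum.inr.injEq, Prod.mk.injEq] at h
  omega

theorem decode_injective : Function.Injective W.decode := by
  intro u v h
  rcases hv : W.decode v with ⟨l, r⟩ | ⟨x, o⟩
  · rw [(W.eq_of_decode_inl hv).1, (W.eq_of_decode_inl (h.trans hv)).1]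
  · rw [(W.eq_of_decode_inr hv).1, (W.eq_of_decode_inr (h.trans hv)).1]

theorem decode_fin_injective : Function.Injective fun v : Fin W.size => W.decode v :=
  W.decode_injective.comp Fin.val_injective

/-- The special vertices. -/
def specials : Finset (Fin W.size) :=
  Finset.univ.filter fun v => 2 * W.V * (8 * W.n) ≤ v.val

theorem card_specials_le : W.specials.card ≤ 8 * W.V := by
  rw [← Finset.card_image_of_injective _ Fin.val_injective]
  have : W.specials.image Fin.val ⊆ Finset.Ico (2 * W.V * (8 * W.n)) W.size := by
    intro x
    simp only [specials, Finset.mem_image, Finset.mem_filter, Finset.mem_univ, true_and,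
      Finset.mem_Ico]
    rintro ⟨v, hv, rfl⟩
    exact ⟨hv, v.2⟩
  refine (Finset.card_le_card this).trans ?_
  rw [Nat.card_Ico, size]
  omega

theorem consecutive (u v : Fin W.size) (h : W.graph.Adj u v) (hu : u ∉ W.specials)
    (hv : v ∉ W.specials) : v.val = u.val + 1 ∨ u.val = v.val + 1 := by
  have key : ∀ u v : Fin W.size, u ∉ W.specials → v ∉ W.specials →
      W.Arc (W.decode u) (W.decode v) → v.val = u.val + 1 := by
    intro u v hu hv h
    simp only [specials, Finset.mem_filter, Finset.mem_univ, true_and, not_le] at hu hv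
    have h1 : W.decode u = _ := if_pos hu
    have h2 : W.decode v = _ := if_pos hv
    rw [h1, h2] at h
    rw [(W.eq_of_decode_inl h1).1, (W.eq_of_decode_inl h2).1]
    have := h.1
    have := h.2
    rw [h.1, h.2]
    ring
  exact Or.imp (key u v hu hv) (key v u hv hu) h

theorem pathwidth_le : W.toNDP.G.pathwidth ≤ 8 * W.V + 1 :=
  (W.graph.pathwidth_le_of_consecutive _ W.consecutive).trans
    (Nat.add_le_add_right W.card_specials_le 1)

theorem feedbackVertexNumber_le : W.toNDP.G.feedbackVertexNumber ≤ 8 * W.V :=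
  (W.graph.feedbackVertexNumber_le_of_consecutive _ W.consecutive).trans W.card_specials_le

end Network

/-- The sets have total size at most |L|, and those that are not singletons have size at least 2; so
at least 2|ι| − |L| of them are singletons. -/
theorem Finset.card_filter_not_singleton_add_le {β ι : Type*} [Fintype ι] [DecidableEq β]
    (L : Finset β) (S : ι → Finset β) [DecidablePred fun z => ¬ ∃ i, S i = {z}]
    (hne : ∀ i, (S i).Nonempty) (hsub : ∀ i, S i ⊆ L)
    (hdisj : ∀ i j, i ≠ j → Disjoint (S i) (S j)) :
    (L.filter fun z => ¬ ∃ i, S i = {z}).card + 2 * Fintype.card ι ≤ 2 * L.card := by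
  classical
  have h1 : ∑ i, (S i).card ≤ L.card := by
    rw [← Finset.card_biUnion fun i _ j _ h => hdisj i j h]
    exact Finset.card_le_card (Finset.biUnion_subset.2 fun i _ => hsub i)
  have h2 : 2 * Fintype.card ι ≤
      ∑ i, (S i).card + (Finset.univ.filter fun i => (S i).card = 1).card := by
    rw [Finset.card_filter, ← Finset.sum_add_distrib, mul_comm, ← smul_eq_mul, ← Finset.card_univ,
      ← Finset.sum_const]
    refine Finset.sum_le_sum fun i _ => ?_
    have := (hne i).card_pos
    split_ifs <;> omega
  have h3 : (Finset.univ.filter fun i => (S i).card = 1).card ≤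
      (L.filter fun z => ∃ i, S i = {z}).card := by
    have hex : ∀ i, ∃ z, (S i).card = 1 → S i = {z} := fun i => by
      by_cases h : (S i).card = 1
      · exact (Finset.card_eq_one.1 h).imp fun z hz _ => hz
      · exact ⟨(hne i).choose, fun h' => absurd h' h⟩
    choose f hf using hex
    refine Finset.card_le_card_of_injOn f (fun i hi => ?_) fun i hi j hj hij => ?_
    · have := hf i (Finset.mem_filter.1 hi).2
      exact Finset.mem_filter.2 ⟨hsub i (this ▸ Finset.mem_singleton_self _), i, this⟩
    · have h1 := hf i (Finset.mem_filter.1 hi).2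
      have h2 := hf j (Finset.mem_filter.1 hj).2
      by_contra hne'
      have := hdisj i j hne'
      rw [h1, h2, hij] at this
      simp at this
  have h4 := Finset.card_filter_add_card_filter_not (s := L) fun z => ∃ i, S i = {z}
  convert (by omega : (L.filter fun z => ¬ ∃ i, S i = {z}).card + 2 * Fintype.card ι ≤ 2 * L.card)

/-! ### What the paths of a routing occupy -/

namespace Network

variable (W : Network)

/-- The special vertices that are attached to some line. -/
def Live (x o : ℕ) : Prop :=
  (W.Active x ∧ (o = 0 ∨ o = 7)) ∨ ∃ p y q, W.Rel x o p y q

open Classical in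
/-- The set of attached special vertices. -/
noncomputable def live : Finset (ℕ × ℕ) :=
  (Finset.range W.V ×ˢ Finset.range 8).filter fun z => W.Live z.1 z.2

theorem mem_live {z : ℕ × ℕ} : z ∈ W.live ↔ W.Live z.1 z.2 := by
  simp only [live, Finset.mem_filter, Finset.mem_product, Finset.mem_range, and_iff_right_iff_imp]
  rintro (⟨h, h'⟩ | ⟨p, y, q, h⟩)
  · exact ⟨W.lt_of_active _ h, by omega⟩
  · obtain ⟨h1, h2, -, -, h3, -⟩ := W.bounds _ _ _ _ _ h
    exact ⟨W.lt_of_active _ h3, by omega⟩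

theorem Attached.live {W : Network} {l r x o : ℕ} (h : W.Attached l r x o) : W.Live x o := by
  rcases h with ⟨h, h'⟩ | ⟨p, y, q, h, -⟩
  · exact .inl ⟨h, h'.imp And.left And.left⟩
  · exact .inr ⟨p, y, q, h⟩

variable {W}

theorem attached_of_adj {u v : Fin W.size} (h : W.graph.Adj u v) {x o : ℕ}
    (hv : W.decode v = .inr (x, o)) :
    ∃ l r, W.decode u = .inl (l, r) ∧ W.Attached l r x o := by
  change W.Arc _ _ ∨ W.Arc _ _ at h
  rw [hv] at h
  rcases hu : W.decode u with ⟨l, r⟩ | ⟨y, o'⟩ <;> rw [hu] at h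
  · exact ⟨l, r, rfl, h.resolve_right id⟩
  · exact h.elim False.elim False.elim

theorem line_of_adj {u v : Fin W.size} (h : W.graph.Adj u v) {l r l' r' : ℕ}
    (hu : W.decode u = .inl (l, r)) (hv : W.decode v = .inl (l', r')) :
    l = l' ∧ (r' = r + 1 ∨ r = r' + 1) := by
  change W.Arc _ _ ∨ W.Arc _ _ at h
  rw [hu, hv] at h
  rcases h with h | h
  · exact ⟨h.1, .inl h.2⟩
  · exact ⟨h.1.symm, .inr h.2⟩

theorem live_of_mem_support {u v : Fin W.size} (w : W.graph.Walk u v) {l r x o : ℕ}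
    (hu : W.decode u = .inl (l, r)) {c : Fin W.size} (hc : c ∈ w.support)
    (hcz : W.decode c = .inr (x, o)) : W.Live x o := by
  have key : ∀ {u v : Fin W.size} (w : W.graph.Walk u v), c ∈ w.support → c = u ∨ W.Live x o := by
    intro u v w
    induction w with
    | nil => exact fun h => .inl (List.mem_singleton.1 h)
    | @cons a b d hab p ih =>
      intro h
      rw [SimpleGraph.Walk.support_cons, List.mem_cons] at h
      rcases h with rfl | h
      · exact .inl rfl
      · rcases ih h with rfl | h
        · obtain ⟨l, r, -, h⟩ := attached_of_adj hab hcz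
          exact .inr h.live
        · exact .inr h
  rcases key w hc with rfl | h
  · rw [hu] at hcz; cases hcz
  · exact h

/-- Different lines are connected only through special vertices. -/
theorem exists_special_mem_support {u v : Fin W.size} (w : W.graph.Walk u v) {l' r' : ℕ}
    (hv : W.decode v = .inl (l', r')) : ∀ {l r : ℕ}, W.decode u = .inl (l, r) → l ≠ l' →
    ∃ c ∈ w.support, ∃ z, W.decode c = .inr z := by
  induction w with
  | nil =>
    intro l r hu hl
    rw [hu] at hv
    cases hv
    exact absurd rfl hl
  | @cons a b d hab p ih =>
    intro l r hu hl
    rcases hb : W.decode b with ⟨l'', r''⟩ | z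
    · obtain ⟨c, hc, hz⟩ := ih hv hb ((line_of_adj hab hu hb).1 ▸ hl)
      exact ⟨c, List.mem_cons_of_mem _ hc, hz⟩
    · exact ⟨b, List.mem_cons_of_mem _ p.start_mem_support, z, hb⟩

/-- Before it meets a special vertex a walk moves along its line in unit steps, so it visits every
position between its start and the point of attachment. -/
theorem exists_attached_of_walk {u v : Fin W.size} (w : W.graph.Walk u v) {x o : ℕ}
    (hv : W.decode v = .inr (x, o)) : ∀ {l r : ℕ}, W.decode u = .inl (l, r) →
    (∀ c ∈ w.support, ∀ z, W.decode c = .inr z → z = (x, o)) →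
    ∃ r', W.Attached l r' x o ∧ ∀ t, min r r' ≤ t → t ≤ max r r' →
      ∃ c ∈ w.support, W.decode c = .inl (l, t) := by
  induction w with
  | nil =>
    intro l r hu
    rw [hu] at hv
    cases hv
  | @cons a b d hab p ih =>
    intro l r hu hs
    rcases hb : W.decode b with ⟨l'', r''⟩ | z
    · obtain ⟨rfl, h⟩ := line_of_adj hab hu hb
      obtain ⟨r', h1, h2⟩ := ih hv hb fun c hc => hs c (List.mem_cons_of_mem _ hc)
      refine ⟨r', h1, fun t ht ht' => ?_⟩
      by_cases htr : t = r
      · exact ⟨a, List.mem_cons_self, htr ▸ hu⟩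
      · obtain ⟨c, hc, hct⟩ := h2 t (by omega) (by omega)
        exact ⟨c, List.mem_cons_of_mem _ hc, hct⟩
    · obtain rfl := hs b (List.mem_cons_of_mem _ p.start_mem_support) z hb
      obtain ⟨l₁, r₁, h1, h2⟩ := attached_of_adj hab hb
      rw [hu] at h1
      cases h1
      refine ⟨r, h2, fun t ht ht' => ⟨a, List.mem_cons_self, ?_⟩⟩
      rw [hu, show t = r by omega]

/-- In a routing of almost as many demands as there are attached special vertices, most of the
special vertices `z` are the only special vertex of a path, which then occupies an interval on
each of two lines. -/
theorem exists_occupation (D : Finset (Sym2 (Fin W.size))) (hD : D ⊆ W.demandSet)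
    (hr : W.graph.Routable D) :
    ∃ (Bad : Finset (ℕ × ℕ)) (Occ : ℕ × ℕ → ℕ → ℕ → Prop),
      Bad.card + 2 * D.card ≤ 2 * W.live.card ∧
      (∀ z z' l t, Occ z l t → Occ z' l t → z = z') ∧
      ∀ x o, W.Live x o → (x, o) ∉ Bad → ∃ l r s l' r' s', W.Demand l r l' r' ∧
        W.Attached l s x o ∧ W.Attached l' s' x o ∧
        (∀ t, min r s ≤ t → t ≤ max r s → Occ (x, o) l t) ∧
        (∀ t, min r' s' ≤ t → t ≤ max r' s' → Occ (x, o) l' t) := by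
  classical
  obtain ⟨a, b, P, hab, hdisj⟩ := hr
  -- Demands are unordered; the path is reversed if necessary, so that it starts at the source of
  -- the directed demand.
  have horient : ∀ d : D, ∃ (u v : Fin W.size) (w : W.graph.Walk u v),
      W.DemandArc (W.decode u) (W.decode v) ∧ ∀ c, c ∈ w.support ↔ c ∈ (P d).1.support := by
    intro d
    have hd := hD d.2
    rw [← hab d, mem_demandSet] at hd
    rcases hd with hd | hd
    · exact ⟨_, _, (P d).1, hd, fun _ => Iff.rfl⟩
    · exact ⟨_, _, (P d).1.reverse, hd, fun c => by simp⟩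
  choose u v w harc hsupp using horient
  have hends : ∀ d, ∃ l r l' r', W.decode (u d) = .inl (l, r) ∧ W.decode (v d) = .inl (l', r') ∧
      W.Demand l r l' r' := by
    intro d
    have h := harc d
    rcases hu : W.decode (u d) with ⟨l, r⟩ | z <;> rcases hv : W.decode (v d) with ⟨l', r'⟩ | z' <;>
      rw [hu, hv] at h
    · exact ⟨l, r, l', r', rfl, rfl, h⟩
    all_goals exact h.elim
  let S : D → Finset (ℕ × ℕ) := fun d =>
    W.live.filter fun z => ∃ c ∈ (w d).support, W.decode c = .inr z
  have hmem : ∀ d c z, c ∈ (w d).support → W.decode c = .inr z → z ∈ S d := by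
    intro d c z hc hz
    obtain ⟨l, r, -, -, hu, -, -⟩ := hends d
    exact Finset.mem_filter.2 ⟨W.mem_live.2 (live_of_mem_support _ hu hc hz), c, hc, hz⟩
  have hshare : ∀ d e c, c ∈ (w d).support → c ∈ (w e).support → d = e := by
    intro d e c hc hc'
    by_contra hne
    exact hdisj d e hne ((hsupp d c).1 hc) ((hsupp e c).1 hc')
  refine ⟨W.live.filter fun z => ¬ ∃ d, S d = {z},
    fun z l t => ∃ d, S d = {z} ∧ ∃ c ∈ (w d).support, W.decode c = .inl (l, t), ?_, ?_, ?_⟩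
  · have := Finset.card_filter_not_singleton_add_le W.live S ?_ (fun d => Finset.filter_subset _ _) ?_
    · rwa [Fintype.card_coe] at this
    · intro d
      obtain ⟨l, r, l', r', hu, hv, h⟩ := hends d
      obtain ⟨c, hc, z, hz⟩ := exists_special_mem_support (w d) hv hu h.line_ne
      exact ⟨z, hmem d c z hc hz⟩
    · intro d e hne
      rw [Finset.disjoint_left]
      intro z hz hz'
      obtain ⟨-, c, hc, hcz⟩ := Finset.mem_filter.1 hz
      obtain ⟨-, c', hc', hcz'⟩ := Finset.mem_filter.1 hz'
      obtain rfl : c = c' := W.decode_fin_injective (hcz.trans hcz'.symm)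
      exact hne (hshare d e c hc hc')
  · rintro z z' l t ⟨d, hd, c, hc, hct⟩ ⟨d', hd', c', hc', hct'⟩
    obtain rfl : c = c' := W.decode_fin_injective (hct.trans hct'.symm)
    obtain rfl := hshare d d' c hc hc'
    exact Finset.singleton_injective (hd.symm.trans hd')
  · intro x o hlive hbad
    rw [Finset.mem_filter, not_and, not_not] at hbad
    obtain ⟨d, hd⟩ := hbad (W.mem_live.2 hlive)
    have hz : (x, o) ∈ S d := hd ▸ Finset.mem_singleton_self _
    obtain ⟨-, c, hc, hcz⟩ := Finset.mem_filter.1 hz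
    obtain ⟨l, r, l', r', hu, hv, h⟩ := hends d
    have honly : ∀ c ∈ (w d).support, ∀ z, W.decode c = .inr z → z = (x, o) := fun c hc z hz =>
      Finset.mem_singleton.1 (hd ▸ hmem d c z hc hz)
    -- The path is cut at its only special vertex; either half stays on the line of its end.
    obtain ⟨s, h1, h2⟩ := exists_attached_of_walk ((w d).takeUntil c hc) hcz hu
      fun c' hc' => honly c' ((w d).support_takeUntil_subset_support hc hc')
    obtain ⟨s', h1', h2'⟩ := exists_attached_of_walk ((w d).dropUntil c hc).reverse hcz hv
      fun c' hc' => honly c' ((w d).support_dropUntil_subset_support hc (by simpa using hc'))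
    refine ⟨l, r, s, l', r', s', h, h1, h1', fun t ht ht' => ?_, fun t ht ht' => ?_⟩
    · obtain ⟨c', hc', h⟩ := h2 t ht ht'
      exact ⟨d, hd, c', (w d).support_takeUntil_subset_support hc hc', h⟩
    · obtain ⟨c', hc', h⟩ := h2' t ht ht'
      exact ⟨d, hd, c', (w d).support_dropUntil_subset_support hc (by simpa using hc'), h⟩

end Network

/-! ### Values from routings and routings from values -/

namespace Network

variable {W : Network}

theorem exists_routable_card_eq_opt (W : Network) :
    ∃ D ⊆ W.demandSet, W.graph.Routable D ∧ D.card = W.toNDP.opt := by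
  classical
  have hne : (W.demandSet.powerset.filter W.graph.Routable).Nonempty :=
    ⟨∅, Finset.mem_filter.2 ⟨Finset.empty_mem_powerset _, fun d => absurd d.2 (Finset.notMem_empty _),
      fun d => absurd d.2 (Finset.notMem_empty _), fun d => absurd d.2 (Finset.notMem_empty _), fun d => absurd d.2 (Finset.notMem_empty _),
      fun d => absurd d.2 (Finset.notMem_empty _)⟩⟩
  obtain ⟨D, hD, h⟩ := Finset.exists_mem_eq_sup _ hne Finset.card
  obtain ⟨h1, h2⟩ := Finset.mem_filter.1 hD
  refine ⟨D, Finset.mem_powerset.1 h1, h2, ?_⟩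
  rw [← h, NDPInstance.opt]
  congr

/-- From an almost optimal routing one reads off values of the variables that satisfy every
constraint none of whose special vertices is bad. -/
theorem exists_values (W : Network) : ∃ (Bad : Finset (ℕ × ℕ)) (val : ℕ → ℕ),
    Bad.card + 2 * W.toNDP.opt ≤ 2 * W.live.card ∧
    ∀ x o p y q, W.Rel x o p y q → (x, o) ∉ Bad → (x, 0) ∉ Bad → (x, 7) ∉ Bad →
      (y, 0) ∉ Bad → (y, 7) ∉ Bad → W.Rel x o (val x) y (val y) := by
  obtain ⟨D, hD, hr, hcard⟩ := W.exists_routable_card_eq_opt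
  obtain ⟨Bad, Occ, h1, hocc, hpath⟩ := exists_occupation D hD hr
  rw [hcard] at h1
  have hdem : ∀ {l r l' r' : ℕ}, W.Demand l r l' r' → l' % 2 = 1 →
      ∃ x p, p < W.n ∧ l = 2 * x ∧ l' = 2 * x + 1 ∧
        (r = 8 * p ∧ r' = 8 * p + 7 ∨ r = 8 * p + 7 ∧ r' = 8 * p) := by
    rintro l r l' r' (⟨x, p, -, h⟩ | ⟨x, o, p, y, q, -, -, -, h, -⟩) hl
    · exact ⟨x, p, h⟩
    · omega
  have hline : ∀ {l r x o : ℕ}, W.Attached l r x o → (o = 0 ∨ o = 7) →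
      (o = 0 ∧ (l = 2 * x ∧ r = 0 ∨ l = 2 * x + 1 ∧ r + 1 = 8 * W.n) ∨
        o = 7 ∧ (l = 2 * x ∧ r + 1 = 8 * W.n ∨ l = 2 * x + 1 ∧ r = 0)) := by
    rintro l r x o (⟨-, h⟩ | ⟨p, y, q, h, -⟩) ho
    · exact h
    · have := W.bounds _ _ _ _ _ h
      omega
  have hparity : ∀ {l r l' r' : ℕ}, W.Demand l r l' r' → l % 2 = 0 := by
    rintro l r l' r' (⟨x, p, -, -, h, -⟩ | ⟨x, o, p, y, q, -, h, -⟩) <;> omega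
  have hval : ∀ x, ∃ p, W.Active x → (x, 0) ∉ Bad → (x, 7) ∉ Bad → ∀ z q o, z ≠ (x, 0) →
      z ≠ (x, 7) → o < 8 → Occ z (2 * x) (8 * q + o) → q < W.n → q = p := by
    intro x
    by_cases hx : W.Active x ∧ (x, 0) ∉ Bad ∧ (x, 7) ∉ Bad
    swap
    · exact ⟨0, fun h h' h'' => absurd ⟨h, h', h''⟩ hx⟩
    obtain ⟨hact, hb0, hb7⟩ := hx
    obtain ⟨l₀, r₀, s₀, l₀', r₀', s₀', d0, a0, a0', c0, c0'⟩ :=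
      hpath x 0 (.inl ⟨hact, .inl rfl⟩) hb0
    obtain ⟨l₁, r₁, s₁, l₁', r₁', s₁', d1, a1, a1', c1, c1'⟩ :=
      hpath x 7 (.inl ⟨hact, .inr rfl⟩) hb7
    have e0 := hline a0 (.inl rfl)
    have e0' := hline a0' (.inl rfl)
    have e1 := hline a1 (.inr rfl)
    have e1' := hline a1' (.inr rfl)
    have f0 := hparity d0
    have f1 := hparity d1
    have g0 := d0.line_ne
    have g1 := d1.line_ne
    obtain ⟨x0, p₀, hn₀, hx0, hx0', hp₀⟩ := hdem d0 (by omega)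
    obtain ⟨x1, p₁, -, hx1, hx1', hp₁⟩ := hdem d1 (by omega)
    obtain rfl : x0 = x := by omega
    obtain rfl : x1 = x0 := by omega
    subst hx0 hx0' hx1 hx1'
    -- On line 2x + 1 the path of (x, 0) covers everything from block p₀ to the end, and the path of
    -- (x, 7) everything from the start to block p₁. If p₀ < p₁, both would contain position 8p₀ +
    -- 7.
    have key : p₁ ≤ p₀ := by
      by_contra hlt
      have := hocc _ _ _ _ (c0' (8 * p₀ + 7) (by omega) (by omega))
        (c1' (8 * p₀ + 7) (by omega) (by omega))
      simp at this
    -- On line 2x the blocks before p₀ belong to the path of (x, 0). As p₁ ≤ p₀, those after p₀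
    -- belong to the path of (x, 7). Any other path therefore meets this line only in block p₀.
    refine ⟨p₀, fun _ _ _ z q o hz hz' ho hq hqn => ?_⟩
    by_contra hne
    rcases Nat.lt_or_gt_of_ne hne with h | h
    · exact hz (hocc _ _ _ _ hq (c0 _ (by omega) (by omega)))
    · exact hz' (hocc _ _ _ _ hq (c1 _ (by omega) (by omega)))
  choose val hval using hval
  refine ⟨Bad, val, h1, fun x o p y q hrel hb hx0 hx7 hy0 hy7 => ?_⟩
  obtain ⟨ho1, ho6, -, -, hactx, hacty, hxy⟩ := W.bounds _ _ _ _ _ hrel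
  obtain ⟨l, r, s, l', r', s', d, a, a', c, c'⟩ := hpath x o (.inr ⟨p, y, q, hrel⟩) hb
  have hhub : ∀ {l r : ℕ}, W.Attached l r x o → l = 2 * x ∨ l = 2 * y := by
    rintro l r (⟨-, h⟩ | ⟨p', y', q', h, h'⟩)
    · omega
    · obtain rfl := W.target_unique _ _ _ _ _ _ _ _ hrel h
      omega
  have e := hhub a
  have e' := hhub a'
  rcases d with ⟨x₁, p₁, -, -, -, h, -⟩ | ⟨x₁, o₁, p₁, y₁, q₁, h, rfl, rfl, rfl, rfl⟩
  · omega
  have hb₁ := W.bounds _ _ _ _ _ h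
  have h2 : x₁ = x ∧ y₁ = y ∨ x₁ = y ∧ y₁ = x := by omega
  rcases h2 with ⟨rfl, rfl⟩ | ⟨rfl, rfl⟩
  · have hp : p₁ = val x₁ := hval x₁ hactx hx0 hx7 (x₁, o) p₁ o₁ (by simp; omega) (by simp; omega)
      (by omega) (c _ (by omega) (by omega)) (by omega)
    have hq : q₁ = val y₁ := hval y₁ hacty hy0 hy7 (x₁, o) q₁ o₁ (by simp; omega) (by simp; omega)
      (by omega) (c' _ (by omega) (by omega)) (by omega)
    rw [← hp, ← hq]
    -- The path through (x, o) may serve a demand of another slot between the same two variables;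
    -- the pair it selects is allowed in slot o as well.
    exact W.parallel _ _ _ _ _ _ _ _ hrel h
  · exact absurd h (W.antiparallel _ _ _ _ _ _ _ _ hrel)

theorem exists_walk_line {l : ℕ} (hl : l < 2 * W.V) {r s : ℕ} (hr : r < 8 * W.n)
    (hs : s < 8 * W.n) {u v : Fin W.size} (hu : W.decode u = .inl (l, r))
    (hv : W.decode v = .inl (l, s)) : ∃ w : W.graph.Walk u v, ∀ c ∈ w.support,
      ∃ t, min r s ≤ t ∧ t ≤ max r s ∧ W.decode c = .inl (l, t) := by
  have key : ∀ k r, r + k < 8 * W.n → ∀ u v : Fin W.size, W.decode u = .inl (l, r) →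
      W.decode v = .inl (l, r + k) → ∃ w : W.graph.Walk u v, ∀ c ∈ w.support,
        ∃ t, r ≤ t ∧ t ≤ r + k ∧ W.decode c = .inl (l, t) := by
    intro k
    induction k with
    | zero =>
      intro r hr u v hu hv
      obtain rfl : u = v := W.decode_fin_injective (hu.trans hv.symm)
      refine ⟨.nil, fun c hc => ⟨r, le_rfl, le_rfl, ?_⟩⟩
      rwa [List.mem_singleton.1 hc]
    | succ k ih =>
      intro r hr u v hu hv
      obtain ⟨b, hb⟩ := W.exists_line hl (show r + 1 < 8 * W.n by omega)
      obtain ⟨w, hw⟩ := ih (r + 1) (by omega) b v hb (by rw [hv]; congr 2; omega)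
      refine ⟨.cons (Or.inl ?_) w, fun c hc => ?_⟩
      · rw [hu, hb]; exact ⟨rfl, rfl⟩
      · rcases List.mem_cons.1 hc with rfl | hc
        · exact ⟨r, le_rfl, by omega, hu⟩
        · obtain ⟨t, h1, h2, h3⟩ := hw c hc
          exact ⟨t, by omega, by omega, h3⟩
  rcases le_total r s with h | h
  · obtain ⟨w, hw⟩ := key (s - r) r (by omega) u v hu (by rw [hv]; congr 2; omega)
    refine ⟨w, fun c hc => ?_⟩
    obtain ⟨t, h1, h2, h3⟩ := hw c hc
    exact ⟨t, by omega, by omega, h3⟩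
  · obtain ⟨w, hw⟩ := key (r - s) s (by omega) v u hv (by rw [hu]; congr 2; omega)
    refine ⟨w.reverse, fun c hc => ?_⟩
    obtain ⟨t, h1, h2, h3⟩ := hw c (by simpa using hc)
    exact ⟨t, by omega, by omega, h3⟩

theorem exists_walk_special {l r s x o : ℕ} (hl : l < 2 * W.V) (hr : r < 8 * W.n)
    (hs : s < 8 * W.n) (h : W.Attached l s x o) {u v : Fin W.size}
    (hu : W.decode u = .inl (l, r)) (hv : W.decode v = .inr (x, o)) :
    ∃ w : W.graph.Walk u v, ∀ c ∈ w.support, W.decode c = .inr (x, o) ∨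
      ∃ t, min r s ≤ t ∧ t ≤ max r s ∧ W.decode c = .inl (l, t) := by
  obtain ⟨b, hb⟩ := W.exists_line hl hs
  obtain ⟨w, hw⟩ := exists_walk_line hl hr hs hu hb
  have hadj : W.graph.Adj b v := Or.inl (by rw [hb, hv]; exact h)
  refine ⟨w.concat hadj, fun c hc => ?_⟩
  · rw [SimpleGraph.Walk.support_concat, List.mem_append,
      List.mem_singleton] at hc
    rcases hc with hc | rfl
    · exact .inr (hw c hc)
    · exact .inl hv

/-- The positions occupied by the path through the special vertex in slot `o` of `x`, in the
routing that belongs to the values `val`. -/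
def Owns (W : Network) (val : ℕ → ℕ) (x o l t : ℕ) : Prop :=
  (o = 0 ∧ (l = 2 * x ∧ t ≤ 8 * val x ∨ l = 2 * x + 1 ∧ 8 * val x + 7 ≤ t)) ∨
  (o = 7 ∧ (l = 2 * x ∧ 8 * val x + 7 ≤ t ∨ l = 2 * x + 1 ∧ t ≤ 8 * val x)) ∨
  ∃ p y q, W.Rel x o p y q ∧ (l = 2 * x ∧ t = 8 * val x + o ∨ l = 2 * y ∧ t = 8 * val y + o)

/-- The paths of (x, 0) and (x, 7) leave the interior of the block of `val x` free, and there the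
residue modulo 8 is the slot. Two constraints meeting a variable in the same slot coincide, by
`source_unique` and `source_ne_target`. -/
theorem Owns.unique {val : ℕ → ℕ} {x o x' o' l t : ℕ} (h : W.Owns val x o l t)
    (h' : W.Owns val x' o' l t) : x = x' ∧ o = o' := by
  have hv : ∀ {x y : ℕ}, 2 * x = 2 * y → val x = val y := fun {x y} h => by
    rw [show x = y by omega]
  have hv' : ∀ {x y : ℕ}, 2 * x + 1 = 2 * y + 1 → val x = val y := fun {x y} h => by
    rw [show x = y by omega]
  have hend : ∀ {x o l t x' o' : ℕ}, o = 0 ∧ (l = 2 * x ∧ t ≤ 8 * val x ∨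
      l = 2 * x + 1 ∧ 8 * val x + 7 ≤ t) ∨ o = 7 ∧ (l = 2 * x ∧ 8 * val x + 7 ≤ t ∨
      l = 2 * x + 1 ∧ t ≤ 8 * val x) → (∃ p y q, W.Rel x' o' p y q ∧
      (l = 2 * x' ∧ t = 8 * val x' + o' ∨ l = 2 * y ∧ t = 8 * val y + o')) → False := by
    rintro x o l t x' o' h ⟨p, y, q, hr, h'⟩
    have := W.bounds _ _ _ _ _ hr
    rcases h' with ⟨rfl, rfl⟩ | ⟨rfl, rfl⟩
    · rcases h with ⟨-, ⟨h, h'⟩ | ⟨h, h'⟩⟩ | ⟨-, ⟨h, h'⟩ | ⟨h, h'⟩⟩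
      · have := hv h; omega
      · omega
      · have := hv h; omega
      · omega
    · rcases h with ⟨-, ⟨h, h'⟩ | ⟨h, h'⟩⟩ | ⟨-, ⟨h, h'⟩ | ⟨h, h'⟩⟩
      · have := hv h; omega
      · omega
      · have := hv h; omega
      · omega
  rw [Owns, ← or_assoc] at h h'
  rcases h with h | h <;> rcases h' with h' | h'
  · have hxx : x = x' := by omega
    subst hxx
    omega
  · exact (hend h h').elim
  · exact (hend h' h).elim
  · obtain ⟨p, y, q, h, e⟩ := h
    obtain ⟨p', y', q', h', e'⟩ := h'
    have hb := W.bounds _ _ _ _ _ h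
    have hb' := W.bounds _ _ _ _ _ h'
    rcases e with ⟨rfl, rfl⟩ | ⟨rfl, rfl⟩ <;> rcases e' with ⟨e, e'⟩ | ⟨e, e'⟩
    · have := hv e; omega
    · have := hv e
      obtain rfl : o = o' := by omega
      obtain rfl : x = y' := by omega
      exact absurd h (W.source_ne_target _ _ _ _ _ _ _ _ h')
    · have := hv e
      obtain rfl : o = o' := by omega
      obtain rfl : y = x' := by omega
      exact absurd h' (W.source_ne_target _ _ _ _ _ _ _ _ h)
    · have := hv e
      obtain rfl : o = o' := by omega
      obtain rfl : y = y' := by omega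
      exact ⟨W.source_unique _ _ _ _ _ _ _ _ h h', rfl⟩

/-- Satisfying values yield a routing that uses every attached special vertex. -/
theorem card_live_le_opt (val : ℕ → ℕ) (hval : ∀ x, W.Active x → val x < W.n)
    (hsat : ∀ x o p y q, W.Rel x o p y q → W.Rel x o (val x) y (val y)) :
    W.live.card ≤ W.toNDP.opt := by
  classical
  have hdata : ∀ x o, W.Live x o → ∃ l r s l' r' s', W.Demand l r l' r' ∧ W.Attached l s x o ∧
      W.Attached l' s' x o ∧ (l < 2 * W.V ∧ l' < 2 * W.V ∧ r < 8 * W.n ∧ r' < 8 * W.n ∧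
      s < 8 * W.n ∧ s' < 8 * W.n) ∧
      (∀ t, min r s ≤ t → t ≤ max r s → t < 8 * W.n → W.Owns val x o l t) ∧
      (∀ t, min r' s' ≤ t → t ≤ max r' s' → t < 8 * W.n → W.Owns val x o l' t) := by
    rintro x o (⟨hact, ho⟩ | ⟨p, y, q, h⟩)
    · have h1 := hval x hact
      have h2 := W.lt_of_active x hact
      rcases ho with ho | ho <;> subst ho
      · refine ⟨2 * x, 8 * val x, 0, 2 * x + 1, 8 * val x + 7, 8 * W.n - 1,
          .inl ⟨x, val x, hact, h1, rfl, rfl, .inl ⟨rfl, rfl⟩⟩,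
          .inl ⟨hact, .inl ⟨rfl, .inl ⟨rfl, rfl⟩⟩⟩,
          .inl ⟨hact, .inl ⟨rfl, .inr ⟨rfl, by omega⟩⟩⟩, by omega,
          fun t _ _ _ => .inl ⟨rfl, .inl ⟨rfl, by omega⟩⟩,
          fun t _ _ _ => .inl ⟨rfl, .inr ⟨rfl, by omega⟩⟩⟩
      · refine ⟨2 * x, 8 * val x + 7, 8 * W.n - 1, 2 * x + 1, 8 * val x, 0,
          .inl ⟨x, val x, hact, h1, rfl, rfl, .inr ⟨rfl, rfl⟩⟩,
          .inl ⟨hact, .inr ⟨rfl, .inl ⟨rfl, by omega⟩⟩⟩,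
          .inl ⟨hact, .inr ⟨rfl, .inr ⟨rfl, rfl⟩⟩⟩, by omega,
          fun t _ _ _ => .inr (.inl ⟨rfl, .inl ⟨rfl, by omega⟩⟩),
          fun t _ _ _ => .inr (.inl ⟨rfl, .inr ⟨rfl, by omega⟩⟩)⟩
    · have h' := hsat _ _ _ _ _ h
      have hb := W.bounds _ _ _ _ _ h'
      have h2 := W.lt_of_active x hb.2.2.2.2.1
      have h3 := W.lt_of_active y hb.2.2.2.2.2.1
      refine ⟨2 * x, 8 * val x + o, 8 * val x + o, 2 * y, 8 * val y + o, 8 * val y + o,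
        .inr ⟨x, o, _, y, _, h', rfl, rfl, rfl, rfl⟩, .inr ⟨_, y, _, h', .inl ⟨rfl, rfl⟩⟩,
        .inr ⟨_, y, _, h', .inr ⟨rfl, rfl⟩⟩, by omega,
        fun t _ _ _ => .inr (.inr ⟨_, y, _, h', .inl ⟨rfl, by omega⟩⟩),
        fun t _ _ _ => .inr (.inr ⟨_, y, _, h', .inr ⟨rfl, by omega⟩⟩)⟩
  have hwalk : ∀ z : W.live, ∃ (u v : Fin W.size) (w : W.graph.Walk u v),
      s(u, v) ∈ W.demandSet ∧ ∀ c ∈ w.support, W.decode c = .inr z.1 ∨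
        ∃ l t, W.decode c = .inl (l, t) ∧ W.Owns val z.1.1 z.1.2 l t := by
    intro z
    obtain ⟨l, r, s, l', r', s', d, a, a', ⟨hl, hl', hr, hr', hs, hs'⟩, o, o'⟩ := hdata _ _ (W.mem_live.1 z.2)
    obtain ⟨u, hu⟩ := W.exists_line hl hr
    obtain ⟨v, hv⟩ := W.exists_line hl' hr'
    obtain ⟨m, hm⟩ := W.exists_special (Finset.mem_range.1
      (Finset.mem_product.1 (Finset.mem_filter.1 z.2).1).1) (Finset.mem_range.1
      (Finset.mem_product.1 (Finset.mem_filter.1 z.2).1).2)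
    obtain ⟨w, hw⟩ := exists_walk_special hl hr hs a hu hm
    obtain ⟨w', hw'⟩ := exists_walk_special hl' hr' hs' a' hv hm
    refine ⟨u, v, w.append w'.reverse, W.mem_demandSet.2 (.inl ?_), fun c hc => ?_⟩
    · rw [hu, hv]; exact d
    · rw [SimpleGraph.Walk.mem_support_append_iff, SimpleGraph.Walk.support_reverse,
        List.mem_reverse] at hc
      rcases hc with hc | hc
      · rcases hw c hc with h | ⟨t, h1, h2, h3⟩
        · exact .inl h
        · exact .inr ⟨l, t, h3, o t h1 h2 (by omega)⟩
      · rcases hw' c hc with h | ⟨t, h1, h2, h3⟩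
        · exact .inl h
        · exact .inr ⟨l', t, h3, o' t h1 h2 (by omega)⟩
  choose u v w hdem hw using hwalk
  have hdisj : ∀ z z' c, c ∈ (w z).support → c ∈ (w z').support → z = z' := by
    intro z z' c hc hc'
    rcases hw z c hc with h | ⟨l, t, h, ho⟩ <;> rcases hw z' c hc' with h' | ⟨l', t', h', ho'⟩ <;>
      rw [h] at h'
    · exact Subtype.ext (Sum.inr_injective h')
    · cases h'
    · cases h'
    · obtain ⟨rfl, rfl⟩ := Prod.ext_iff.1 (Sum.inl_injective h')
      obtain ⟨h1, h2⟩ := ho.unique ho'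
      exact Subtype.ext (Prod.ext h1 h2)
  -- Walks with the same ends share a vertex, so disjointness makes the demands distinct.
  have hinj : Function.Injective fun z : W.live => s(u z, v z) := by
    intro z z' h
    refine hdisj z z' (u z) (w z).start_mem_support ?_
    rcases Sym2.eq_iff.1 h with ⟨h, -⟩ | ⟨h, -⟩ <;> rw [h]
    · exact (w z').start_mem_support
    · exact (w z').end_mem_support
  let D : Finset (Sym2 (Fin W.size)) := Finset.univ.image fun z : W.live => s(u z, v z)
  have hD : D ∈ W.demandSet.powerset.filter W.graph.Routable := by
    refine Finset.mem_filter.2 ⟨Finset.mem_powerset.2 fun d hd => ?_, ?_⟩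
    · obtain ⟨z, -, rfl⟩ := Finset.mem_image.1 hd
      exact hdem z
    · have hex : ∀ d : D, ∃ z : W.live, s(u z, v z) = d := fun d => by
        obtain ⟨z, -, h⟩ := Finset.mem_image.1 d.2
        exact ⟨z, h⟩
      choose f hf using hex
      refine ⟨fun d => u (f d), fun d => v (f d), fun d => (w (f d)).toPath, hf,
        fun d e hde c hc hc' => hde (Subtype.ext ?_)⟩
      rw [← hf d, ← hf e, hdisj (f d) (f e) c
        (SimpleGraph.Walk.support_toPath_subset_support _ hc) (SimpleGraph.Walk.support_toPath_subset_support _ hc')]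
  have hcard : D.card = W.live.card := by
    rw [Finset.card_image_of_injective _ hinj, Finset.card_univ, Fintype.card_coe]
  rw [← hcard, NDPInstance.opt]
  refine Finset.le_sup (f := Finset.card) ?_
  exact (@Finset.mem_filter _ W.graph.Routable (fun _ => Classical.propDecidable _) _ _).2
    (Finset.mem_filter.1 hD)

end Network

/-! ### The constraint network of an instance of Maximum Colored Densest `k`-Subgraph -/

namespace ColoredInstance

variable (I : ColoredInstance)

theorem Edge.symm {I : ColoredInstance} {i p j q : ℕ} : I.Edge i p j q → I.Edge j q i p :=
  fun ⟨hi, hp, hj, hq, h⟩ => ⟨hj, hq, hi, hp, h.symm⟩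

theorem Edge.ne {I : ColoredInstance} {i p j q : ℕ} : I.Edge i p j q → i ≠ j := by
  rintro ⟨hi, hp, hj, hq, h⟩ rfl
  exact I.indep _ _ _ h

/-- Some edge joins the colors `i` and `j`. -/
def Joined (i j : ℕ) : Prop := ∃ p, p < I.n ∧ ∃ q, q < I.n ∧ I.Edge i p j q

theorem Edge.joined {I : ColoredInstance} {i p j q : ℕ} (h : I.Edge i p j q) : I.Joined i j :=
  ⟨p, h.2.1, q, h.2.2.2.1, h⟩

theorem Joined.symm {I : ColoredInstance} {i j : ℕ} : I.Joined i j → I.Joined j i :=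
  fun ⟨_, _, _, _, h⟩ => h.symm.joined

theorem Joined.ne {I : ColoredInstance} {i j : ℕ} : I.Joined i j → i ≠ j :=
  fun ⟨_, _, _, _, h⟩ => h.ne

theorem Joined.lt {I : ColoredInstance} {i j : ℕ} : I.Joined i j → i < I.k ∧ j < I.k :=
  fun ⟨_, _, _, _, h⟩ => ⟨h.1, h.2.2.1⟩

open Classical in
/-- The number of colors joined to `i`. -/
noncomputable def deg (i : ℕ) : ℕ := ((Finset.range I.k).filter fun j => I.Joined i j).card

open Classical in
/-- The number of colors before `j` joined to `i`. -/
noncomputable def rank (i j : ℕ) : ℕ := ((Finset.range j).filter fun j' => I.Joined i j').card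

/-- The side length of the square of copies of color `i`: the least number whose square is at least
the degree of `i`. -/
noncomputable def width (i : ℕ) : ℕ :=
  ((Finset.range (I.deg i)).filter fun z => z * z < I.deg i).card

theorem rank_lt_rank {i j j' : ℕ} (h : I.Joined i j) (hj : j < j') : I.rank i j < I.rank i j' := by
  classical
  refine Finset.card_lt_card ⟨fun a ha => ?_, fun hsub => ?_⟩
  · simp only [Finset.mem_filter, Finset.mem_range] at ha ⊢
    exact ⟨ha.1.trans hj, ha.2⟩
  · have := hsub (Finset.mem_filter.2 ⟨Finset.mem_range.2 hj, h⟩)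
    simp at this

theorem rank_injective {i j j' : ℕ} (h : I.Joined i j) (h' : I.Joined i j')
    (he : I.rank i j = I.rank i j') : j = j' := by
  rcases lt_trichotomy j j' with hlt | heq | hlt
  · exact absurd he (I.rank_lt_rank h hlt).ne
  · exact heq
  · exact absurd he.symm (I.rank_lt_rank h' hlt).ne

theorem rank_lt_deg {i j : ℕ} (h : I.Joined i j) : I.rank i j < I.deg i := I.rank_lt_rank h h.lt.2

theorem deg_le (i : ℕ) : I.deg i ≤ I.k := by
  classical exact (Finset.card_filter_le _ _).trans (Finset.card_range _).le

/-- The numbers whose square is below the degree form an initial segment, so their count is its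
threshold. -/
theorem lt_width_iff {i z : ℕ} : z < I.width i ↔ z * z < I.deg i := by
  set d := I.deg i with hd
  have hmono : ∀ {y z : ℕ}, z * z < d → y ≤ z → y ∈ (Finset.range d).filter fun z => z * z < d := by
    intro y z hz hy
    have h1 : y * y ≤ z * z := Nat.mul_le_mul hy hy
    have h2 : y ≤ y * y := Nat.le_mul_self y
    exact Finset.mem_filter.2 ⟨Finset.mem_range.2 (by omega), by omega⟩
  constructor
  · intro h
    by_contra hz
    have : (Finset.range d).filter (fun z => z * z < d) ⊆ Finset.range z := by
      intro y hy
      rw [Finset.mem_range]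
      by_contra hzy
      have h1 : z * z ≤ y * y := Nat.mul_le_mul (not_lt.1 hzy) (not_lt.1 hzy)
      have h2 := (Finset.mem_filter.1 hy).2
      omega
    have := Finset.card_le_card this
    rw [Finset.card_range] at this
    exact absurd h (not_lt.2 this)
  · intro hz
    have : Finset.range (z + 1) ⊆ (Finset.range d).filter fun z => z * z < d := fun y hy =>
      hmono hz (Nat.lt_succ_iff.1 (Finset.mem_range.1 hy))
    have := Finset.card_le_card this
    rw [Finset.card_range] at this
    exact this

theorem deg_le_width_sq (i : ℕ) : I.deg i ≤ I.width i * I.width i := by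
  by_contra h
  exact lt_irrefl _ (I.lt_width_iff.2 (not_le.1 h))

/-- For width m + 1 one has m² + 1 ≤ deg, and (m + 1)² ≤ 2 (m² + 1). -/
theorem width_sq_le (i : ℕ) : I.width i * I.width i ≤ 2 * I.deg i := by
  rcases h : I.width i with _ | m
  · omega
  · have := I.lt_width_iff.1 (show m < I.width i by omega)
    nlinarith [sq_nonneg ((m : ℤ) - 1)]

theorem width_le (i : ℕ) : I.width i ≤ I.k :=
  (Finset.card_filter_le _ _).trans ((Finset.card_range _).le.trans (I.deg_le i))

/-- The number of the variable of color `i`, side `s` and position `(a, b)`. -/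
def code (i s a b : ℕ) : ℕ := ((i * 2 + s) * I.k + a) * I.k + b

/-- The color of a variable. -/
def col (x : ℕ) : ℕ := x / I.k / I.k / 2

/-- The side of a variable. -/
def side (x : ℕ) : ℕ := x / I.k / I.k % 2

/-- The first coordinate of a variable. -/
def fst (x : ℕ) : ℕ := x / I.k % I.k

/-- The second coordinate of a variable. -/
def snd (x : ℕ) : ℕ := x % I.k

theorem code_eta (x : ℕ) : I.code (I.col x) (I.side x) (I.fst x) (I.snd x) = x := by
  simp only [code, col, side, fst, snd, Nat.div_add_mod']

theorem ext {x y : ℕ} (h1 : I.col x = I.col y) (h2 : I.side x = I.side y)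
    (h3 : I.fst x = I.fst y) (h4 : I.snd x = I.snd y) : x = y := by
  rw [← I.code_eta x, ← I.code_eta y, h1, h2, h3, h4]

section code

variable {i s a b : ℕ}

theorem mul_add_div_mod {u k b : ℕ} (hb : b < k) : (u * k + b) / k = u ∧ (u * k + b) % k = b := by
  rw [Nat.mul_comm, Nat.mul_add_div (by omega), Nat.mul_add_mod, Nat.div_eq_of_lt hb,
    Nat.mod_eq_of_lt hb]
  exact ⟨rfl, rfl⟩

theorem snd_code (hb : b < I.k) : I.snd (I.code i s a b) = b := (mul_add_div_mod hb).2

theorem fst_code (ha : a < I.k) (hb : b < I.k) : I.fst (I.code i s a b) = a := by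
  rw [fst, code, (mul_add_div_mod hb).1, (mul_add_div_mod ha).2]

theorem side_code (hs : s < 2) (ha : a < I.k) (hb : b < I.k) : I.side (I.code i s a b) = s := by
  rw [side, code, (mul_add_div_mod hb).1, (mul_add_div_mod ha).1, (mul_add_div_mod hs).2]

theorem col_code (hs : s < 2) (ha : a < I.k) (hb : b < I.k) : I.col (I.code i s a b) = i := by
  rw [col, code, (mul_add_div_mod hb).1, (mul_add_div_mod ha).1, (mul_add_div_mod hs).1]

theorem code_lt (hi : i < I.k) (hs : s < 2) (ha : a < I.k) (hb : b < I.k) :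
    I.code i s a b < I.k * 2 * I.k * I.k := by
  have h : ∀ {u v k c : ℕ}, u < v → c < k → u * k + c < v * k := fun {u v k c} hu hc =>
    calc u * k + c < u * k + k := by omega
      _ = (u + 1) * k := by ring
      _ ≤ v * k := Nat.mul_le_mul_right _ hu
  exact h (h (h hi hs) ha) hb

end code

theorem col_lt {x : ℕ} (hx : x < I.k * 2 * I.k * I.k) : I.col x < I.k :=
  Nat.div_lt_of_lt_mul (Nat.div_lt_of_lt_mul (Nat.div_lt_of_lt_mul (by
    calc x < I.k * 2 * I.k * I.k := hx
      _ = _ := by ring)))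

/-- The variables of the network: on either side, color `i` has a square of copies. -/
def Active (x : ℕ) : Prop :=
  x < I.k * 2 * I.k * I.k ∧ I.fst x < I.width (I.col x) ∧ I.snd x < I.width (I.col x)

/-- The edge of type `o` of the expander leads from the copy `x` to the copy `y`. -/
def Step (o x y : ℕ) : Prop :=
  o = 1 ∧ I.fst y = I.fst x ∧ I.snd y = I.snd x ∨
  o = 2 ∧ I.fst y = (I.fst x + 1) % I.width (I.col x) ∧ I.snd y = I.snd x ∨
  o = 3 ∧ I.fst y = I.fst x ∧ I.snd y = (I.snd x + 1) % I.width (I.col x) ∨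
  o = 4 ∧ I.fst y = (I.fst x + I.snd x) % I.width (I.col x) ∧ I.snd y = I.snd x ∨
  o = 5 ∧ I.fst y = I.fst x ∧ I.snd y = (I.fst x + I.snd x) % I.width (I.col x)

/-- The copy `x` of its color is responsible for the edges to color `j`. -/
def Serves (x j : ℕ) : Prop :=
  I.fst x * I.width (I.col x) + I.snd x = I.rank (I.col x) j

/-- The constraints: equality along the edges of an expander between the two sides of a color, and
adjacency for one pair of copies of every two joined colors. -/
def Constraint (x o p y q : ℕ) : Prop :=
  I.Active x ∧ I.Active y ∧ p < I.n ∧ q < I.n ∧ I.side x = 0 ∧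
  ((I.side y = 1 ∧ I.col y = I.col x ∧ p = q ∧ I.Step o x y) ∨
    (o = 6 ∧ I.side y = 0 ∧ I.col x < I.col y ∧ I.Serves x (I.col y) ∧ I.Serves y (I.col x) ∧
      I.Edge (I.col x) p (I.col y) q))

theorem Step.bounds {I : ColoredInstance} {o x y : ℕ} (h : I.Step o x y) : 1 ≤ o ∧ o ≤ 5 := by
  unfold Step at h
  omega

theorem Step.target_unique {I : ColoredInstance} {o x y y' : ℕ} (h : I.Step o x y)
    (h' : I.Step o x y') : I.fst y = I.fst y' ∧ I.snd y = I.snd y' := by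
  unfold Step at h h'
  omega

theorem add_mod_cancel {m a a' c : ℕ} (ha : a < m) (ha' : a' < m)
    (h : (a + c) % m = (a' + c) % m) : a = a' := by
  have : a ≡ a' [MOD m] := Nat.ModEq.add_right_cancel' c h
  rwa [Nat.ModEq, Nat.mod_eq_of_lt ha, Nat.mod_eq_of_lt ha'] at this

/-- Every edge type acts on the square of copies of a color as a permutation. -/
theorem Step.source_unique {I : ColoredInstance} {o x x' y : ℕ} (h : I.Step o x y)
    (h' : I.Step o x' y) (hx : I.Active x) (hx' : I.Active x') (hc : I.col x = I.col x') :
    I.fst x = I.fst x' ∧ I.snd x = I.snd x' := by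
  obtain ⟨-, h1, h2⟩ := hx
  obtain ⟨-, h1', h2'⟩ := hx'
  rw [← hc] at h1' h2'
  unfold Step at h h'
  rw [← hc] at h'
  rcases h with ⟨rfl, e, e'⟩ | ⟨rfl, e, e'⟩ | ⟨rfl, e, e'⟩ | ⟨rfl, e, e'⟩ | ⟨rfl, e, e'⟩
  · omega
  · have h3 := (show _ ∧ _ by simpa using h' : I.fst y = (I.fst x' + 1) % _ ∧ I.snd y = I.snd x')
    exact ⟨add_mod_cancel h1 h1' (e.symm.trans h3.1), e'.symm.trans h3.2⟩
  · have h3 := (show _ ∧ _ by simpa using h' : I.fst y = I.fst x' ∧ I.snd y = (I.snd x' + 1) % _)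
    exact ⟨e.symm.trans h3.1, add_mod_cancel h2 h2' (e'.symm.trans h3.2)⟩
  · have h3 := (show _ ∧ _ by simpa using h' :
      I.fst y = (I.fst x' + I.snd x') % _ ∧ I.snd y = I.snd x')
    have h4 := e'.symm.trans h3.2
    rw [← h4] at h3
    exact ⟨add_mod_cancel h1 h1' (e.symm.trans h3.1), h4⟩
  · have h3 := (show _ ∧ _ by simpa using h' :
      I.fst y = I.fst x' ∧ I.snd y = (I.fst x' + I.snd x') % _)
    have h4 := e.symm.trans h3.1
    rw [← h4, add_comm _ (I.snd x')] at h3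
    rw [add_comm] at e'
    exact ⟨h4, add_mod_cancel h2 h2' (e'.symm.trans h3.2)⟩

/-- The two coordinates are the digits of the rank in base `width`. -/
theorem Serves.unique {I : ColoredInstance} {x y j : ℕ} (h : I.Serves x j) (h' : I.Serves y j)
    (hx : I.Active x) (hy : I.Active y) (hc : I.col x = I.col y) :
    I.fst x = I.fst y ∧ I.snd x = I.snd y := by
  have h1 := hx.2.2
  have h2 := hy.2.2
  unfold Serves at h h'
  rw [← hc] at h' h2
  have e := h.trans h'.symm
  have a1 := @mul_add_div_mod (I.fst x) _ _ h1
  have a2 := @mul_add_div_mod (I.fst y) _ _ h2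
  rw [e] at a1
  exact ⟨a1.1.symm.trans a2.1, a1.2.symm.trans a2.2⟩

/-- The constraint network of an instance. -/
def network : Network where
  V := I.k * 2 * I.k * I.k
  n := I.n
  Active := I.Active
  Rel := I.Constraint
  lt_of_active := fun _ h => h.1
  bounds := by
    rintro x o p y q ⟨hx, hy, hp, hq, hs, h⟩
    refine ⟨?_, ?_, hp, hq, hx, hy, ?_⟩
    · rcases h with h | h
      · exact h.2.2.2.bounds.1
      · omega
    · rcases h with h | h
      · exact h.2.2.2.bounds.2.trans (by omega)
      · omega
    · rintro rfl
      rcases h with h | h <;> omega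
  target_unique := by
    rintro x o p y q p' y' q' ⟨hx, hy, hp, hq, hs, h⟩ ⟨-, hy', hp', hq', -, h'⟩
    rcases h with ⟨h1, h2, h3, h4⟩ | ⟨rfl, h1, h2, h3, h4, h5⟩
    · rcases h' with ⟨h1', h2', h3', h4'⟩ | ⟨rfl, h1', h2', h3', h4', h5'⟩
      · obtain ⟨e, e'⟩ := h4.target_unique h4'
        exact I.ext (h2.trans h2'.symm) (h1.trans h1'.symm) e e'
      · exact absurd h4.bounds.2 (by omega)
    · rcases h' with ⟨h1', h2', h3', h4'⟩ | ⟨-, h1', h2', h3', h4', h5'⟩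
      · exact absurd h4'.bounds.2 (by omega)
      · have hc := I.rank_injective h5.joined h5'.joined (h3.symm.trans h3')
        obtain ⟨e, e'⟩ := h4.unique h4' hy hy' hc
        exact I.ext hc (h1.trans h1'.symm) e e'
  source_unique := by
    rintro x o p y q x' p' q' ⟨hx, hy, hp, hq, hs, h⟩ ⟨hx', -, hp', hq', hs', h'⟩
    rcases h with ⟨h1, h2, h3, h4⟩ | ⟨rfl, h1, h2, h3, h4, h5⟩
    · rcases h' with ⟨h1', h2', h3', h4'⟩ | ⟨rfl, h1', h2', h3', h4', h5'⟩
      · have hc := h2.symm.trans h2'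
        obtain ⟨e, e'⟩ := h4.source_unique h4' hx hx' hc
        exact I.ext hc (hs.trans hs'.symm) e e'
      · exact absurd h4.bounds.2 (by omega)
    · rcases h' with ⟨h1', h2', h3', h4'⟩ | ⟨-, h1', h2', h3', h4', h5'⟩
      · exact absurd h4'.bounds.2 (by omega)
      · have hc := I.rank_injective h5.symm.joined h5'.symm.joined (h4.symm.trans h4')
        obtain ⟨e, e'⟩ := h3.unique h3' hx hx' hc
        exact I.ext hc (hs.trans hs'.symm) e e'
  -- Equality constraints lead from side 0 to side 1. In slot 6 a copy serves a single color, so the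
  -- order of the two colors decides whether it is source or target.
  source_ne_target := by
    rintro x o p y q p' y' q' ⟨hx, hy, hp, hq, hs, h⟩ ⟨-, hy', hp', hq', hs', h'⟩
    rcases h with ⟨h1, h2, h3, h4⟩ | ⟨rfl, h1, h2, h3, h4, h5⟩
    · omega
    · rcases h' with ⟨h1', h2', h3', h4'⟩ | ⟨-, h1', h2', h3', h4', h5'⟩
      · exact absurd h4'.bounds.2 (by omega)
      · have hc := I.rank_injective h5.symm.joined h5'.joined (h4.symm.trans h3')
        omega
  -- Different edge types may join the same two copies, but all of them impose the same relation,
  -- equality.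
  parallel := by
    rintro x o p y q o' p' q' ⟨hx, hy, hp, hq, hs, h⟩ ⟨-, -, hp', hq', -, h'⟩
    refine ⟨hx, hy, hp', hq', hs, ?_⟩
    rcases h with ⟨h1, h2, h3, h4⟩ | ⟨rfl, h1, h2, h3, h4, h5⟩
    · rcases h' with ⟨h1', h2', h3', h4'⟩ | ⟨rfl, h1', h2', h3', h4', h5'⟩
      · exact .inl ⟨h1, h2, h3', h4⟩
      · omega
    · rcases h' with ⟨h1', h2', h3', h4'⟩ | ⟨-, h1', h2', h3', h4', h5'⟩
      · omega
      · exact .inr ⟨rfl, h1, h2, h3, h4, h5'⟩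
  antiparallel := by
    rintro x o p y q o' p' q' ⟨hx, hy, hp, hq, hs, h⟩ ⟨-, -, hp', hq', hs', h'⟩
    rcases h with ⟨h1, h2, h3, h4⟩ | ⟨rfl, h1, h2, h3, h4, h5⟩ <;>
      rcases h' with ⟨h1', h2', h3', h4'⟩ | ⟨rfl, h1', h2', h3', h4', h5'⟩ <;> omega

end ColoredInstance

/-! ### Counting violated constraints -/

namespace Network

open Classical in
/-- The constraints violated by an assignment. -/
noncomputable def unsat (W : Network) (val : ℕ → ℕ) : Finset (ℕ × ℕ) :=
  W.live.filter fun z => ∃ p y q, W.Rel z.1 z.2 p y q ∧ ¬ W.Rel z.1 z.2 (val z.1) y (val y)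

theorem rel_of_notMem_unsat {W : Network} {val : ℕ → ℕ} {x o p y q : ℕ} (h : W.Rel x o p y q)
    (hz : (x, o) ∉ W.unsat val) : W.Rel x o (val x) y (val y) := by
  classical
  by_contra hn
  exact hz (Finset.mem_filter.2 ⟨W.mem_live.2 (.inr ⟨p, y, q, h⟩), p, y, q, h, hn⟩)

theorem exists_card_unsat_le (W : Network) :
    ∃ val, (W.unsat val).card + 32 * W.toNDP.opt ≤ 32 * W.live.card := by
  classical
  obtain ⟨Bad, val, hcard, hval⟩ := W.exists_values
  refine ⟨val, ?_⟩
  let source : ℕ → ℕ → ℕ := fun y o =>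
    if h : ∃ x p q, W.Rel x o p y q then h.choose else 0
  have hsource : ∀ {x o p y q}, W.Rel x o p y q → source y o = x := by
    intro x o p y q h
    have hex : ∃ x p q, W.Rel x o p y q := ⟨x, p, q, h⟩
    obtain ⟨p', q', h'⟩ := hex.choose_spec
    simp only [source, dif_pos hex]
    exact W.source_unique _ _ _ _ _ _ _ _ h' h
  -- A violated constraint has a bad special vertex at its source or at its target. That vertex, the
  -- slot and the choice of the end determine the constraint: 16 per bad vertex, and there are at
  -- most 2 (L − OPT) bad ones.
  have hsub : W.unsat val ⊆ (Bad ×ˢ Finset.range 8 ×ˢ (Finset.univ : Finset Bool)).image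
      fun a => (if a.2.2 then a.1.1 else source a.1.1 a.2.1, a.2.1) := by
    rintro ⟨x, o⟩ hz
    obtain ⟨-, p, y, q, h, hn⟩ := Finset.mem_filter.1 hz
    have ho : o < 8 := (W.bounds _ _ _ _ _ h).2.1.trans_lt (by omega)
    have key : ∃ z ∈ Bad, z.1 = x ∨ z.1 = y := by
      by_contra! hb
      exact hn (hval _ _ _ _ _ h (fun h => (hb _ h).1 rfl) (fun h => (hb _ h).1 rfl)
        (fun h => (hb _ h).1 rfl) (fun h => (hb _ h).2 rfl) fun h => (hb _ h).2 rfl)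
    obtain ⟨z, hzB, rfl | rfl⟩ := key
    · exact Finset.mem_image.2 ⟨(z, o, true), by simp [hzB, ho], by simp⟩
    · exact Finset.mem_image.2 ⟨(z, o, false), by simp [hzB, ho], by simp [hsource h]⟩
  have h1 := (Finset.card_le_card hsub).trans Finset.card_image_le
  rw [Finset.card_product, Finset.card_product, Finset.card_range, Finset.card_univ,
    Fintype.card_bool] at h1
  omega

end Network

/-! ### Comparing the two optima -/

namespace ColoredInstance

variable (I : ColoredInstance)

open Classical in
/-- The pairs of joined colors. -/
noncomputable def pairs : Finset (ℕ × ℕ) :=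
  (Finset.range I.k ×ˢ Finset.range I.k).filter fun e => e.1 < e.2 ∧ I.Joined e.1 e.2

theorem mem_pairs {e : ℕ × ℕ} : e ∈ I.pairs ↔ e.1 < e.2 ∧ I.Joined e.1 e.2 := by
  simp only [pairs, Finset.mem_filter, Finset.mem_product, Finset.mem_range, and_iff_right_iff_imp]
  exact fun h => h.2.lt

theorem sum_deg : ∑ i ∈ Finset.range I.k, I.deg i = 2 * I.pairs.card := by
  classical
  have h1 : ∑ i ∈ Finset.range I.k, I.deg i = (I.pairs ∪ I.pairs.image Prod.swap).card := by
    simp only [deg]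
    rw [← Finset.card_sigma]
    refine Finset.card_bij (fun a _ => (a.1, a.2)) ?_ ?_ ?_
    · rintro ⟨i, j⟩ h
      simp only [Finset.mem_sigma, Finset.mem_filter, Finset.mem_range] at h
      rw [Finset.mem_union, Finset.mem_image]
      rcases h.2.2.ne.lt_or_gt with hlt | hlt
      · exact .inl (I.mem_pairs.2 ⟨hlt, h.2.2⟩)
      · exact .inr ⟨(j, i), I.mem_pairs.2 ⟨hlt, h.2.2.symm⟩, rfl⟩
    · rintro ⟨i, j⟩ - ⟨i', j'⟩ - h
      cases h
      rfl
    · rintro ⟨i, j⟩ h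
      have hj : I.Joined i j := by
        rcases Finset.mem_union.1 h with h | h
        · exact (I.mem_pairs.1 h).2
        · obtain ⟨⟨a, b⟩, hab, e⟩ := Finset.mem_image.1 h
          cases e
          exact (I.mem_pairs.1 hab).2.symm
      exact ⟨⟨i, j⟩, by simpa [hj.lt] using hj, rfl⟩
  rw [h1, Finset.card_union_of_disjoint, Finset.card_image_of_injective _ Prod.swap_injective,
    two_mul]
  rw [Finset.disjoint_left]
  rintro e h h'
  obtain ⟨e', he, rfl⟩ := Finset.mem_image.1 h'
  exact lt_asymm (I.mem_pairs.1 h).1 (I.mem_pairs.1 he).1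

theorem colorDegree_eq (i : Fin I.k) : I.colorDegree i = I.deg i := by
  classical
  have : Fin.val '' {j : Fin I.k | ∃ p q, I.G.Adj (i, p) (j, q)} =
      ((Finset.range I.k).filter fun j => I.Joined i j : Finset ℕ) := by
    ext j
    simp only [Set.mem_image, Set.mem_ofPred_eq, Finset.coe_filter, Finset.mem_range]
    constructor
    · rintro ⟨j, ⟨p, q, h⟩, rfl⟩
      exact ⟨j.2, p, p.2, q, q.2, i.2, p.2, j.2, q.2, h⟩
    · rintro ⟨hj, p, _, q, _, _, hp, _, hq, h⟩
      exact ⟨⟨j, hj⟩, ⟨⟨p, hp⟩, ⟨q, hq⟩, h⟩, rfl⟩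
  rw [colorDegree, ← Set.ncard_image_of_injective _ Fin.val_injective, this,
    Set.ncard_coe_finset, deg]

theorem sigma_eq : I.sigma = I.pairs.card := by
  have h1 : ∑ i : Fin I.k, (I.colorDegree i : ℝ) = 2 * I.pairs.card := by
    simp only [colorDegree_eq]
    rw [Fin.sum_univ_eq_sum_range fun i => (I.deg i : ℝ)]
    exact_mod_cast I.sum_deg
  rw [sigma, ← Finset.sum_div, h1]
  ring

-- An induced edge is counted by its two colors in increasing order; `H` is any extension of `h` to
-- all natural numbers.
open Classical in
theorem value_eq (h : Fin I.k → Fin I.n) (H : ℕ → ℕ) (hH : ∀ i : Fin I.k, H i = h i) :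
    I.value h = (I.pairs.filter fun e => I.Edge e.1 (H e.1) e.2 (H e.2)).card := by
  have hinj : Function.Injective fun v : Set.range fun i => (i, h i) => v.1.1.val := by
    rintro ⟨-, i, rfl⟩ ⟨-, j, rfl⟩ e
    obtain rfl : i = j := Fin.ext e
    rfl
  have hinj' : Set.InjOn (fun e : ℕ × ℕ => s(e.1, e.2))
      (I.pairs.filter fun e => I.Edge e.1 (H e.1) e.2 (H e.2) : Finset (ℕ × ℕ)) := by
    rintro ⟨i, j⟩ h1 ⟨i', j'⟩ h2 e
    have h1 := (I.mem_pairs.1 (Finset.mem_filter.1 h1).1).1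
    have h2 := (I.mem_pairs.1 (Finset.mem_filter.1 h2).1).1
    rcases Sym2.eq_iff.1 e with ⟨rfl, rfl⟩ | ⟨rfl, rfl⟩
    · rfl
    · exact absurd h1 (lt_asymm h2)
  rw [value, ← Set.ncard_image_of_injective _ (Sym2.map.injective hinj), ← Set.ncard_coe_finset,
    ← hinj'.ncard_image]
  congr 1
  ext e
  simp only [Set.mem_image, Finset.mem_coe, Finset.mem_filter, mem_pairs]
  constructor
  · rintro ⟨e, he, rfl⟩
    induction e with
    | _ u v =>
      obtain ⟨-, i, rfl⟩ := u
      obtain ⟨-, j, rfl⟩ := v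
      have he : I.G.Adj (i, h i) (j, h j) := he
      have hE : I.Edge i (H i) j (H j) :=
        ⟨i.2, hH i ▸ (h i).2, j.2, hH j ▸ (h j).2, by simpa only [hH] using he⟩
      rcases hE.ne.lt_or_gt with hlt | hlt
      · exact ⟨(i, j), ⟨⟨hlt, hE.joined⟩, hE⟩, rfl⟩
      · exact ⟨(j, i), ⟨⟨hlt, hE.symm.joined⟩, hE.symm⟩, Sym2.eq_swap⟩
  · rintro ⟨⟨i, j⟩, ⟨-, hE⟩, rfl⟩
    obtain ⟨hi, hp, hj, hq, hadj⟩ := hE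
    refine ⟨s(⟨_, ⟨i, hi⟩, rfl⟩, ⟨_, ⟨j, hj⟩, rfl⟩), ?_, rfl⟩
    have e1 := hH ⟨i, hi⟩
    have e2 := hH ⟨j, hj⟩
    refine (show I.G.Adj (⟨i, hi⟩, h ⟨i, hi⟩) (⟨j, hj⟩, h ⟨j, hj⟩) from ?_)
    simpa only [e1, e2] using hadj

/-- 8 special vertices per copy, 2 sides, at most 2 deg i copies per side, and the degrees add up to
twice the number of pairs: 8 · 2 · 2 · 2 = 64. -/
theorem card_live_le : I.network.live.card ≤ 64 * I.pairs.card := by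
  classical
  let S := (Finset.range (I.k * 2 * I.k * I.k)).filter I.Active
  have h1 : I.network.live ⊆ S ×ˢ Finset.range 8 := by
    intro z hz
    have h := (Finset.mem_filter.1 hz).1
    have hact : I.Active z.1 := by
      rcases I.network.mem_live.1 hz with ⟨h, -⟩ | ⟨p, y, q, h⟩
      · exact h
      · exact h.1
    exact Finset.mem_product.2 ⟨Finset.mem_filter.2 ⟨(Finset.mem_product.1 h).1, hact⟩,
      (Finset.mem_product.1 h).2⟩
  have h2 : S.card ≤ ∑ i ∈ Finset.range I.k, 4 * I.deg i := by
    rw [Finset.card_eq_sum_card_fiberwise (f := I.col) (t := Finset.range I.k)]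
    · refine Finset.sum_le_sum fun i _ => ?_
      have : S.filter (fun x => I.col x = i) ⊆
          (Finset.range 2 ×ˢ Finset.range (I.width i) ×ˢ Finset.range (I.width i)).image
            fun a => I.code i a.1 a.2.1 a.2.2 := by
        intro x hx
        obtain ⟨hxS, rfl⟩ := Finset.mem_filter.1 hx
        obtain ⟨-, -, hf, hs⟩ := Finset.mem_filter.1 hxS
        refine Finset.mem_image.2 ⟨(I.side x, I.fst x, I.snd x), ?_, I.code_eta x⟩
        simp only [Finset.mem_product, Finset.mem_range]
        exact ⟨Nat.mod_lt _ (by omega), hf, hs⟩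
      have := (Finset.card_le_card this).trans Finset.card_image_le
      simp only [Finset.card_product, Finset.card_range] at this
      have := I.width_sq_le i
      omega
    · intro x hx
      exact Finset.mem_coe.2 (Finset.mem_range.2 (I.col_lt (Finset.mem_filter.1 hx).2.1))
  rw [← Finset.mul_sum, sum_deg] at h2
  have h3 := Finset.card_le_card h1
  rw [Finset.card_product, Finset.card_range] at h3
  omega

/-- An optimal choice realises every joined pair; giving all copies of a color the vertex chosen for
it satisfies every constraint. -/
theorem card_live_le_opt_of_opt_eq (h : I.opt = I.pairs.card) :
    I.network.live.card ≤ I.network.toNDP.opt := by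
  classical
  have : Nonempty (Fin I.n) := ⟨⟨0, I.n_pos⟩⟩
  obtain ⟨f, -, hf⟩ := Finset.exists_mem_eq_sup (Finset.univ : Finset (Fin I.k → Fin I.n))
    Finset.univ_nonempty I.value
  let H : ℕ → ℕ := fun i => if hi : i < I.k then f ⟨i, hi⟩ else 0
  have hH : ∀ i : Fin I.k, H i = f i := fun i => by simp [H]
  have hlt : ∀ i, H i < I.n := by
    intro i
    simp only [H]
    split_ifs
    exacts [(f _).2, I.n_pos]
  have hval : I.value f = I.pairs.card := hf.symm.trans h
  rw [I.value_eq f H hH, Finset.card_filter_eq_iff] at hval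
  refine I.network.card_live_le_opt (fun x => H (I.col x)) (fun x _ => hlt _) ?_
  rintro x o p y q ⟨hx, hy, hp, hq, hs, hc⟩
  refine ⟨hx, hy, hlt _, hlt _, hs, ?_⟩
  rcases hc with ⟨h1, h2, h3, h4⟩ | ⟨ho, h1, h2, h3, h4, h5⟩
  · exact .inl ⟨h1, h2, by rw [h2], h4⟩
  · exact .inr ⟨ho, h1, h2, h3, h4, hval (I.col x, I.col y) (I.mem_pairs.2 ⟨h2, h5.joined⟩)⟩

/-- The copy of color `i` that is responsible for the edges to color `j`. -/
noncomputable def server (i j : ℕ) : ℕ :=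
  I.code i 0 (I.rank i j / I.width i) (I.rank i j % I.width i)

variable {I}

theorem active_code {i s a b : ℕ} (hi : i < I.k) (hs : s < 2) (ha : a < I.width i)
    (hb : b < I.width i) : I.Active (I.code i s a b) := by
  have ha' := ha.trans_le (I.width_le i)
  have hb' := hb.trans_le (I.width_le i)
  refine ⟨I.code_lt hi hs ha' hb', ?_, ?_⟩
  · rwa [I.fst_code ha' hb', I.col_code hs ha' hb']
  · rwa [I.snd_code hb', I.col_code hs ha' hb']

theorem server_spec {i j : ℕ} (h : I.Joined i j) :
    I.Active (I.server i j) ∧ I.col (I.server i j) = i ∧ I.side (I.server i j) = 0 ∧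
      I.Serves (I.server i j) j := by
  have h1 := (I.rank_lt_deg h).trans_le (I.deg_le_width_sq i)
  have hw : 0 < I.width i := by
    by_contra hw
    rw [Nat.eq_zero_of_not_pos hw] at h1
    omega
  have ha : I.rank i j / I.width i < I.width i := Nat.div_lt_of_lt_mul h1
  have hb : I.rank i j % I.width i < I.width i := Nat.mod_lt _ hw
  have ha' := ha.trans_le (I.width_le i)
  have hb' := hb.trans_le (I.width_le i)
  refine ⟨active_code h.lt.1 (by omega) ha hb, I.col_code (by omega) ha' hb',
    I.side_code (by omega) ha' hb', ?_⟩
  rw [Serves, server, I.col_code (by omega) ha' hb', I.fst_code ha' hb', I.snd_code hb',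
    Nat.div_add_mod']

theorem server_injective {i j i' j' : ℕ} (h : I.Joined i j) (h' : I.Joined i' j')
    (he : I.server i j = I.server i' j') : i = i' ∧ j = j' := by
  obtain ⟨-, h1, -, h2⟩ := server_spec h
  obtain ⟨-, h1', -, h2'⟩ := server_spec h'
  rw [he] at h1 h2
  obtain rfl : i = i' := h1.symm.trans h1'
  unfold Serves at h2 h2'
  rw [h1] at h2 h2'
  exact ⟨rfl, I.rank_injective h h' (h2.symm.trans h2')⟩

-- An expander edge from v to π v is simulated through side 1: by its own slot from v to the second
-- copy of π v, and back by slot 1 to the first copy. A broken edge thus costs one of two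
-- constraints, which gives 64 · 4 · 2 = 512.
open Classical in
theorem exists_color_label (val : ℕ → ℕ) (i : ℕ) (hi : i < I.k) : ∃ l,
    ((Finset.range (I.k * 2 * I.k * I.k)).filter fun x =>
      I.Active x ∧ I.side x = 0 ∧ I.col x = i ∧ val x ≠ l).card ≤
      512 * ((I.network.unsat val).filter fun z => I.col z.1 = i).card := by
  -- A color of degree 0 has no copies; it is set apart because `ZMod 0` is not a finite torus.
  rcases Nat.eq_zero_or_pos (I.width i) with hw | hw
  · refine ⟨0, ?_⟩
    rw [Finset.filter_false_of_mem, Finset.card_empty]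
    · exact Nat.zero_le _
    · rintro x - ⟨h, -, rfl, -⟩
      have := h.2.1
      omega
  have : NeZero (I.width i) := ⟨hw.ne'⟩
  let c : ℕ → ZMod (I.width i) × ZMod (I.width i) → ℕ := fun s v => I.code i s v.1.val v.2.val
  have hlt : ∀ a : ZMod (I.width i), a.val < I.width i := ZMod.val_lt
  have hltk : ∀ a : ZMod (I.width i), a.val < I.k := fun a => (hlt a).trans_le (I.width_le i)
  have hcol : ∀ s v, s < 2 → I.col (c s v) = i := fun s v hs => I.col_code hs (hltk _) (hltk _)
  have hfst : ∀ s v, I.fst (c s v) = v.1.val := fun s v => I.fst_code (hltk _) (hltk _)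
  have hsnd : ∀ s v, I.snd (c s v) = v.2.val := fun s v => I.snd_code (hltk _)
  have hcinj : Function.Injective (c 0) := by
    intro v v' h
    exact Prod.ext (ZMod.val_injective _ (by rw [← hfst 0 v, h, hfst]))
      (ZMod.val_injective _ (by rw [← hsnd 0 v, h, hsnd]))
  set U := I.network.unsat val with hU
  set Ui := U.filter fun z => I.col z.1 = i with hUi
  have hstep : ∀ o v v', I.Step o (c 0 v) (c 1 v') → (c 0 v, o) ∉ U →
      val (c 0 v) = val (c 1 v') := by
    intro o v v' h hn
    have hrel : I.network.Rel (c 0 v) o 0 (c 1 v') 0 :=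
      ⟨active_code hi (by omega) (hlt _) (hlt _), active_code hi (by omega) (hlt _) (hlt _),
        I.n_pos, I.n_pos, I.side_code (by omega) (hltk _) (hltk _),
        .inl ⟨I.side_code (by omega) (hltk _) (hltk _),
          by rw [hcol _ _ (by omega), hcol _ _ (by omega)], rfl, h⟩⟩
    obtain ⟨-, -, -, -, -, h' | h'⟩ := Network.rel_of_notMem_unsat hrel hn
    · exact h'.2.2.1
    · have h1 : I.side (c 1 v') = 0 := h'.2.1
      have h2 : I.side (c 1 v') = 1 := I.side_code (by omega) (hltk _) (hltk _)
      omega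
  have hslot : ∀ o, (Finset.univ.filter fun v => (c 0 v, o) ∈ U).card ≤ Ui.card := by
    intro o
    refine Finset.card_le_card_of_injOn (fun v => (c 0 v, o)) ?_ ?_
    · intro v hv
      exact Finset.mem_filter.2 ⟨(Finset.mem_filter.1 hv).2, hcol 0 v (by omega)⟩
    · intro v _ v' _ h
      exact hcinj (Prod.ext_iff.1 h).1
  have hmove : ∀ (o : ℕ) (π : ZMod (I.width i) × ZMod (I.width i) ≃ _),
      (∀ v, I.Step o (c 0 v) (c 1 (π v))) →
      (Finset.univ.filter fun v => val (c 0 (π v)) ≠ val (c 0 v)).card ≤ 2 * Ui.card := by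
    intro o π hπ
    have hsub : (Finset.univ.filter fun v => val (c 0 (π v)) ≠ val (c 0 v)) ⊆
        (Finset.univ.filter fun v => (c 0 v, o) ∈ U) ∪
          (Finset.univ.filter fun v => (c 0 v, 1) ∈ U).map π.symm.toEmbedding := by
      intro v hv
      rw [Finset.mem_union, Finset.mem_map_equiv, Equiv.symm_symm, Finset.mem_filter,
        Finset.mem_filter]
      by_contra! hn
      refine (Finset.mem_filter.1 hv).2 ?_
      rw [hstep o v (π v) (hπ v) (hn.1 (Finset.mem_univ _))]
      exact hstep 1 (π v) (π v) (.inl ⟨rfl, by rw [hfst, hfst], by rw [hsnd, hsnd]⟩)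
        (hn.2 (Finset.mem_univ _))
    have h1 := (Finset.card_le_card hsub).trans (Finset.card_union_le _ _)
    rw [Finset.card_map] at h1
    have h2 := hslot o
    have h3 := hslot 1
    omega
  have hone : ∀ a : ZMod (I.width i), (a + 1).val = (a.val + 1) % I.width i := fun a => by
    rw [ZMod.val_add, ZMod.val_one_eq_one_mod, Nat.add_mod_mod]
  obtain ⟨l, hl⟩ := Torus.exists_label fun v => val (c 0 v)
  refine ⟨l, ?_⟩
  have m1 := hmove 2 Torus.moveFst fun v => by
    refine .inr (.inl ⟨rfl, ?_, ?_⟩)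
    · rw [hfst, hfst, hcol _ _ (by omega)]
      exact hone _
    · rw [hsnd, hsnd]
      rfl
  have m2 := hmove 3 Torus.moveSnd fun v => by
    refine .inr (.inr (.inl ⟨rfl, ?_, ?_⟩))
    · rw [hfst, hfst]
      rfl
    · rw [hsnd, hsnd, hcol _ _ (by omega)]
      exact hone _
  have m3 := hmove 4 Torus.shearFst fun v => by
    refine .inr (.inr (.inr (.inl ⟨rfl, ?_, ?_⟩)))
    · rw [hfst, hfst, hsnd, hcol _ _ (by omega)]
      exact ZMod.val_add _ _
    · rw [hsnd, hsnd]
      rfl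
  have m4 := hmove 5 Torus.shearSnd fun v => by
    refine .inr (.inr (.inr (.inr ⟨rfl, ?_, ?_⟩)))
    · rw [hfst, hfst]
      rfl
    · rw [hsnd, hfst, hsnd, hcol _ _ (by omega)]
      exact ZMod.val_add _ _
  have hle : ((Finset.range (I.k * 2 * I.k * I.k)).filter fun x =>
      I.Active x ∧ I.side x = 0 ∧ I.col x = i ∧ val x ≠ l).card ≤
      (Finset.univ.filter fun v => val (c 0 v) ≠ l).card := by
    rw [← Finset.card_image_of_injective _ hcinj]
    refine Finset.card_le_card fun x hx => ?_
    obtain ⟨-, ⟨-, hf, hs⟩, h1, rfl, h2⟩ := Finset.mem_filter.1 hx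
    have e : c 0 ((I.fst x : ZMod _), (I.snd x : ZMod _)) = x := by
      simp only [c]
      rw [ZMod.val_natCast_of_lt hf, ZMod.val_natCast_of_lt hs, ← h1, I.code_eta]
    refine Finset.mem_image.2 ⟨_, Finset.mem_filter.2 ⟨Finset.mem_univ _, ?_⟩, e⟩
    rwa [e]
  omega

/-- If the labels of two joined colors are not adjacent, then the slot 6 constraint of the pair is
violated or one of its two servers deviates from its label. Servers of different ordered pairs are
different, so at most 1 + 2 · 512 = 1025 pairs are lost per violated constraint, and 1025 · 32 =
32800. -/
theorem card_pairs_add_le : I.pairs.card + 32800 * I.network.toNDP.opt ≤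
    I.opt + 32800 * I.network.live.card := by
  classical
  obtain ⟨val, hval⟩ := I.network.exists_card_unsat_le
  set U := I.network.unsat val with hU
  choose! l hl using fun i hi => exists_color_label (I := I) val i hi
  let B := (Finset.range (I.k * 2 * I.k * I.k)).filter fun x =>
      I.Active x ∧ I.side x = 0 ∧ val x ≠ l (I.col x)
  have hB : B.card ≤ 512 * U.card := by
    rw [Finset.card_eq_sum_card_fiberwise (f := I.col) (t := Finset.range I.k),
      Finset.card_eq_sum_card_fiberwise (s := U) (f := fun z => I.col z.1)
        (t := Finset.range I.k), Finset.mul_sum]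
    · refine Finset.sum_le_sum fun i hi => le_trans (Finset.card_le_card fun x hx => ?_)
        (hl i (Finset.mem_range.1 hi))
      obtain ⟨hxB, rfl⟩ := Finset.mem_filter.1 hx
      obtain ⟨h1, h2, h3, h4⟩ := Finset.mem_filter.1 hxB
      exact Finset.mem_filter.2 ⟨h1, h2, h3, rfl, h4⟩
    · intro z hz
      obtain ⟨-, p, y, q, h, -⟩ := Finset.mem_filter.1 hz
      exact Finset.mem_coe.2 (Finset.mem_range.2 (I.col_lt h.1.1))
    · intro x hx
      exact Finset.mem_coe.2 (Finset.mem_range.2 (I.col_lt (Finset.mem_filter.1 hx).2.1.1))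
  -- A label need not be a vertex number; in that case vertex 0 is chosen.
  let H : ℕ → ℕ := fun i => if l i < I.n then l i else 0
  have hH : ∀ i, H i < I.n := fun i => by
    simp only [H]
    split_ifs with h
    exacts [h, I.n_pos]
  have hopt : I.value (fun i => ⟨H i, hH i⟩) ≤ I.opt := Finset.le_sup (Finset.mem_univ _)
  rw [I.value_eq _ H fun _ => rfl] at hopt
  let Q := I.pairs.filter fun e => ¬ I.Edge e.1 (H e.1) e.2 (H e.2)
  have hQ : (I.pairs.filter fun e => I.Edge e.1 (H e.1) e.2 (H e.2)).card + Q.card =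
    I.pairs.card := Finset.card_filter_add_card_filter_not _
  let Q1 := I.pairs.filter fun e => (I.server e.1 e.2, 6) ∈ U
  let Q2 := I.pairs.filter fun e => I.server e.1 e.2 ∈ B
  let Q3 := I.pairs.filter fun e => I.server e.2 e.1 ∈ B
  have h1 : Q1.card ≤ U.card := by
    refine Finset.card_le_card_of_injOn (fun e => (I.server e.1 e.2, 6))
      (fun e he => (Finset.mem_filter.1 he).2) fun e he e' he' h => ?_
    have := server_injective (I.mem_pairs.1 (Finset.mem_filter.1 he).1).2
      (I.mem_pairs.1 (Finset.mem_filter.1 he').1).2 (Prod.ext_iff.1 h).1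
    exact Prod.ext this.1 this.2
  have h2 : Q2.card ≤ B.card := by
    refine Finset.card_le_card_of_injOn (fun e => I.server e.1 e.2)
      (fun e he => (Finset.mem_filter.1 he).2) fun e he e' he' h => ?_
    have := server_injective (I.mem_pairs.1 (Finset.mem_filter.1 he).1).2
      (I.mem_pairs.1 (Finset.mem_filter.1 he').1).2 h
    exact Prod.ext this.1 this.2
  have h3 : Q3.card ≤ B.card := by
    refine Finset.card_le_card_of_injOn (fun e => I.server e.2 e.1)
      (fun e he => (Finset.mem_filter.1 he).2) fun e he e' he' h => ?_
    have := server_injective (I.mem_pairs.1 (Finset.mem_filter.1 he).1).2.symm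
      (I.mem_pairs.1 (Finset.mem_filter.1 he').1).2.symm h
    exact Prod.ext this.2 this.1
  have hsub : Q ⊆ Q1 ∪ (Q2 ∪ Q3) := by
    rintro ⟨i, j⟩ he
    obtain ⟨hp, hn⟩ := Finset.mem_filter.1 he
    by_contra hno
    simp only [Q1, Q2, Q3, Finset.mem_union, Finset.mem_filter, hp, true_and, not_or] at hno
    obtain ⟨no1, no2, no3⟩ := hno
    obtain ⟨hlt, hj⟩ := I.mem_pairs.1 hp
    obtain ⟨a1, a2, a3, a4⟩ := server_spec hj
    obtain ⟨b1, b2, b3, b4⟩ := server_spec hj.symm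
    simp only at hlt hj a1 a2 a3 a4 b1 b2 b3 b4 hn
    have v1 : val (I.server i j) = l i := by
      by_contra hv
      exact no2 (Finset.mem_filter.2 ⟨Finset.mem_range.2 a1.1, a1, a3, by rwa [a2]⟩)
    have v2 : val (I.server j i) = l j := by
      by_contra hv
      exact no3 (Finset.mem_filter.2 ⟨Finset.mem_range.2 b1.1, b1, b3, by rwa [b2]⟩)
    obtain ⟨p, hp, q, hq, hE⟩ := hj
    have hrel : I.network.Rel (I.server i j) 6 p (I.server j i) q :=
      ⟨a1, b1, hp, hq, a3, .inr ⟨rfl, b3, by rwa [a2, b2], by rwa [b2], by rwa [a2],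
        by rwa [a2, b2]⟩⟩
    obtain ⟨-, -, c1, c2, -, c3 | c3⟩ := Network.rel_of_notMem_unsat hrel no1
    · have := c3.2.1
      omega
    · have hE' := c3.2.2.2.2.2
      rw [a2, b2, v1, v2] at hE'
      refine hn ?_
      simp only [H]
      rwa [if_pos hE'.2.1, if_pos hE'.2.2.2.1]
  have h4 := (Finset.card_le_card hsub).trans ((Finset.card_union_le _ _).trans
    (Nat.add_le_add_left (Finset.card_union_le _ _) _))
  omega

end ColoredInstance

/-! ### The network is constructed in polynomial time -/

namespace RAM

variable {i p j q o x y l r l' r' u v : ColoredInstance → (ℕ → ℕ) → ℕ}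

theorem PolyDec.joined (hi : PolyTime i) (hj : PolyTime j) :
    PolyDec fun I ρ => I.Joined (i I ρ) (j I ρ) :=
  ex (P := fun I ρ p => ∃ q, q < I.n ∧ I.Edge (i I ρ) p (j I ρ) q) .n
    (ex (P := fun I ρ q => I.Edge (i I fun m => ρ (m + 1)) (ρ 0) (j I fun m => ρ (m + 1)) q) .n
      (edge hi.shift.shift (.var 1) hj.shift.shift (.var 0)))

namespace PolyTime

theorem deg (hi : PolyTime i) : PolyTime fun I ρ => I.deg (i I ρ) :=
  count (P := fun I ρ j => I.Joined (i I ρ) j) .k (.joined hi.shift (.var 0))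

theorem rank (hi : PolyTime i) (hj : PolyTime j) : PolyTime fun I ρ => I.rank (i I ρ) (j I ρ) :=
  count (P := fun I ρ j' => I.Joined (i I ρ) j') hj (.joined hi.shift (.var 0))

theorem width (hi : PolyTime i) : PolyTime fun I ρ => I.width (i I ρ) :=
  (count (P := fun I ρ z => z * z < I.deg (i I ρ)) hi.deg
    (.lt ((var 0).mul (.var 0)) hi.shift.deg)).congr fun I ρ => by
      unfold ColoredInstance.width
      congr

theorem col (hx : PolyTime x) : PolyTime fun I ρ => I.col (x I ρ) :=
  ((hx.div .k).div .k).div (.const 2)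

theorem side (hx : PolyTime x) : PolyTime fun I ρ => I.side (x I ρ) :=
  ((hx.div .k).div .k).mod (.const 2)

theorem fst (hx : PolyTime x) : PolyTime fun I ρ => I.fst (x I ρ) := (hx.div .k).mod .k

theorem snd (hx : PolyTime x) : PolyTime fun I ρ => I.snd (x I ρ) := hx.mod .k

theorem numVars : PolyTime fun I _ => I.network.V := ((mul .k (.const 2)).mul .k).mul .k

theorem networkSize : PolyTime fun I _ => I.network.size :=
  (((const 2).mul numVars).mul ((const 8).mul .n)).add ((const 8).mul numVars)

end PolyTime

namespace PolyDec

theorem active (hx : PolyTime x) : PolyDec fun I ρ => I.network.Active (x I ρ) :=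
  (lt hx .numVars).and ((lt hx.fst hx.col.width).and (lt hx.snd hx.col.width))

theorem step (ho : PolyTime o) (hx : PolyTime x) (hy : PolyTime y) :
    PolyDec fun I ρ => I.Step (o I ρ) (x I ρ) (y I ρ) :=
  have h1 := hx.col.width
  have h2 := eq hy.fst hx.fst
  have h3 := eq hy.snd hx.snd
  have h4 := hx.fst.add hx.snd
  ((eq ho (.const 1)).and (h2.and h3)).or <|
  ((eq ho (.const 2)).and ((eq hy.fst ((hx.fst.add (.const 1)).mod h1)).and h3)).or <|
  ((eq ho (.const 3)).and (h2.and (eq hy.snd ((hx.snd.add (.const 1)).mod h1)))).or <|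
  ((eq ho (.const 4)).and ((eq hy.fst (h4.mod h1)).and h3)).or
  ((eq ho (.const 5)).and (h2.and (eq hy.snd (h4.mod h1))))

theorem serves (hx : PolyTime x) (hj : PolyTime j) :
    PolyDec fun I ρ => I.Serves (x I ρ) (j I ρ) :=
  eq ((hx.fst.mul hx.col.width).add hx.snd) (hx.col.rank hj)

theorem rel (hx : PolyTime x) (ho : PolyTime o) (hp : PolyTime p) (hy : PolyTime y)
    (hq : PolyTime q) :
    PolyDec fun I ρ => I.network.Rel (x I ρ) (o I ρ) (p I ρ) (y I ρ) (q I ρ) :=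
  (active hx).and <| (active hy).and <| (lt hp .n).and <| (lt hq .n).and <|
  (eq hx.side (.const 0)).and <|
  ((eq hy.side (.const 1)).and <| (eq hy.col hx.col).and <| (eq hp hq).and <| step ho hx hy).or <|
  (eq ho (.const 6)).and <| (eq hy.side (.const 0)).and <| (lt hx.col hy.col).and <|
  (serves hx hy.col).and <| (serves hy hx.col).and <| edge hx.col hp hy.col hq

/-- Quantification over the constraints in a slot. -/
theorem exRel {P : ColoredInstance → (ℕ → ℕ) → ℕ → ℕ → ℕ → Prop} (hx : PolyTime x)
    (ho : PolyTime o)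
    (hP : PolyDec fun I ρ => P I (fun m => ρ (m + 3)) (ρ 2) (ρ 1) (ρ 0)) :
    PolyDec fun I ρ => ∃ p y q, I.network.Rel (x I ρ) (o I ρ) p y q ∧ P I ρ p y q := by
  -- The constraint itself bounds p, y and q, so the three quantifiers may be bounded.
  refine (ex (P := fun I ρ p => ∃ y, y < I.network.V ∧ ∃ q, q < I.n ∧
    (I.network.Rel (x I ρ) (o I ρ) p y q ∧ P I ρ p y q)) .n
    (ex (P := fun I ρ y => ∃ q, q < I.n ∧
      (I.network.Rel (x I fun m => ρ (m + 1)) (o I fun m => ρ (m + 1)) (ρ 0) y q ∧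
        P I (fun m => ρ (m + 1)) (ρ 0) y q)) .numVars
    (ex (P := fun I ρ q => I.network.Rel (x I fun m => ρ (m + 2)) (o I fun m => ρ (m + 2)) (ρ 1)
      (ρ 0) q ∧ P I (fun m => ρ (m + 2)) (ρ 1) (ρ 0) q) .n
    ((rel hx.shift.shift.shift ho.shift.shift.shift (.var 2) (.var 1) (.var 0)).and hP)))).congr
    fun I ρ => ?_
  constructor
  · rintro ⟨p, -, y, -, q, -, h⟩
    exact ⟨p, y, q, h⟩
  · rintro ⟨p, y, q, h, h'⟩
    exact ⟨p, h.2.2.1, y, h.2.1.1, q, h.2.2.2.1, h, h'⟩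

theorem live (hx : PolyTime x) (ho : PolyTime o) :
    PolyDec fun I ρ => I.network.Live (x I ρ) (o I ρ) :=
  ((active hx).and ((eq ho (.const 0)).or (eq ho (.const 7)))).or
    ((exRel (P := fun _ _ _ _ _ => True) hx ho
      ((eq (.const 0) (.const 0)).congr fun _ _ => by simp)).congr fun I ρ => by
        simp only [and_true])

theorem attached (hl : PolyTime l) (hr : PolyTime r) (hx : PolyTime x) (ho : PolyTime o) :
    PolyDec fun I ρ => I.network.Attached (l I ρ) (r I ρ) (x I ρ) (o I ρ) :=
  have h2x := (PolyTime.const 2).mul hx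
  have h8n := (PolyTime.const 8).mul .n
  have a1 := eq hl h2x
  have a2 := eq hl (h2x.add (.const 1))
  have a3 := eq hr (.const 0)
  have a4 := eq (hr.add (.const 1)) h8n
  ((active hx).and
    (((eq ho (.const 0)).and ((a1.and a3).or (a2.and a4))).or
      ((eq ho (.const 7)).and ((a1.and a4).or (a2.and a3))))).or
  (exRel (P := fun I ρ p y q => l I ρ = 2 * x I ρ ∧ r I ρ = 8 * p + o I ρ ∨
      l I ρ = 2 * y ∧ r I ρ = 8 * q + o I ρ) hx ho
    ((a1.shift.shift.shift.and
      (eq hr.shift.shift.shift (((PolyTime.const 8).mul (.var 2)).add ho.shift.shift.shift))).or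
    ((eq hl.shift.shift.shift ((PolyTime.const 2).mul (.var 1))).and
      (eq hr.shift.shift.shift (((PolyTime.const 8).mul (.var 0)).add ho.shift.shift.shift)))))

theorem demand (hl : PolyTime l) (hr : PolyTime r) (hl' : PolyTime l') (hr' : PolyTime r') :
    PolyDec fun I ρ => I.network.Demand (l I ρ) (r I ρ) (l' I ρ) (r' I ρ) := by
  refine or ?_ ?_
  · have e8 := (PolyTime.const 8).mul (.var 0)
    refine (ex (P := fun I ρ x => ∃ p, p < I.n ∧ (I.network.Active x ∧ l I ρ = 2 * x ∧
      l' I ρ = 2 * x + 1 ∧ (r I ρ = 8 * p ∧ r' I ρ = 8 * p + 7 ∨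
        r I ρ = 8 * p + 7 ∧ r' I ρ = 8 * p))) .numVars
      (ex (P := fun I ρ p => I.network.Active (ρ 0) ∧ l I (fun m => ρ (m + 1)) = 2 * ρ 0 ∧
      l' I (fun m => ρ (m + 1)) = 2 * ρ 0 + 1 ∧
        (r I (fun m => ρ (m + 1)) = 8 * p ∧ r' I (fun m => ρ (m + 1)) = 8 * p + 7 ∨
        r I (fun m => ρ (m + 1)) = 8 * p + 7 ∧ r' I (fun m => ρ (m + 1)) = 8 * p)) .n
      ((active (.var 1)).and <| (eq hl.shift.shift ((PolyTime.const 2).mul (.var 1))).and <|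
        (eq hl'.shift.shift (((PolyTime.const 2).mul (.var 1)).add (.const 1))).and <|
        ((eq hr.shift.shift e8).and (eq hr'.shift.shift (e8.add (.const 7)))).or
        ((eq hr.shift.shift (e8.add (.const 7))).and (eq hr'.shift.shift e8))))).congr
      fun I ρ => ?_
    constructor
    · rintro ⟨x, -, p, hp, hx, h⟩
      exact ⟨x, p, hx, hp, h⟩
    · rintro ⟨x, p, hx, hp, h⟩
      exact ⟨x, hx.1, p, hp, hx, h⟩
  · refine (ex (P := fun I ρ x => ∃ o, o < 7 ∧ ∃ p y q, I.network.Rel x o p y q ∧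
      (l I ρ = 2 * x ∧ r I ρ = 8 * p + o ∧ l' I ρ = 2 * y ∧ r' I ρ = 8 * q + o)) .numVars
      (ex (P := fun I ρ o => ∃ p y q, I.network.Rel (ρ 0) o p y q ∧
        (l I (fun m => ρ (m + 1)) = 2 * ρ 0 ∧ r I (fun m => ρ (m + 1)) = 8 * p + o ∧
        l' I (fun m => ρ (m + 1)) = 2 * y ∧ r' I (fun m => ρ (m + 1)) = 8 * q + o)) (.const 7)
      (exRel (P := fun I ρ p y q => l I (fun m => ρ (m + 2)) = 2 * ρ 1 ∧
        r I (fun m => ρ (m + 2)) = 8 * p + ρ 0 ∧ l' I (fun m => ρ (m + 2)) = 2 * y ∧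
        r' I (fun m => ρ (m + 2)) = 8 * q + ρ 0) (.var 1) (.var 0)
      ((eq hl.shift.shift.shift.shift.shift ((PolyTime.const 2).mul (.var 4))).and <|
        (eq hr.shift.shift.shift.shift.shift (((PolyTime.const 8).mul (.var 2)).add (.var 3))).and
        <| (eq hl'.shift.shift.shift.shift.shift ((PolyTime.const 2).mul (.var 1))).and <|
        eq hr'.shift.shift.shift.shift.shift
          (((PolyTime.const 8).mul (.var 0)).add (.var 3)))))).congr fun I ρ => ?_
    constructor
    · rintro ⟨x, -, o, -, p, y, q, h⟩
      exact ⟨x, o, p, y, q, h⟩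
    · rintro ⟨x, o, p, y, q, h⟩
      have h1 := (I.network.bounds _ _ _ _ _ h.1).2.1
      exact ⟨x, h.1.1.1, o, by omega, p, y, q, h⟩

theorem arc (hu : PolyTime u) (hv : PolyTime v) :
    PolyDec fun I ρ => I.network.Arc (I.network.decode (u I ρ)) (I.network.decode (v I ρ)) := by
  have h8n : PolyTime fun I _ => 8 * I.network.n := (PolyTime.const 8).mul .n
  have hL := ((PolyTime.const 2).mul .numVars).mul h8n
  have hu' := hu.sub hL
  have hv' := hv.sub hL
  refine (((lt hu hL).and <| (lt hv hL).and <| (eq (hu.div h8n) (hv.div h8n)).and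
    (eq (hv.mod h8n) ((hu.mod h8n).add (.const 1)))).or ((lt hu hL).and <| (lt hv hL).not.and <|
      attached (hu.div h8n) (hu.mod h8n) (hv'.div (.const 8)) (hv'.mod (.const 8)))).congr
      fun I ρ => ?_
  unfold Network.decode
  split_ifs with h1 h2 h2 <;> simp only [Network.Arc, h1, h2, true_and, false_and, or_false,
    false_or, not_true_eq_false, not_false_eq_true]

theorem demandArc (hu : PolyTime u) (hv : PolyTime v) :
    PolyDec fun I ρ =>
      I.network.DemandArc (I.network.decode (u I ρ)) (I.network.decode (v I ρ)) := by
  have h8n : PolyTime fun I _ => 8 * I.network.n := (PolyTime.const 8).mul .n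
  have hL := ((PolyTime.const 2).mul .numVars).mul h8n
  refine ((lt hu hL).and <| (lt hv hL).and <|
    demand (hu.div h8n) (hu.mod h8n) (hv.div h8n) (hv.mod h8n)).congr fun I ρ => ?_
  unfold Network.decode
  split_ifs with h1 h2 h2 <;> simp only [Network.DemandArc, h1, h2, true_and, false_and]

end PolyDec

namespace PolyTime

theorem matrixArray {N : ColoredInstance → ℕ} {R : ColoredInstance → ℕ → ℕ → Prop}
    (hN : PolyTime fun I _ => N I) (hR : PolyDec fun I ρ => R I (ρ 0 / N I) (ρ 0 % N I)) :
    PolyTime fun I ρ => RAM.matrixArray (N I) (R I) (ρ 0) :=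
  PolyTime.congr ((PolyDec.lt (.var 0) (hN.mul hN)).and hR) fun I ρ => by
    unfold RAM.matrixArray
    congr

theorem input_arr_zero : PolyTime fun I ρ => I.network.toNDP.input.arr 0 (ρ 0) := by
  have hu := (var 0).div networkSize
  have hv := (var 0).mod networkSize
  exact matrixArray (N := fun I => I.network.size) (R := fun I u v =>
    ∃ (hu : u < I.network.size) (hv : v < I.network.size), I.network.graph.Adj ⟨u, hu⟩ ⟨v, hv⟩)
    networkSize ((((PolyDec.lt hu networkSize).and
    (PolyDec.lt hv networkSize)).and ((PolyDec.arc hu hv).or (PolyDec.arc hv hu))).congr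
    fun I ρ => ⟨fun h => ⟨h.1.1, h.1.2, h.2⟩, fun ⟨h, h', h''⟩ => ⟨⟨h, h'⟩, h''⟩⟩)

theorem input_arr_one : PolyTime fun I ρ => I.network.toNDP.input.arr 1 (ρ 0) := by
  have hu := (var 0).div networkSize
  have hv := (var 0).mod networkSize
  exact matrixArray (N := fun I => I.network.size) (R := fun I u v =>
    ∃ (hu : u < I.network.size) (hv : v < I.network.size),
      s(⟨u, hu⟩, ⟨v, hv⟩) ∈ I.network.demandSet)
    networkSize ((((PolyDec.lt hu networkSize).and
    (PolyDec.lt hv networkSize)).and ((PolyDec.demandArc hu hv).or (PolyDec.demandArc hv hu))).congr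
    fun I ρ => ⟨fun h => ⟨h.1.1, h.1.2, I.network.mem_demandSet.2 h.2⟩,
      fun ⟨h, h', h''⟩ => ⟨⟨h, h'⟩, I.network.mem_demandSet.1 h''⟩⟩)

open Classical in
theorem card_live : PolyTime fun I _ => I.network.live.card :=
  (sum (G := fun I _ x => ((Finset.range 8).filter fun o => I.network.Live x o).card) numVars
    (count (P := fun I ρ o => I.network.Live (ρ 0) o) (.const 8)
      (.live (.var 1) (.var 0)))).congr fun I ρ => by
    simp only [Network.live, Finset.card_filter, Finset.sum_product]

end PolyTime

end RAM

/-! ### Computable bounds -/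

theorem Computable.sum_range {g : ℕ → ℕ} (hg : Computable g) :
    Computable fun m => ∑ z ∈ Finset.range m, g z := by
  have h : Computable₂ fun (_ : ℕ) (q : ℕ × ℕ) => q.2 + g q.1 :=
    (Primrec.nat_add.to_comp.comp (Computable.snd.comp .snd)
      (hg.comp (Computable.fst.comp .snd))).to₂
  refine (Computable.nat_rec Computable.id (Computable.const 0) h).of_eq fun m => ?_
  induction m with
  | zero => rfl
  | succ m ih => exact (congrArg (· + g m) ih).trans (Finset.sum_range_succ g m).symm

theorem Primrec.pow_const {g : ℕ → ℕ} (hg : Primrec g) (e : ℕ) : Primrec fun k => g k ^ e := by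
  induction e with
  | zero => exact Primrec.const 1
  | succ e ih => exact (Primrec.nat_mul.comp ih hg).of_eq fun k => (pow_succ _ _).symm

/-- `f` need not be monotone, so a sum over all pairs with coordinates below m replaces it; their
codes are below m², and the sum stays computable. -/
theorem apply_le_sum_unpair (f : ℕ × ℕ → ℕ) {a b m : ℕ} (ha : a < m) (hb : b < m) :
    f (a, b) ≤ ∑ z ∈ Finset.range (m ^ 2), f z.unpair := by
  have h : Nat.pair a b < m ^ 2 := (Nat.pair_lt_max_add_one_sq a b).trans_le
    (Nat.pow_le_pow_left (max_lt ha hb) 2)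
  calc f (a, b) = f (Nat.pair a b).unpair := by rw [Nat.unpair_pair]
    _ ≤ _ := Finset.single_le_sum (f := fun z : ℕ => f z.unpair) (fun _ _ => Nat.zero_le _)
        (Finset.mem_range.2 h)

/-! ### The reduction -/

namespace ColoredInstance

theorem opt_toNDP_le (I : ColoredInstance) : I.network.toNDP.opt ≤ I.network.live.card := by
  obtain ⟨_, h⟩ := I.network.exists_card_unsat_le
  omega

theorem card_live_le_mul (I : ColoredInstance) : I.network.live.card ≤ 8 * I.network.V := by
  classical
  refine (Finset.card_filter_le _ _).trans ?_
  rw [Finset.card_product, Finset.card_range, Finset.card_range, Nat.mul_comm]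

/-- The verdict on an instance from a lower estimate `v` of the value of its network. -/
noncomputable def verdict (D : ℕ) (I : ColoredInstance) (v : ℕ) : ℕ :=
  if (D - 1) * I.network.live.card ≤ D * v then 1 else 0

theorem polyTime_verdict (D : ℕ) : RAM.PolyTime fun I ρ => verdict D I (ρ 0) :=
  RAM.PolyTime.congr (RAM.PolyDec.le ((RAM.PolyTime.const (D - 1)).mul .card_live)
    ((RAM.PolyTime.const D).mul (.var 0))) fun I ρ => by
    unfold verdict
    congr

variable {I : ColoredInstance} {c : ℝ} {D v : ℕ}

theorem verdict_eq_one (hD : 0 < D) (h : (I.opt : ℝ) = I.sigma)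
    (hv : (1 - 1 / (D : ℝ)) * I.network.toNDP.opt ≤ v) : verdict D I v = 1 := by
  rw [sigma_eq, Nat.cast_inj] at h
  have h1 : (I.network.live.card : ℝ) ≤ I.network.toNDP.opt :=
    Nat.cast_le.2 (I.card_live_le_opt_of_opt_eq h)
  have hD' : (1 : ℝ) ≤ D := Nat.one_le_cast.2 hD
  refine if_pos ?_
  have h2 : ((D : ℝ) - 1) * I.network.live.card ≤ D * v :=
    calc ((D : ℝ) - 1) * I.network.live.card ≤ (D - 1) * I.network.toNDP.opt :=
          mul_le_mul_of_nonneg_left h1 (by linarith)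
      _ = D * ((1 - 1 / (D : ℝ)) * I.network.toNDP.opt) := by field_simp
      _ ≤ _ := mul_le_mul_of_nonneg_left hv (by linarith)
  rw [← Nat.cast_one, ← Nat.cast_sub hD] at h2
  exact_mod_cast h2

/-- A positive verdict would give D (L − OPT) ≤ L ≤ 64σ for the network, while the gap gives (1 − c)
σ < 32800 (L − OPT). The two clash once D (1 − c) ≥ 32800 · 64 = 2099200. -/
theorem verdict_eq_zero (hc : c < 1) (hD : 2099200 ≤ D * (1 - c))
    (h : (I.opt : ℝ) < c * I.sigma) (hv : v ≤ I.network.toNDP.opt) : verdict D I v = 0 := by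
  refine if_neg fun hle => ?_
  rw [sigma_eq] at h
  have h1 : (I.pairs.card : ℝ) + 32800 * I.network.toNDP.opt ≤
    I.opt + 32800 * I.network.live.card := by exact_mod_cast I.card_pairs_add_le
  have h2 : (I.network.live.card : ℝ) ≤ 64 * I.pairs.card := by exact_mod_cast I.card_live_le
  have h3 : (D : ℝ) * I.network.live.card ≤ D * I.network.toNDP.opt + I.network.live.card := by
    have : D * I.network.live.card ≤ D * I.network.toNDP.opt + I.network.live.card := by
      have := Nat.mul_le_mul_left D hv
      rw [Nat.sub_mul] at hle
      omega
    exact_mod_cast this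
  have h0 : (0 : ℝ) ≤ I.opt := Nat.cast_nonneg _
  have hD' : (0 : ℝ) < D := by
    by_contra hD'
    nlinarith
  have h4 : (1 - c) * (I.pairs.card : ℝ) <
      32800 * (I.network.live.card - I.network.toNDP.opt) := by linarith
  have h5 : 2099200 * (I.pairs.card : ℝ) ≤ D * (1 - c) * I.pairs.card :=
    mul_le_mul_of_nonneg_right hD (Nat.cast_nonneg _)
  have h6 := mul_lt_mul_of_pos_left h4 hD'
  linarith

/-- A bound of every parameter of the disjoint paths instance. -/
def paramBound (k : ℕ) : ℕ := 24 * (k * 2 * k * k) + k + 2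

theorem primrec_paramBound : Primrec paramBound := by
  unfold paramBound
  have hV : Primrec fun k : ℕ => k * 2 * k * k :=
    Primrec.nat_mul.comp (Primrec.nat_mul.comp (Primrec.nat_mul.comp .id (.const 2)) .id) .id
  exact Primrec.nat_add.comp (Primrec.nat_add.comp (Primrec.nat_mul.comp (.const 24) hV) .id)
    (.const 2)

theorem exists_decision {oc : Bool} (hD : 0 < D) (hc : c < 1) (hDc : 2099200 ≤ D * (1 - c))
    (h : HasFPTApproximation oc (1 - 1 / (D : ℝ))) :
    ∃ (A : RAM.Prog) (f : ℕ → ℕ) (d : ℕ), (oc = true → Computable f) ∧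
      ∀ I : ColoredInstance, ∃ (t : ℕ) (s : RAM.State),
        RAM.Exec A I.input t s ∧ t ≤ f I.k * (I.n + 1) ^ d ∧
        ((I.opt : ℝ) = I.sigma → s.reg 0 = 1) ∧
        ((I.opt : ℝ) < c * I.sigma → s.reg 0 = 0) := by
  obtain ⟨A, f, d, hf, hA⟩ := h
  obtain ⟨P, T, ⟨C, e, hT⟩, hP⟩ := RAM.exists_reduction (J := fun I => I.network.toNDP)
    .networkSize .input_arr_zero .input_arr_one (polyTime_verdict D) A
  refine ⟨P, fun k => (∑ z ∈ Finset.range (paramBound k ^ 2), f z.unpair) * paramBound k ^ d +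
    C * paramBound k ^ e, d + e, fun hoc => ?_, fun I => ?_⟩
  · have h1 : Computable fun k => ∑ z ∈ Finset.range (paramBound k ^ 2), f z.unpair :=
      ((hf hoc).comp Primrec.unpair.to_comp).sum_range.comp
        (primrec_paramBound.pow_const 2).to_comp
    exact Primrec.nat_add.to_comp.comp
      (Primrec.nat_mul.to_comp.comp h1 (primrec_paramBound.pow_const d).to_comp)
      (Primrec.nat_mul.comp (.const C) (primrec_paramBound.pow_const e)).to_comp
  obtain ⟨t, s, hex, ht, hv1, hv2⟩ := hA I.network.toNDP
  have hV : I.network.V = I.k * 2 * I.k * I.k := rfl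
  have hpb : paramBound I.k = 24 * I.network.V + I.k + 2 := rfl
  have hn1 : 0 < I.n + 1 := Nat.succ_pos _
  have hN : I.network.toNDP.n + 1 ≤ paramBound I.k * (I.n + 1) := by
    have : I.network.toNDP.n = 2 * I.network.V * (8 * I.n) + 8 * I.network.V := rfl
    rw [this, hpb]
    nlinarith [Nat.zero_le (I.network.V * I.n), Nat.zero_le (I.k * I.n)]
  have hM : 8 * I.network.V + I.k + I.n + 1 ≤ paramBound I.k * (I.n + 1) := by
    rw [hpb]
    nlinarith [Nat.zero_le (I.network.V * I.n), Nat.zero_le (I.k * I.n)]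
  -- The answer is at most the number of special vertices, so evaluating it takes polynomial time in
  -- k and n.
  have hreg : s.reg 0 ≤ 8 * I.network.V := (hv2.trans I.opt_toNDP_le).trans I.card_live_le_mul
  obtain ⟨t', s', hex', ht', hs'⟩ := hP I t s (8 * I.network.V + I.k + I.n) hex (by omega)
    (by omega) (by omega)
  refine ⟨t', s', hex', ?_, fun h => ?_, fun h => ?_⟩
  · have hfle := apply_le_sum_unpair f (a := I.network.toNDP.G.pathwidth)
      (b := I.network.toNDP.G.feedbackVertexNumber) (m := paramBound I.k)
      (I.network.pathwidth_le.trans_lt (by omega))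
      (I.network.feedbackVertexNumber_le.trans_lt (by omega))
    set S := ∑ z ∈ Finset.range (paramBound I.k ^ 2), f z.unpair
    calc t' ≤ t + T (8 * I.network.V + I.k + I.n) := ht'
      _ ≤ S * (paramBound I.k * (I.n + 1)) ^ d + C * (paramBound I.k * (I.n + 1)) ^ e :=
        add_le_add (ht.trans (Nat.mul_le_mul hfle (Nat.pow_le_pow_left hN d)))
          ((hT _).trans (Nat.mul_le_mul_left _ (Nat.pow_le_pow_left hM e)))
      _ = S * paramBound I.k ^ d * (I.n + 1) ^ d + C * paramBound I.k ^ e * (I.n + 1) ^ e := by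
        rw [mul_pow, mul_pow]
        ring
      _ ≤ S * paramBound I.k ^ d * (I.n + 1) ^ (d + e) +
          C * paramBound I.k ^ e * (I.n + 1) ^ (d + e) :=
        add_le_add (Nat.mul_le_mul_left _ (Nat.pow_le_pow_right hn1 (by omega)))
          (Nat.mul_le_mul_left _ (Nat.pow_le_pow_right hn1 (by omega)))
      _ = _ := by ring
  · rw [hs', verdict_eq_one hD h hv1]
  · rw [hs', verdict_eq_zero hc hDc h hv2]

end ColoredInstance

theorem mainTheorem2 (onlyComputable : Bool) (hPIH : PIH onlyComputable) :
    (∃ c' : ℝ, 0 < c' ∧ c' < 1 ∧ ¬ HasFPTApproximation onlyComputable c') ∧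
      ¬ HasApproximationScheme onlyComputable := by
  obtain ⟨c, hc0, hc1, hPIH⟩ := hPIH
  obtain ⟨D, hD⟩ := exists_nat_ge (2099200 / (1 - c))
  have hDc : 2099200 ≤ D * (1 - c) := (div_le_iff₀ (by linarith)).1 hD
  have hD1 : (1 : ℝ) < D := by nlinarith
  have hno : ¬ HasFPTApproximation onlyComputable (1 - 1 / (D : ℝ)) := fun h =>
    hPIH (ColoredInstance.exists_decision (by exact_mod_cast hD1.trans' one_pos) hc1 hDc h)
  have hinv : 1 / (D : ℝ) < 1 := (div_lt_one (by linarith)).2 hD1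
  have hpos : 0 < 1 / (D : ℝ) := by positivity
  refine ⟨⟨1 - 1 / (D : ℝ), by linarith, by linarith, hno⟩, ?_⟩
  rintro ⟨f, g, hf, hfg⟩
  -- For the fixed ε = 1/D the exponent g(ε) is a constant, so the scheme contains the approximation
  -- algorithm just excluded.
  obtain ⟨A, hA⟩ := hfg (1 / D) (by rw [← Rat.cast_lt (K := ℝ)]; push_cast; exact hpos)
    (by rw [← Rat.cast_lt (K := ℝ)]; push_cast; exact hinv)
  exact hno ⟨A, f (1 / D), g (1 / D), fun h => hf h _, by simpa using hA⟩
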